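/- Let $B_n$ be the braid group on $n$ strands with Artin generators $\sigma_1,\dots,\sigma_{n-1}$. For a word $w$ in the $\sigma_i^{\pm1}$, let $CKh(\bar w)$ be the Khovanov complex over $\mathbb Z/2$ of the diagram of the closure of $w$, regarded as a diagram in an annulus around the braid axis. Its generators are the complete resolutions of the diagram with every circle labeled $v_+$ or $v_-$; the $0$-resolution of a positive crossing $\sigma_i$ and the $1$-resolution of a negative crossing $\sigma_i^{-1}$ are the braidlike ones. The differential is given by the merges $v_+v_+\mapsto v_+$, $v_+v_-,\,v_-v_+\mapsto v_-$, $v_-v_-\mapsto 0$ and the splits $v_+\mapsto v_+\otimes v_-+v_-\otimes v_+$, $v_-\mapsto v_-\otimes v_-$. Call a circle non-trivial if it meets an arc from the inner to the outer boundary of the annulus an odd number of times. The $k$-grading of a generator is the number of its non-trivial circles labeled $v_+$ minus the number of its non-trivial circles labeled $v_-$, and $\mathcal F_i\subseteq CKh(\bar w)$ is the subcomplex spanned by the generators with $k\le i$. Let $\psi(\bar w)$ be the braidlike resolution (all crossings resolved in the braidlike way) with all circles labeled $v_-$. Put $$\kappa(w)=n+\min\{i:[\psi(\bar w)]=0\in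 H(\mathcal F_i)\}$$ if $\psi(\bar w)$ is a boundary in $CKh(\bar w)$, and $\kappa(w)=\infty$ otherwise. **Theorem.** (1) $\kappa$ is well defined on $B_n$: words that represent the same element of $B_n$ have the same $\kappa$. It is constant on conjugacy classes of $B_n$. (2) $\kappa$ is not a transverse invariant, that is, it is not invariant under the equivalence relation on braids (of all numbers of strands) generated by conjugation and positive stabilization $B_n\ni\beta\mapsto\beta\sigma_n\in B_{n+1}$. It can increase by $2$ under positive stabilization. (3) Explicitly, let $B(0,0)=\sigma_3\sigma_2^{-2}\sigma_3^{2}\sigma_2\sigma_3^{-1}\sigma_1^{2}\sigma_2\sigma_1^{-1}\in B_4$. For a point $p$ of the innermost strand (the strand in position $4$) of this closed braid diagram let $S^pB(0,0)\in B_5$ be the braid obtained by inserting $\sigma_4$ at $p$. Then $\kappa(B(0,0))=2$. Moreover $\kappa(S^pB(0,0))=4$ for every $p$ on the innermost arc that leads from the crossing $\sigma_3^{-1}$ through the closure of the braid to the first crossing $\sigma_3$ (in particular $\kappa(B(0,0)\sigma_4)=4$), while $\kappa(S^pB(0,0))=2$ for $p$ on any of the other three innermost arcs. -/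

import Mathlib

noncomputable section

open scoped Classical

namespace BraidKh

/-! ### Braid groups -/

/-- Artin's relations for the braid group on `n` strands; the generators `σ_1, …, σ_{n-1}` are
indexed by `0, …, n - 2`. -/
def artinRels (n : ℕ) : Set (FreeGroup (Fin (n - 1))) :=
  {r | (∃ i j : Fin (n - 1), i.val + 1 = j.val ∧
        r = (.of i * .of j * .of i) * (.of j * .of i * .of j)⁻¹) ∨
      (∃ i j : Fin (n - 1), i.val + 2 ≤ j.val ∧
        r = (.of i * .of j) * (.of j * .of i)⁻¹)}

/-- The braid group `B_n` on `n` strands. -/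
abbrev BraidGroup (n : ℕ) : Type := PresentedGroup (artinRels n)

/-- A word in the Artin generators of `B_n` and their inverses. The letter `(i, true)` is the
positive crossing `σ_{i+1}`, the letter `(i, false)` is its inverse. -/
abbrev BraidWord (n : ℕ) : Type := List (Fin (n - 1) × Bool)

/-- The element of `B_n` represented by a word. -/
def BraidWord.toBraid {n : ℕ} (w : BraidWord n) : BraidGroup n :=
  PresentedGroup.mk (artinRels n) (FreeGroup.mk w)

/-! ### The closed braid diagram of a word and its resolutions

The diagram of the closure of `w` has one crossing for every letter of `w`. The strand in position
`p` at level `t` (just before letter number `t`) is recorded by the point `(p, t)`; the top level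
`w.length` is joined to level `0` by the `n` closing arcs. -/

/-- Points of the closed braid diagram: a strand position and a level. -/
abbrev Pt {n : ℕ} (w : BraidWord n) : Type := Fin n × Fin (w.length + 1)

/-- The position of the left strand of the `j`-th crossing. -/
def lft {n : ℕ} (w : BraidWord n) (j : Fin w.length) : Fin n :=
  ⟨(w.get j).1.val, by have := (w.get j).1.isLt; omega⟩

/-- The position of the right strand of the `j`-th crossing. -/
def rgt {n : ℕ} (w : BraidWord n) (j : Fin w.length) : Fin n :=
  ⟨(w.get j).1.val + 1, by have := (w.get j).1.isLt; omega⟩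

/-- A complete resolution: a choice of the `0`-resolution (`false`) or the `1`-resolution (`true`)
at every crossing. -/
abbrev Resolution {n : ℕ} (w : BraidWord n) : Type := Fin w.length → Bool

/-- The braidlike (oriented) resolution: `0` at positive and `1` at negative crossings. -/
def braidlike {n : ℕ} (w : BraidWord n) : Resolution w := fun j => !(w.get j).2

/-- Two points are adjacent in the resolved diagram. -/
inductive Joined {n : ℕ} (w : BraidWord n) (I : Resolution w) : Pt w → Pt w → Prop
  /-- the closing arcs of the braid closure -/
  | closing (p : Fin n) : Joined w I (p, Fin.last _) (p, 0)
  /-- strands that do not meet the `j`-th crossing go straight on -/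
  | away (j : Fin w.length) (p : Fin n) (hl : p ≠ lft w j) (hr : p ≠ rgt w j) :
      Joined w I (p, j.castSucc) (p, j.succ)
  /-- at a crossing with braidlike resolution both strands go straight on -/
  | left (j : Fin w.length) (h : I j = braidlike w j) :
      Joined w I (lft w j, j.castSucc) (lft w j, j.succ)
  | right (j : Fin w.length) (h : I j = braidlike w j) :
      Joined w I (rgt w j, j.castSucc) (rgt w j, j.succ)
  /-- at a crossing with the other resolution both strands turn back -/
  | cap (j : Fin w.length) (h : I j ≠ braidlike w j) :
      Joined w I (lft w j, j.castSucc) (rgt w j, j.castSucc)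
  | cup (j : Fin w.length) (h : I j ≠ braidlike w j) :
      Joined w I (lft w j, j.succ) (rgt w j, j.succ)

/-- The circles of a complete resolution: the connected components of the resolved diagram. -/
def Circle {n : ℕ} (w : BraidWord n) (I : Resolution w) : Type := Quot (Joined w I)

/-- The circle through a point. -/
def circ {n : ℕ} (w : BraidWord n) (I : Resolution w) (v : Pt w) : Circle w I := Quot.mk _ v

instance {n : ℕ} (w : BraidWord n) (I : Resolution w) : Finite (Circle w I) :=
  inferInstanceAs (Finite (Quot _))

instance {n : ℕ} (w : BraidWord n) (I : Resolution w) : Fintype (Circle w I) :=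
  Fintype.ofFinite _

/-! ### The Khovanov complex over `ℤ/2` -/

/-- Canonical generators: a complete resolution with a label `v₊` (`true`) or `v₋` (`false`) on
each of its circles. -/
structure Gen {n : ℕ} (w : BraidWord n) where
  res : Resolution w
  lab : Circle w res → Bool

instance {n : ℕ} (w : BraidWord n) : Finite (Gen w) :=
  Finite.of_injective
    (fun x : Gen w => (⟨x.res, x.lab⟩ : Σ I : Resolution w, (Circle w I → Bool)))
    (by rintro ⟨I, l⟩ ⟨J, m⟩ h; cases h; rfl)

instance {n : ℕ} (w : BraidWord n) : Fintype (Gen w) := Fintype.ofFinite _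

/-- The Khovanov chain group `CKh`, the `ℤ/2`-vector space on the (finitely many) canonical
generators; a chain is given by its coefficients. -/
abbrev CKh {n : ℕ} (w : BraidWord n) : Type := Gen w → ZMod 2

/-- `v_c` is a term of the product `v_a · v_b`: `v₊v₊ = v₊`, `v₊v₋ = v₋v₊ = v₋`, `v₋v₋ = 0`. -/
def MulTerm : Bool → Bool → Bool → Prop
  | true, true, true => True
  | true, false, false => True
  | false, true, false => True
  | _, _, _ => False

/-- `v_b ⊗ v_c` is a term of the coproduct of `v_a`: `v₊ ↦ v₊ ⊗ v₋ + v₋ ⊗ v₊`, `v₋ ↦ v₋ ⊗ v₋`. -/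
def ComulTerm : Bool → Bool → Bool → Prop
  | true, true, false => True
  | true, false, true => True
  | false, false, false => True
  | _, _, _ => False

/-- `y` is a term of `d x` along the edge of the cube of resolutions that changes the `j`-th
crossing from its `0`- to its `1`-resolution. The two opposite corners `a` and `b` of the crossing
lie on different arcs of either resolution of it, so the circles that the edge changes are those
through `a` and through `b`; they are merged if they are distinct, and otherwise the one circle
through both is split. All other circles keep their labels. -/
def EdgeTerm {n : ℕ} {w : BraidWord n} (j : Fin w.length) (x y : Gen w) : Prop :=
  let a : Pt w := (lft w j, j.castSucc)
  let b : Pt w := (rgt w j, j.succ)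
  let s : Pt w → Bool := fun v => x.lab (circ w x.res v)
  let t : Pt w → Bool := fun v => y.lab (circ w y.res v)
  x.res j = false ∧ y.res = Function.update x.res j true ∧
  (∀ v : Pt w, circ w x.res v ≠ circ w x.res a → circ w x.res v ≠ circ w x.res b → s v = t v) ∧
  (if circ w x.res a = circ w x.res b then ComulTerm (s a) (t a) (t b)
    else MulTerm (s a) (s b) (t a))

/-- The Khovanov differential, by its matrix: the coefficient of `y` in `d x` is `1` if `y` is a term
of `d x` along an edge of the cube (the edge is determined by the resolutions of `x` and `y`). -/
def d {n : ℕ} (w : BraidWord n) : CKh w →ₗ[ZMod 2] CKh w :=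
  Matrix.mulVecLin (Matrix.of fun y x : Gen w => if ∃ j, EdgeTerm j x y then 1 else 0)

/-! ### The annular filtration, the transverse element and `κ` -/

/-- A circle is non-trivial if it meets the arc `γ` from the inner to the outer boundary of the
annulus an odd number of times; `γ` is placed so that it crosses each of the `n` closing arcs once
and meets nothing else. -/
def Circle.Nontrivial {n : ℕ} {w : BraidWord n} {I : Resolution w} (c : Circle w I) : Prop :=
  Odd (Finset.card {p : Fin n | circ w I (p, 0) = c})

/-- The `k`-grading: non-trivial circles labeled `v₊` minus non-trivial circles labeled `v₋`. -/
def kGrading {n : ℕ} {w : BraidWord n} (x : Gen w) : ℤ :=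
  (Finset.card {c : Circle w x.res | c.Nontrivial ∧ x.lab c = true} : ℤ) -
    (Finset.card {c : Circle w x.res | c.Nontrivial ∧ x.lab c = false} : ℤ)

/-- The filtration level `F_i`, spanned by the generators with `k ≤ i`. -/
def F {n : ℕ} (w : BraidWord n) (i : ℤ) : Submodule (ZMod 2) (CKh w) :=
  Submodule.span (ZMod 2) {f | ∃ x : Gen w, kGrading x ≤ i ∧ f = Pi.single x 1}

/-- The cycles of `F_i`. -/
def cycles {n : ℕ} (w : BraidWord n) (i : ℤ) : Submodule (ZMod 2) (CKh w) :=
  F w i ⊓ LinearMap.ker (d w)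

/-- The homology `H(F_i)`: cycles of `F_i` modulo the image of `F_i` under `d`. -/
abbrev H {n : ℕ} (w : BraidWord n) (i : ℤ) : Type :=
  cycles w i ⧸ ((F w i).map (d w)).submoduleOf (cycles w i)

/-- Plamenevskaya's element `ψ`: the braidlike resolution with all circles labeled `v₋`. -/
def psi {n : ℕ} (w : BraidWord n) : CKh w :=
  Pi.single ⟨braidlike w, fun _ => false⟩ 1

/-- `[ψ] = 0` in `H(F_i)` (which includes that `ψ` is a cycle of `F_i`). -/
def PsiVanishes {n : ℕ} (w : BraidWord n) (i : ℤ) : Prop :=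
  ∃ h : psi w ∈ cycles w i, (Submodule.Quotient.mk ⟨psi w, h⟩ : H w i) = 0

/-- `κ` of the closed braid diagram of a word: `n + min {i | [ψ] = 0 ∈ H(F_i)}` if `ψ` is a boundary
and `∞` otherwise. -/
def kappa {n : ℕ} (w : BraidWord n) : WithTop ℤ :=
  if psi w ∈ LinearMap.range (d w) then (((n : ℤ) + sInf {i : ℤ | PsiVanishes w i} : ℤ) : WithTop ℤ)
  else ⊤

/-! ### Positive stabilization and transverse equivalence of braids -/

/-- A word on `n + 1` strands seen as a word on `n + 2` strands. -/
def BraidWord.lift {n : ℕ} (w : BraidWord (n + 1)) : BraidWord (n + 2) :=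
  w.map fun s => (Fin.castSucc (n := n) s.1, s.2)

/-- The positive crossing `σ_{n+1}` of the two rightmost of `n + 2` strands. -/
def lastCrossing (n : ℕ) : Fin (n + 2 - 1) × Bool := (Fin.last n, true)

/-- Positive stabilization `S^p` of a closed braid diagram on `n + 1` strands at the innermost point
`p = (n, t)` just before letter number `t` (the axis is on the right, so the strand in the last
position is the innermost one): the positive crossing
of the innermost strand with one new strand is inserted there. -/
def BraidWord.stabAt {n : ℕ} (w : BraidWord (n + 1)) (t : Fin (w.length + 1)) : BraidWord (n + 2) :=
  BraidWord.lift (w.take t) ++ lastCrossing n :: BraidWord.lift (w.drop t)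

/-- Elementary moves between braids (of any number of strands): conjugation, and positive
stabilization `β ↦ β σ_m`, `β ∈ B_m`, `m ≥ 1`. -/
inductive TransverseMove : (Σ n : ℕ, BraidGroup n) → (Σ n : ℕ, BraidGroup n) → Prop
  | conj {n : ℕ} (β γ : BraidGroup n) : TransverseMove ⟨n, β⟩ ⟨n, γ * β * γ⁻¹⟩
  | stab {n : ℕ} (w : BraidWord (n + 1)) :
      TransverseMove ⟨n + 1, w.toBraid⟩ ⟨n + 2, BraidWord.toBraid (w.stabAt (Fin.last _))⟩

/-- Transverse equivalence: a sequence of conjugations, positive stabilizations and positive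
destabilizations. -/
def TransverseEquiv : (Σ n : ℕ, BraidGroup n) → (Σ n : ℕ, BraidGroup n) → Prop :=
  Relation.EqvGen TransverseMove

/-- The 4-braid word `σ₃ σ₂⁻² σ₃² σ₂ σ₃⁻¹ σ₁² σ₂ σ₁⁻¹`. -/
def B00 : BraidWord 4 :=
  [(2, true), (1, false), (1, false), (2, true), (2, true), (1, true), (2, false),
    (0, true), (0, true), (1, true), (0, false)]

end BraidKh

end

noncomputable section

open scoped Classical

/-! ### Equivalence relations that differ by a saddle, and their non-trivial classes. -/

namespace BraidKh

/-! Every point v of the diagram acts on `CKh` by X_v, the multiplication by v₋ on the circle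
through v. These operators commute, have square zero and commute with `d`. The part of `CKh` at a
resolution I is generated over them by the vector `vac I` with all labels v₊, subject to X_u = X_v
for u, v on one circle. So `d` is known from `d (vac I)`, which is a sum over the edges of the cube
of saddle maps `theta`: the identity for a merge, X_a + X_b for a split (`d_vac`, `d_X`). That every
edge is a merge or a split follows from orienting the strands alternately up and down: the circles
become cycles of a permutation, and changing a crossing multiplies it by a transposition
(`saddle_mul_swap`).

Chain maps are given in the same way, by their values on the `vac I` and on one more vector if a
small circle misses the rest of the diagram (`Outer.fmap`). They are filtered if these values are
`Adm`, that is, sit in the filtration as v₊ on all circles does. Saddles never raise k, so `theta`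
preserves this (`Adm.theta`).

Invariance. Equality of `kappa` needs only filtered chain maps in both directions that send ψ to ψ
(`KEquiv.kappa_eq`). For conjugation and far commutation they identify the cubes. For a cancelling
pair and for the braid relation they are the maps from Gaussian elimination known from the
Reidemeister moves II and III; their corrections are compositions with saddles and do not affect ψ.
Words with equal `kappa` in every context form a congruence on the free monoid of letters. In the
quotient the letters are units that satisfy Artin's relations, so the quotient map factors through
the braid group (`kHom`, `kappa_eq_of_toBraid_eq`).

The example. An upper bound for κ is an explicit chain with boundary ψ (`psiVanishes_of_boundsPsi`).
A lower bound is a functional, the sum of the coefficients at all-v₋ generators over a list of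
resolutions, that is 1 on ψ and 0 on the boundaries of F_i (`not_psiVanishes_of_detectsPsi`). A
generator whose differential contains an all-v₋ generator has at most one circle labeled v₊, so this
is a short finite check. Both kinds of certificate are evaluated, with the circles found by joining
labels of arcs. The chain for `B00` carries over to a stabilization, with the new strand labeled v₋,
if the circle through p is labeled v₋ in all its terms. On one of the four innermost arcs one term
has v₊ there; the correction labels the new strand v₊, which raises k by 2. The functional shows
that this cannot be avoided. -/

/-- Commuting square-zero operators, indexed by `V`, on a filtered vector space over `ℤ/2`. -/
structure FiltOps (V N : Type*) [AddCommGroup N] [Module (ZMod 2) N] where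
  X : V → Module.End (ZMod 2) N
  comm : ∀ u v m, X u (X v m) = X v (X u m)
  sq : ∀ v m, X v (X v m) = 0
  F : ℤ → Submodule (ZMod 2) N
  mono : ∀ {i j}, i ≤ j → F i ≤ F j

/-- `E'` arises from `E` by joining the different classes of `a` and `b`. -/
structure Fuse {V : Type*} (E E' : Setoid V) (a b : V) : Prop where
  ne : ¬ E a b
  iff : ∀ u v, E' u v ↔ E u v ∨ ((E u a ∨ E u b) ∧ (E v a ∨ E v b))

/-- One of the equivalence relations arises from the other one by joining the classes of `a`, `b`. -/
def Saddle {V : Type*} (E E' : Setoid V) (a b : V) : Prop := Fuse E E' a b ∨ Fuse E' E a b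

theorem Saddle.symm {V : Type*} {E E' : Setoid V} {a b : V} (h : Saddle E E' a b) :
    Saddle E' E a b := Or.symm h

theorem Fuse.le {V : Type*} {E E' : Setoid V} {a b : V} (h : Fuse E E' a b) {u v : V}
    (k : E u v) : E' u v := (h.iff u v).2 (Or.inl k)

theorem Fuse.joined {V : Type*} {E E' : Setoid V} {a b : V} (h : Fuse E E' a b) : E' a b :=
  (h.iff a b).2 (Or.inr ⟨Or.inl (E.refl a), Or.inr (E.refl b)⟩)

theorem Saddle.fuse {V : Type*} {E E' : Setoid V} {a b : V} (h : Saddle E E' a b)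
    (k : ¬ E a b) : Fuse E E' a b := h.resolve_right fun h' => k h'.joined

theorem Saddle.fuse' {V : Type*} {E E' : Setoid V} {a b : V} (h : Saddle E E' a b)
    (k : E a b) : Fuse E' E a b := h.resolve_left fun h' => h'.ne k

/-! ### How the number of non-trivial classes changes under a saddle. -/

section Count

variable {V : Type*} {n : ℕ} (cl : Fin n → V)

/-- The closing arcs on the class of `v`. -/
def trace (E : Setoid V) (v : V) : Finset (Fin n) := {p | E (cl p) v}

/-- The non-trivial classes, given by their closing arcs. -/
def oddTraces (E : Setoid V) : Finset (Finset (Fin n)) :=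
  {C | Odd C.card ∧ ∃ v, C = trace cl E v}

/-- A point is non-trivial if it lies on a class with an odd number of closing arcs. -/
def NT (E : Setoid V) (v : V) : Prop := Odd (trace cl E v).card

variable {cl}

theorem mem_trace {E : Setoid V} {v : V} {p : Fin n} : p ∈ trace cl E v ↔ E (cl p) v := by
  simp [trace]

theorem trace_congr {E : Setoid V} {u v : V} (h : E u v) : trace cl E u = trace cl E v := by
  ext p; simp only [mem_trace]
  exact ⟨fun k => E.trans k h, fun k => E.trans k (E.symm h)⟩

theorem NT_congr {E : Setoid V} {u v : V} (h : E u v) : NT cl E u ↔ NT cl E v := by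
  rw [NT, NT, trace_congr h]

theorem trace_disjoint {E : Setoid V} {u v : V} (h : ¬ E u v) :
    Disjoint (trace cl E u) (trace cl E v) := by
  rw [Finset.disjoint_left]
  intro p hp hq
  rw [mem_trace] at hp hq
  exact h (E.trans (E.symm hp) hq)

theorem mem_oddTraces {E : Setoid V} {C : Finset (Fin n)} :
    C ∈ oddTraces cl E ↔ Odd C.card ∧ ∃ v, C = trace cl E v := by
  simp [oddTraces]

theorem mem_oddTraces' {E : Setoid V} {C : Finset (Fin n)} :
    C ∈ oddTraces cl E ↔ Odd C.card ∧ ∃ p, C = trace cl E (cl p) := by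
  rw [mem_oddTraces]
  refine and_congr_right fun ho => ⟨?_, fun ⟨p, hp⟩ => ⟨_, hp⟩⟩
  rintro ⟨v, rfl⟩
  obtain ⟨p, hp⟩ := Finset.card_pos.1 ho.pos
  exact ⟨p, (trace_congr (mem_trace.1 hp)).symm⟩

/-- The number of non-trivial classes depends only on how the closing arcs are connected. -/
theorem oddTraces_eq {W : Type*} {cl' : Fin n → W} {E : Setoid V} {E' : Setoid W}
    (h : ∀ p q, E (cl p) (cl q) ↔ E' (cl' p) (cl' q)) : oddTraces cl E = oddTraces cl' E' := by
  have ht : ∀ p, trace cl E (cl p) = trace cl' E' (cl' p) := fun p => by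
    ext q; simp only [mem_trace, h]
  ext C
  simp only [mem_oddTraces', ht]

theorem Fuse.trace_of_not {E E' : Setoid V} {a b v : V} (h : Fuse E E' a b)
    (ha : ¬ E v a) (hb : ¬ E v b) : trace cl E' v = trace cl E v := by
  ext p; simp only [mem_trace, h.iff]; tauto

theorem Fuse.trace_left {E E' : Setoid V} {a b : V} (h : Fuse E E' a b) :
    trace cl E' a = trace cl E a ∪ trace cl E b := by
  ext p
  simp only [Finset.mem_union, mem_trace, h.iff]
  have := E.refl a
  tauto

theorem Fuse.NT_left {E E' : Setoid V} {a b : V} (h : Fuse E E' a b) :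
    NT cl E' a ↔ ¬ (NT cl E a ↔ NT cl E b) := by
  rw [NT, NT, NT, h.trace_left, Finset.card_union_of_disjoint (trace_disjoint h.ne),
    Nat.odd_add, Nat.odd_iff, Nat.even_iff, Nat.odd_iff]
  omega

theorem Fuse.NT_of_not {E E' : Setoid V} {a b v : V} (h : Fuse E E' a b)
    (ha : ¬ E v a) (hb : ¬ E v b) : NT cl E' v ↔ NT cl E v := by
  rw [NT, NT, h.trace_of_not ha hb]

/-- The indicator of a proposition. -/
def ind (P : Prop) : ℤ := if P then 1 else 0

/-- Only the classes of `a` and `b` change: their disjoint traces are replaced by the union. `R`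
collects the odd traces of all other classes, which both relations have in common. -/
theorem Fuse.card_oddTraces {E E' : Setoid V} {a b : V} (h : Fuse E E' a b) :
    ((oddTraces cl E').card : ℤ) =
      (oddTraces cl E).card - ind (NT cl E a) - ind (NT cl E b) + ind (NT cl E' a) := by
  set R := ((oddTraces cl E).erase (trace cl E a)).erase (trace cl E b) with hR
  -- Equal disjoint traces are empty, hence even. So two erasures never hit the same odd trace
  -- twice.
  have hab : trace cl E a ≠ trace cl E b ∨ ¬ NT cl E b := by
    by_contra hc
    push Not at hc
    have hd := trace_disjoint (cl := cl) h.ne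
    rw [hc.1, disjoint_self] at hd
    have := hc.2
    rw [NT, hd] at this
    simp at this
  have ma : trace cl E a ∈ oddTraces cl E ↔ NT cl E a := by
    rw [mem_oddTraces]; exact ⟨fun k => k.1, fun k => ⟨k, a, rfl⟩⟩
  have mb : trace cl E b ∈ oddTraces cl E ↔ NT cl E b := by
    rw [mem_oddTraces]; exact ⟨fun k => k.1, fun k => ⟨k, b, rfl⟩⟩
  have h1 : ((oddTraces cl E).card : ℤ) = R.card + ind (NT cl E a) + ind (NT cl E b) := by
    have e1 : (((oddTraces cl E).erase (trace cl E a)).card : ℤ) =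
        (oddTraces cl E).card - ind (NT cl E a) := by
      by_cases k : NT cl E a
      · rw [Finset.card_erase_of_mem (ma.2 k), ind, if_pos k]
        have := Finset.card_pos.2 ⟨_, ma.2 k⟩
        omega
      · rw [Finset.erase_eq_of_notMem (fun c => k (ma.1 c)), ind, if_neg k]; simp
    have e2 : (R.card : ℤ) = ((oddTraces cl E).erase (trace cl E a)).card - ind (NT cl E b) := by
      by_cases k : NT cl E b
      · have hm : trace cl E b ∈ (oddTraces cl E).erase (trace cl E a) :=
          Finset.mem_erase.2 ⟨(hab.resolve_right (not_not.2 k)).symm, mb.2 k⟩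
        rw [hR, Finset.card_erase_of_mem hm, ind, if_pos k]
        have := Finset.card_pos.2 ⟨_, hm⟩
        omega
      · rw [hR, Finset.erase_eq_of_notMem (fun c => k (mb.1 (Finset.mem_of_mem_erase c))),
          ind, if_neg k]; simp
    omega
  -- An odd trace is not empty, so it differs from every trace that is disjoint from it.
  have key : ∀ v, ¬ E v a → ¬ E v b → NT cl E v →
      trace cl E v ≠ trace cl E' a ∧ trace cl E v ≠ trace cl E a ∧ trace cl E v ≠ trace cl E b := by
    intro v ha hb hv
    obtain ⟨p, hp⟩ := Finset.card_pos.1 (Odd.pos hv)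
    refine ⟨fun k => ?_, fun k => ?_, fun k => ?_⟩
    · have hp' := hp
      rw [k, h.trace_left, Finset.mem_union] at hp'
      rcases hp' with hp' | hp'
      · exact Finset.disjoint_left.1 (trace_disjoint ha) hp hp'
      · exact Finset.disjoint_left.1 (trace_disjoint hb) hp hp'
    · exact Finset.disjoint_left.1 (trace_disjoint ha) hp (k ▸ hp)
    · exact Finset.disjoint_left.1 (trace_disjoint hb) hp (k ▸ hp)
  have hRmem : ∀ C, C ∈ R ↔ ∃ v, C = trace cl E v ∧ ¬ E v a ∧ ¬ E v b ∧ NT cl E v := by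
    intro C
    rw [hR, Finset.mem_erase, Finset.mem_erase, mem_oddTraces]
    constructor
    · rintro ⟨hb, ha, ho, v, rfl⟩
      exact ⟨v, rfl, fun k => ha (trace_congr k), fun k => hb (trace_congr k), ho⟩
    · rintro ⟨v, rfl, ha, hb, hv⟩
      have := key v ha hb hv
      exact ⟨this.2.2, this.2.1, hv, v, rfl⟩
  have h2 : ((oddTraces cl E').card : ℤ) = R.card + ind (NT cl E' a) := by
    have hmem : ∀ C, C ∈ oddTraces cl E' ↔ C ∈ R ∨ (C = trace cl E' a ∧ NT cl E' a) := by
      intro C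
      rw [mem_oddTraces, hRmem]
      constructor
      · rintro ⟨ho, v, rfl⟩
        by_cases hv : E' v a
        · right; rw [trace_congr hv] at ho ⊢; exact ⟨rfl, ho⟩
        · have ha : ¬ E v a := fun k => hv (h.le k)
          have hb : ¬ E v b := fun k => hv (E'.trans (h.le k) (E'.symm h.joined))
          left
          rw [h.trace_of_not ha hb] at ho ⊢
          exact ⟨v, rfl, ha, hb, ho⟩
      · rintro (⟨v, rfl, ha, hb, hv⟩ | ⟨rfl, ho⟩)
        · exact ⟨hv, v, (h.trace_of_not ha hb).symm⟩
        · exact ⟨ho, a, rfl⟩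
    by_cases k : NT cl E' a
    · have : oddTraces cl E' = insert (trace cl E' a) R := by
        ext C; rw [hmem, Finset.mem_insert]; tauto
      rw [this, Finset.card_insert_of_notMem, ind, if_pos k]
      · simp
      · rw [hRmem]; rintro ⟨v, hv, ha, hb, hn⟩; exact (key v ha hb hn).1 hv.symm
    · have : oddTraces cl E' = R := by
        ext C; rw [hmem]; tauto
      rw [this, ind, if_neg k]; simp
  omega

end Count

end BraidKh

/-! ### The algebra of the operators: compatible vectors, saddle maps and their effect on the
filtration. -/

namespace BraidKh

namespace FiltOps

variable {V N : Type*} [AddCommGroup N] [Module (ZMod 2) N] (O : FiltOps V N)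

theorem add_self_zmod2 (m : N) : m + m = 0 := by
  rw [← two_smul (ZMod 2), show (2 : ZMod 2) = 0 from rfl, zero_smul]

/-- The product of the operators in a list. -/
def xs (S : List V) : Module.End (ZMod 2) N := (S.map O.X).prod

@[simp] theorem xs_nil (m : N) : O.xs [] m = m := rfl

@[simp] theorem xs_cons (v : V) (S : List V) (m : N) : O.xs (v :: S) m = O.X v (O.xs S m) := by
  simp [xs]

theorem X_xs (v : V) (S : List V) (m : N) : O.X v (O.xs S m) = O.xs S (O.X v m) := by
  induction S with
  | nil => rfl
  | cons u S ih => rw [xs_cons, xs_cons, O.comm, ih]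

theorem xs_comm_of (f : Module.End (ZMod 2) N) (h : ∀ v m, f (O.X v m) = O.X v (f m)) (S : List V)
    (m : N) : f (O.xs S m) = O.xs S (f m) := by
  induction S with
  | nil => rfl
  | cons u S ih => rw [xs_cons, xs_cons, h, ih]

theorem xs_perm {S T : List V} (h : S.Perm T) (m : N) : O.xs S m = O.xs T m := by
  induction h with
  | nil => rfl
  | cons v _ ih => rw [xs_cons, xs_cons, ih]
  | swap u v S => simp only [xs_cons]; exact O.comm _ _ _
  | trans _ _ h1 h2 => exact h1.trans h2

/-- On the vector `m` operators at equivalent points agree. -/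
def Compat (E : Setoid V) (m : N) : Prop := ∀ u v, E u v → O.X u m = O.X v m

variable {O}

theorem Compat.xs {E : Setoid V} {m : N} (h : O.Compat E m) (S : List V) :
    O.Compat E (O.xs S m) := fun u v k => by rw [X_xs, X_xs, h u v k]

theorem Compat.X {E : Setoid V} {m : N} (h : O.Compat E m) (w : V) :
    O.Compat E (O.X w m) := fun u v k => by rw [O.comm, O.comm v, h u v k]

theorem Compat.zero {E : Setoid V} : O.Compat E 0 := fun u v _ => by simp

theorem Compat.add {E : Setoid V} {m m' : N} (h : O.Compat E m) (h' : O.Compat E m') :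
    O.Compat E (m + m') := fun u v k => by simp [h u v k, h' u v k]

theorem Compat.xs_zero_of_mem {E : Setoid V} {m : N} (h : O.Compat E m) {u : V} {S : List V}
    (hu : ∃ s ∈ S, E u s) : O.X u (O.xs S m) = 0 := by
  obtain ⟨s, hs, hE⟩ := hu
  rw [O.xs_perm (List.perm_cons_erase hs), xs_cons, O.comm, (h.xs _) u s hE, O.sq]

/-- This is v₋v₋ = 0: a list that meets some class twice applies the square of one operator. -/
theorem Compat.xs_zero {E : Setoid V} {m : N} (h : O.Compat E m) {S : List V}
    (hS : ¬ S.Pairwise fun u v => ¬ E u v) : O.xs S m = 0 := by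
  induction S with
  | nil => simp at hS
  | cons u S ih =>
    rw [List.pairwise_cons] at hS
    by_cases k : ∀ s ∈ S, ¬ E u s
    · rw [xs_cons, ih fun c => hS ⟨k, c⟩, map_zero]
    · push Not at k
      rw [xs_cons, h.xs_zero_of_mem k]

theorem Compat.of_fuse {E E' : Setoid V} {a b : V} {m : N} (h : O.Compat E' m)
    (k : Fuse E E' a b) : O.Compat E m := fun u v e => h u v (k.le e)

/-- Since squares vanish, X_a(X_a + X_b) = X_aX_b = X_b(X_a + X_b). So the operators at the two
halves agree on X_a m + X_b m, which is the coproduct of v₊. -/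
theorem Compat.split {E E' : Setoid V} {a b : V} {m : N} (h : O.Compat E' m)
    (k : Fuse E' E a b) : O.Compat E (O.X a m + O.X b m) := by
  have key : ∀ u, E' u a ∨ E' u b → O.X u (O.X a m + O.X b m) = O.X a (O.X b m) := by
    rintro u (hu | hu)
    · rw [map_add, h.X a u a hu, h.X b u a hu, O.sq, zero_add]
    · rw [map_add, h.X a u b hu, h.X b u b hu, O.sq, add_zero, O.comm]
  intro u v e
  rcases (k.iff u v).1 e with e | ⟨hu, hv⟩
  · exact ((h.X a).add (h.X b)) u v e
  · rw [key u hu, key v hv]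

variable (O)

/-- The effect of the saddle at `a`, `b` on the vector with all labels `v₊`. -/
def theta (E : Setoid V) (a b : V) : Module.End (ZMod 2) N :=
  if E a b then O.X a + O.X b else 1

variable {O}

theorem theta_of {E : Setoid V} {a b : V} (h : E a b) (m : N) :
    O.theta E a b m = O.X a m + O.X b m := by rw [theta, if_pos h]; rfl

theorem theta_of_not {E : Setoid V} {a b : V} (h : ¬ E a b) (m : N) :
    O.theta E a b m = m := by rw [theta, if_neg h]; rfl

theorem X_theta (E : Setoid V) (a b v : V) (m : N) :
    O.X v (O.theta E a b m) = O.theta E a b (O.X v m) := by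
  by_cases h : E a b
  · rw [theta_of h, theta_of h, map_add, O.comm, O.comm v]
  · rw [theta_of_not h, theta_of_not h]

theorem xs_theta (E : Setoid V) (a b : V) (S : List V) (m : N) :
    O.xs S (O.theta E a b m) = O.theta E a b (O.xs S m) :=
  (xs_comm_of O _ (fun v m => (X_theta E a b v m).symm) S m).symm

theorem Compat.theta {E E' : Setoid V} {a b : V} {m : N} (h : O.Compat E' m)
    (k : Saddle E E' a b) : O.Compat E (O.theta E a b m) := by
  by_cases e : E a b
  · rw [theta_of e]; exact h.split (k.fuse' e)
  · rw [theta_of_not e]; exact h.of_fuse (k.fuse e)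

theorem Compat.theta_congr {E E' : Setoid V} {a b a' b' : V} {m : N} (h : O.Compat E' m)
    (ha : E a a') (hb : E b b') (ha' : E' a a') (hb' : E' b b') :
    O.theta E a b m = O.theta E a' b' m := by
  by_cases e : E a b
  · rw [theta_of e, theta_of (E.trans (E.symm ha) (E.trans e hb)), h _ _ ha', h _ _ hb']
  · rw [theta_of_not e, theta_of_not fun e' => e (E.trans ha (E.trans e' (E.symm hb)))]

/-- A saddle followed by the reverse saddle. -/
theorem theta_reverse {E E' : Setoid V} {a b : V} (k : Saddle E E' a b) (m : N) :
    O.theta E a b (O.theta E' a b m) = O.X a m + O.X b m := by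
  by_cases e : E a b
  · rw [theta_of e, theta_of_not (k.fuse' e).ne]
  · rw [theta_of_not e, theta_of (k.fuse e).joined]

/-- If joining the classes of `a` and `b` also joins the distinct classes of `c` and `d`, then these
are the same two classes, and the roles of the pairs may be exchanged. -/
theorem cross_pairs {E : Setoid V} {a b c d : V} (hcd : ¬ E c d)
    (h : E c d ∨ ((E c a ∨ E c b) ∧ (E d a ∨ E d b))) :
    E a b ∨ ((E a c ∨ E a d) ∧ (E b c ∨ E b d)) := by
  rcases h with h | ⟨h1 | h1, h2 | h2⟩
  · exact absurd h hcd
  · exact absurd (E.trans h1 (E.symm h2)) hcd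
  · exact Or.inr ⟨Or.inl (E.symm h1), Or.inr (E.symm h2)⟩
  · exact Or.inr ⟨Or.inr (E.symm h2), Or.inl (E.symm h1)⟩
  · exact absurd (E.trans h1 (E.symm h2)) hcd

/-- Two saddles commute. -/
theorem Compat.face {E00 E10 E01 E11 : Setoid V} {a b c d : V} {m : N} (h : O.Compat E11 m)
    (h1 : Saddle E00 E10 a b) (h2 : Saddle E10 E11 c d) (h3 : Saddle E00 E01 c d)
    (h4 : Saddle E01 E11 a b) :
    O.theta E00 a b (O.theta E10 c d m) = O.theta E00 c d (O.theta E01 a b m) := by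
  -- The cases ask which saddles out of `E00` split a class. If one splits and the other merges,
  -- each keeps its kind after the other.
  by_cases e1 : E00 a b <;> by_cases e3 : E00 c d
  · have f1 := h1.fuse' e1
    have f3 := h3.fuse' e3
    rw [theta_of e1, theta_of e3]
    by_cases e2 : E10 c d <;> by_cases e4 : E01 a b
    · rw [theta_of e2, theta_of e4]
      simp only [map_add]
      rw [O.comm c a, O.comm c b, O.comm d a, O.comm d b]; abel
    · exact absurd ((h2.fuse' e2).le ((h4.fuse e4).joined)) f1.ne
    · exact absurd ((h4.fuse' e4).le ((h2.fuse e2).joined)) f3.ne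
    -- Both second saddles undo the splitting. Each side is then a sum of two equal terms, which is
    -- zero modulo 2.
    · rw [theta_of_not e2, theta_of_not e4, h _ _ (h4.fuse e4).joined, h _ _ (h2.fuse e2).joined,
        add_self_zmod2, add_self_zmod2]
  · have f1 := h1.fuse' e1
    have f3 := h3.fuse e3
    rw [theta_of e1, theta_of_not e3, theta_of_not fun e => e3 (f1.le e), theta_of (f3.le e1)]
  · have f1 := h1.fuse e1
    have f3 := h3.fuse' e3
    rw [theta_of_not e1, theta_of e3, theta_of (f1.le e3), theta_of_not fun e => e1 (f3.le e)]
  · have f1 := h1.fuse e1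
    have f3 := h3.fuse e3
    rw [theta_of_not e1, theta_of_not e3]
    -- Both first saddles merge. The second ones split exactly if both pairs join the same two
    -- classes.
    have e24 : E10 c d ↔ E01 a b := by
      rw [f1.iff, f3.iff]
      exact ⟨cross_pairs e3, cross_pairs e1⟩
    by_cases e2 : E10 c d
    · have e4 := e24.1 e2
      rw [theta_of e2, theta_of e4]
      have g2 := h2.fuse' e2
      have g4 := h4.fuse' e4
      -- It remains to see X_c + X_d = X_a + X_b on `m`. In `E11` the points `a` and `b` lie on
      -- different halves of the split class, and each half contains `c` or `d`.
      have hac : E10 a c ∧ E10 b c ∨ E10 a d ∧ E10 b d := by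
        rcases (f1.iff c d).1 e2 with k | ⟨k1, -⟩
        · exact absurd k e3
        · left
          have j := f1.joined
          rcases k1 with k1 | k1
          · exact ⟨E10.symm (f1.le k1), E10.trans (E10.symm j) (E10.symm (f1.le k1))⟩
          · exact ⟨E10.trans j (E10.symm (f1.le k1)), E10.symm (f1.le k1)⟩
      have ha : E11 a c ∨ E11 a d := by
        have : E10 a c := by
          rcases hac with k | k
          · exact k.1
          · exact E10.trans k.1 (E10.symm e2)
        rcases (g2.iff a c).1 this with k | ⟨k, -⟩
        · exact Or.inl k
        · exact k
      have hb : E11 b c ∨ E11 b d := by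
        have : E10 b c := by
          rcases hac with k | k
          · exact k.2
          · exact E10.trans k.2 (E10.symm e2)
        rcases (g2.iff b c).1 this with k | ⟨k, -⟩
        · exact Or.inl k
        · exact k
      rcases ha with ha | ha <;> rcases hb with hb | hb
      · exact absurd (E11.trans ha (E11.symm hb)) g4.ne
      · rw [h _ _ ha, h _ _ hb]
      · rw [h _ _ ha, h _ _ hb, add_comm]
      · exact absurd (E11.trans ha (E11.symm hb)) g4.ne
    · rw [theta_of_not e2, theta_of_not fun k => e2 (e24.2 k)]

section Adm

variable {n : ℕ}

variable (O) in
/-- The vector `m` sits in the filtration like the vector with all labels `v₊` on the classes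
of `E`. -/
structure Adm (cl : Fin n → V) (E : Setoid V) (m : N) : Prop where
  compat : O.Compat E m
  -- The bound is the k-grading of the generator with v₋ on the classes of `S`: each non-trivial
  -- class changes from +1 to -1.
  mem : ∀ S : List V, S.Pairwise (fun u v => ¬ E u v) →
    O.xs S m ∈ O.F ((oddTraces cl E).card - 2 * (S.map fun v => ind (NT cl E v)).sum)

variable {cl : Fin n → V}

theorem Adm.zero {E : Setoid V} : O.Adm cl E 0 := ⟨Compat.zero, fun S _ => by simp⟩

theorem Adm.add {E : Setoid V} {m m' : N} (h : O.Adm cl E m) (h' : O.Adm cl E m') :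
    O.Adm cl E (m + m') :=
  ⟨h.compat.add h'.compat, fun S hS => by rw [map_add]; exact add_mem (h.mem S hS) (h'.mem S hS)⟩

theorem exists_perm_cons {E : Setoid V} {S : List V} {a : V}
    (hS : S.Pairwise (fun u v => ¬ E u v)) (h : ∃ s ∈ S, E s a) :
    ∃ s T, S.Perm (s :: T) ∧ E s a ∧ (∀ t ∈ T, ¬ E t a) := by
  obtain ⟨s, hs, hE⟩ := h
  refine ⟨s, S.erase s, List.perm_cons_erase hs, hE, fun t ht hta => ?_⟩
  have := (List.perm_cons_erase hs).pairwise_iff (R := fun u v => ¬ E u v)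
    (fun h k => h (E.symm k)) |>.1 hS
  exact (List.pairwise_cons.1 this).1 t ht (E.trans hE (E.symm hta))

theorem sum_map_congr {E E' : Setoid V} {a b : V} (k : Fuse E E' a b) {T : List V}
    (ha : ∀ t ∈ T, ¬ E t a) (hb : ∀ t ∈ T, ¬ E t b) :
    (T.map fun v => ind (NT cl E' v)).sum = (T.map fun v => ind (NT cl E v)).sum := by
  congr 1
  refine List.map_congr_left fun t ht => ?_
  rw [ind, ind, k.NT_of_not (ha t ht) (hb t ht)]

theorem pairwise_of_perm {E : Setoid V} {S T : List V} (h : S.Perm T)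
    (hS : S.Pairwise (fun u v => ¬ E u v)) : T.Pairwise (fun u v => ¬ E u v) :=
  (h.pairwise_iff (R := fun u v => ¬ E u v) (fun h k => h (E.symm k))).1 hS

theorem Fuse.ind_left {E E' : Setoid V} {a b : V} (h : Fuse E E' a b) :
    (ind (NT cl E a) = 0 ∧ ind (NT cl E b) = 0 ∧ ind (NT cl E' a) = 0) ∨
    (ind (NT cl E a) = 1 ∧ ind (NT cl E b) = 0 ∧ ind (NT cl E' a) = 1) ∨
    (ind (NT cl E a) = 0 ∧ ind (NT cl E b) = 1 ∧ ind (NT cl E' a) = 1) ∨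
    (ind (NT cl E a) = 1 ∧ ind (NT cl E b) = 1 ∧ ind (NT cl E' a) = 0) := by
  have := h.NT_left (cl := cl)
  unfold ind; split_ifs <;> tauto

/-- A merge lowers k by 0 or 2. Two non-trivial classes merge to a trivial one; otherwise the number
of non-trivial classes among them is kept. A label v₋ on one of the classes is inherited, and v₋ on
both gives zero. -/
theorem Adm.merge {E E' : Setoid V} {a b : V} {m : N} (h : O.Adm cl E' m) (k : Fuse E E' a b) :
    O.Adm cl E m := by
  refine ⟨h.compat.of_fuse k, fun S hS => ?_⟩
  have hc := k.card_oddTraces (cl := cl)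
  have hi := Fuse.ind_left (cl := cl) k
  -- Inequivalent points become equivalent only if they come from the two joined classes. So a list
  -- that misses one of these stays pairwise inequivalent.
  have conv : ∀ S : List V, S.Pairwise (fun u v => ¬ E u v) →
      (∀ s ∈ S, ¬ E s a) ∨ (∀ s ∈ S, ¬ E s b) → S.Pairwise (fun u v => ¬ E' u v) := by
    intro S hS hab
    refine hS.imp_of_mem fun {u v} hu hv hn e => ?_
    rcases (k.iff u v).1 e with e | ⟨e1, e2⟩
    · exact hn e
    · rcases hab with hab | hab
      · exact hn (E.trans (e1.resolve_left (hab u hu)) (E.symm (e2.resolve_left (hab v hv))))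
      · exact hn (E.trans (e1.resolve_right (hab u hu)) (E.symm (e2.resolve_right (hab v hv))))
  by_cases ha : ∃ s ∈ S, E s a
  · by_cases hb : ∃ s ∈ S, E s b
    · rw [h.compat.xs_zero]
      · exact zero_mem _
      · intro hp
        obtain ⟨s, T, hT, hs, -⟩ := exists_perm_cons hS ha
        obtain ⟨t, ht, htb⟩ := hb
        have hp' := List.pairwise_cons.1 (pairwise_of_perm hT hp)
        rcases List.mem_cons.1 (hT.mem_iff.1 ht) with rfl | ht'
        · exact k.ne (E.trans (E.symm hs) htb)
        · exact hp'.1 t ht' ((k.iff _ _).2 (Or.inr ⟨Or.inl hs, Or.inr htb⟩))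
    · push Not at hb
      obtain ⟨s, T, hT, hs, hTa⟩ := exists_perm_cons hS ha
      have hm := h.mem S (conv S hS (Or.inr hb))
      refine O.mono ?_ hm
      rw [(hT.map _).sum_eq, (hT.map _).sum_eq, List.map_cons, List.map_cons, List.sum_cons,
        List.sum_cons, sum_map_congr k hTa (fun t ht => hb t (hT.mem_iff.2 (by simp [ht]))),
        show ind (NT cl E' s) = ind (NT cl E' a) by rw [ind, ind, NT_congr (k.le hs)],
        show ind (NT cl E s) = ind (NT cl E a) by rw [ind, ind, NT_congr hs]]
      omega
  · push Not at ha
    by_cases hb : ∃ s ∈ S, E s b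
    · obtain ⟨s, T, hT, hs, hTb⟩ := exists_perm_cons hS hb
      have hm := h.mem S (conv S hS (Or.inl ha))
      refine O.mono ?_ hm
      rw [(hT.map _).sum_eq, (hT.map _).sum_eq, List.map_cons, List.map_cons, List.sum_cons,
        List.sum_cons, sum_map_congr k (fun t ht => ha t (hT.mem_iff.2 (by simp [ht]))) hTb,
        show ind (NT cl E' s) = ind (NT cl E' a) by
          rw [ind, ind, NT_congr (E'.trans (k.le hs) (E'.symm k.joined))],
        show ind (NT cl E s) = ind (NT cl E b) by rw [ind, ind, NT_congr hs]]
      omega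
    · push Not at hb
      have hm := h.mem S (conv S hS (Or.inl ha))
      refine O.mono ?_ hm
      rw [sum_map_congr k ha hb]
      omega

/-- A split does not raise k either. If the class is labeled v₊, both summands X_a m and X_b m have
to be bounded; if it is labeled v₋, one of them vanishes. -/
theorem Adm.split {E E' : Setoid V} {a b : V} {m : N} (h : O.Adm cl E' m) (k : Fuse E' E a b) :
    O.Adm cl E (O.X a m + O.X b m) := by
  refine ⟨h.compat.split k, fun S hS => ?_⟩
  have hc := k.card_oddTraces (cl := cl)
  have hi := Fuse.ind_left (cl := cl) k
  have hS' : S.Pairwise (fun u v => ¬ E' u v) := hS.imp fun hn e => hn (k.le e)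
  rw [map_add, ← X_xs, ← X_xs]
  by_cases hu : ∃ s ∈ S, E s a
  · obtain ⟨s, T, hT, hs, hTa⟩ := exists_perm_cons hS hu
    have hTa' : ∀ t ∈ T, ¬ E' t a := fun t ht e => hTa t ht (k.le e)
    have hTb' : ∀ t ∈ T, ¬ E' t b := fun t ht e =>
      hTa t ht (E.trans (k.le e) (E.symm k.joined))
    have hP := List.pairwise_cons.1 (pairwise_of_perm hT hS')
    have hsab : E' s a ∨ E' s b := by
      rcases (k.iff s a).1 hs with e | ⟨e, -⟩
      · exact Or.inl e
      · exact e
    rw [(hT.map _).sum_eq, List.map_cons, List.sum_cons, sum_map_congr k hTa' hTb',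
      show ind (NT cl E s) = ind (NT cl E a) by rw [ind, ind, NT_congr hs]]
    -- The point `s` of the list lies on one of the two halves. The summand at this half is zero by
    -- X² = 0, and the other one puts v₋ on both halves.
    rcases hsab with e | e
    · rw [h.compat.xs_zero_of_mem ⟨s, hT.mem_iff.2 (by simp), E'.symm e⟩, zero_add, ← xs_cons]
      have hd : (b :: S).Pairwise (fun u v => ¬ E' u v) := by
        refine List.pairwise_cons.2 ⟨fun t ht ebt => ?_, hS'⟩
        rcases List.mem_cons.1 (hT.mem_iff.1 ht) with rfl | ht'
        · exact k.ne (E'.trans (E'.symm e) (E'.symm ebt))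
        · exact hTb' t ht' (E'.symm ebt)
      refine O.mono ?_ (h.mem _ hd)
      rw [List.map_cons, List.sum_cons, (hT.map _).sum_eq, List.map_cons, List.sum_cons,
        show ind (NT cl E' s) = ind (NT cl E' a) by rw [ind, ind, NT_congr e]]
      omega
    · rw [h.compat.xs_zero_of_mem (u := b) ⟨s, hT.mem_iff.2 (by simp), E'.symm e⟩, add_zero,
        ← xs_cons]
      have hd : (a :: S).Pairwise (fun u v => ¬ E' u v) := by
        refine List.pairwise_cons.2 ⟨fun t ht ebt => ?_, hS'⟩
        rcases List.mem_cons.1 (hT.mem_iff.1 ht) with rfl | ht'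
        · exact k.ne (E'.trans ebt e)
        · exact hTa' t ht' (E'.symm ebt)
      refine O.mono ?_ (h.mem _ hd)
      rw [List.map_cons, List.sum_cons, (hT.map _).sum_eq, List.map_cons, List.sum_cons,
        show ind (NT cl E' s) = ind (NT cl E' b) by rw [ind, ind, NT_congr e]]
      omega
  · push Not at hu
    have hSa : ∀ t ∈ S, ¬ E' t a := fun t ht e => hu t ht (k.le e)
    have hSb : ∀ t ∈ S, ¬ E' t b := fun t ht e =>
      hu t ht (E.trans (k.le e) (E.symm k.joined))
    rw [← xs_cons, ← xs_cons, sum_map_congr k hSa hSb]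
    refine add_mem (O.mono ?_ (h.mem (a :: S) (List.pairwise_cons.2
      ⟨fun t ht e => hSa t ht (E'.symm e), hS'⟩))) (O.mono ?_ (h.mem (b :: S)
        (List.pairwise_cons.2 ⟨fun t ht e => hSb t ht (E'.symm e), hS'⟩))) <;>
    · rw [List.map_cons, List.sum_cons]
      omega

theorem Adm.theta {E E' : Setoid V} {a b : V} {m : N} (h : O.Adm cl E' m)
    (k : Saddle E E' a b) : O.Adm cl E (O.theta E a b m) := by
  by_cases e : E a b
  · rw [theta_of e]; exact h.split (k.fuse' e)
  · rw [theta_of_not e]; exact h.merge (k.fuse e)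

end Adm

/-- Restriction of the operators along a map of index sets. -/
def comap {W : Type*} (ι : W → V) : FiltOps W N where
  X w := O.X (ι w)
  comm _ _ := O.comm _ _
  sq _ := O.sq _
  F := O.F
  mono := O.mono

end FiltOps

theorem Fuse.comap {V W : Type*} {E E' : Setoid V} {a b : V} (h : Fuse E E' a b) (ι : W → V) {c d : W}
    (hc : E (ι c) a) (hd : E (ι d) b) : Fuse (E.comap ι) (E'.comap ι) c d where
  ne k := h.ne (E.trans (E.symm hc) (E.trans k hd))
  iff u v := by
    have e1 : ∀ u, E (ι u) a ↔ E (ι u) (ι c) := fun u =>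
      ⟨fun k => E.trans k (E.symm hc), fun k => E.trans k hc⟩
    have e2 : ∀ u, E (ι u) b ↔ E (ι u) (ι d) := fun u =>
      ⟨fun k => E.trans k (E.symm hd), fun k => E.trans k hd⟩
    have := h.iff (ι u) (ι v)
    rw [e1, e1, e2, e2] at this
    exact this

theorem Saddle.comap {V W : Type*} {E E' : Setoid V} {a b : V} (h : Saddle E E' a b) (ι : W → V)
    {c d : W} (hc : E (ι c) a) (hd : E (ι d) b) (hc' : E' (ι c) a) (hd' : E' (ι d) b) :
    Saddle (E.comap ι) (E'.comap ι) c d :=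
  h.imp (fun k => k.comap ι hc hd) (fun k => k.comap ι hc' hd')

/-- The filtration sees a class only through its closing arcs. Points may be forgotten as long as
every closing arc keeps a representative. -/
theorem FiltOps.Adm.comap {V W N : Type*} [AddCommGroup N] [Module (ZMod 2) N] {O : FiltOps V N}
    {n : ℕ} {cl : Fin n → V} {E : Setoid V} {m : N} (h : O.Adm cl E m) (ι : W → V)
    {cl' : Fin n → W} (hcl : ∀ p, E (ι (cl' p)) (cl p)) :
    (FiltOps.comap (O := O) ι).Adm cl' (E.comap ι) m := by
  have ht : ∀ w, trace cl' (E.comap ι) w = trace cl E (ι w) := fun w => by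
    ext p
    simp only [mem_trace]
    exact ⟨fun k => E.trans (E.symm (hcl p)) k, fun k => E.trans (hcl p) k⟩
  have hxs : ∀ S : List W, (FiltOps.comap (O := O) ι).xs S m = O.xs (S.map ι) m := fun S => by
    simp only [FiltOps.xs, List.map_map]; rfl
  refine ⟨fun u v e => h.compat _ _ e, fun S hS => ?_⟩
  have h1 := h.mem (S.map ι) (List.pairwise_map.2 hS)
  rw [hxs]
  have h2 : oddTraces cl' (E.comap ι) = oddTraces cl E := by
    refine oddTraces_eq fun p q => ?_
    exact ⟨fun k => E.trans (E.symm (hcl p)) (E.trans k (hcl q)),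
      fun k => E.trans (hcl p) (E.trans k (E.symm (hcl q)))⟩
  rw [h2]
  have h3 : (S.map fun v => ind (NT cl' (E.comap ι) v)) =
      (S.map ι).map fun v => ind (NT cl E v) := by
    rw [List.map_map]
    refine List.map_congr_left fun w _ => ?_
    simp only [Function.comp, NT, ht]
  rw [h3]
  exact h1

end BraidKh

namespace BraidKh

/-! ### Cycles of a permutation and transpositions -/

section Cycles

open Equiv Equiv.Perm

variable {V : Type*} [Finite V] [DecidableEq V]

/-- The relation obtained from `E` by joining the classes of `a` and `b`. -/
def joinPair (E : Setoid V) (a b : V) : Setoid V :=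
  Setoid.ker fun v => if E v a ∨ E v b then (Quotient.mk E a) else Quotient.mk E v

theorem joinPair_iff (E : Setoid V) (a b u v : V) :
    joinPair E a b u v ↔ E u v ∨ ((E u a ∨ E u b) ∧ (E v a ∨ E v b)) := by
  have h : joinPair E a b u v ↔ (if E u a ∨ E u b then (Quotient.mk E a) else Quotient.mk E u) =
    (if E v a ∨ E v b then (Quotient.mk E a) else Quotient.mk E v) := Iff.rfl
  rw [h]
  have key : ∀ {x y z : V}, E x y → (E x z ↔ E y z) := fun h =>
    ⟨fun k => E.trans (E.symm h) k, fun k => E.trans h k⟩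
  have q : ∀ x y : V, (Quotient.mk E x = Quotient.mk E y) ↔ E x y := fun x y => Quotient.eq
  by_cases hu : E u a ∨ E u b <;> by_cases hv : E v a ∨ E v b
  · simp [hu, hv]
  · simp only [hu, hv, if_true, if_false, q, and_false, or_false]
    constructor
    · intro h; exact absurd (Or.inl (E.symm h)) hv
    · intro h; exact absurd (by rwa [← key h, ← key h]) hv
  · simp only [hu, hv, if_true, if_false, q, false_and, or_false]
    constructor
    · intro h; exact absurd (Or.inl h) hu
    · intro h; exact absurd (by rwa [key h, key h]) hu
  · simp only [hu, hv, if_false, q, false_and, or_false]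

/-- The cycles of a permutation. -/
def cyc (π : Perm V) : Setoid V := SameCycle.setoid π

theorem cyc_apply (π : Perm V) (v : V) : cyc π v (π v) :=
  show SameCycle π v (π v) from sameCycle_apply_right.2 (SameCycle.refl _ _)

theorem cyc_le {π : Perm V} {E : Setoid V} (h : ∀ v, E v (π v)) {u v : V} (k : cyc π u v) :
    E u v := by
  obtain ⟨i, -, rfl⟩ := SameCycle.exists_pow_eq' (show SameCycle π u v from k)
  clear k
  induction i with
  | zero => exact E.refl _
  | succ i ih => rw [pow_succ']; exact E.trans ih (h _)

/-- The product sends `a` to π b and then follows the cycle of `b`, which avoids `a`, until it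
arrives at `b`. -/
theorem cyc_mul_swap_of_not {π : Perm V} {a b : V} (h : ¬ cyc π a b) :
    cyc (π * swap a b) a b := by
  set π' := π * swap a b with hπ
  have hb : π' b = π a := by simp [hπ]
  have ha : π' a = π b := by simp [hπ]
  have key : ∀ i : ℕ, cyc π' a ((π ^ (i + 1)) b) := by
    intro i
    induction i with
    | zero => rw [zero_add, pow_one, ← ha]; exact cyc_apply π' a
    | succ i ih =>
      have hna : (π ^ (i + 1)) b ≠ a := fun e => h (by
        have : cyc π b ((π ^ (i + 1)) b) := ⟨(i + 1 : ℕ), by rw [zpow_natCast]⟩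
        rw [e] at this
        exact (cyc π).symm this)
      by_cases e : (π ^ (i + 1)) b = b
      · rw [pow_succ', Perm.mul_apply, e, ← ha]; exact cyc_apply π' a
      · have : π' ((π ^ (i + 1)) b) = (π ^ (i + 1 + 1)) b := by
          rw [hπ, Perm.mul_apply, swap_apply_of_ne_of_ne hna e, pow_succ' π (i + 1),
            Perm.mul_apply]
        rw [← this]
        exact (cyc π').trans ih (cyc_apply π' _)
  obtain ⟨m, hm, hm1⟩ := isOfFinOrder_iff_pow_eq_one.1 (isOfFinOrder_of_finite π)
  have := key (m - 1)
  rwa [Nat.sub_add_cancel hm, hm1] at this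

/-- Let k be the first exponent with π^k a = b. The product sends `b` back to π a, so its orbit of
`b` consists of the π^i a with 0 < i ≤ k, and `a` is not among them. -/
theorem not_cyc_mul_swap {π : Perm V} {a b : V} (hab : a ≠ b) (h : cyc π a b) :
    ¬ cyc (π * swap a b) a b := by
  set π' := π * swap a b with hπ
  have hb : π' b = π a := by simp [hπ]
  have hex : ∃ k : ℕ, (π ^ k) a = b := by
    obtain ⟨i, -, e⟩ := SameCycle.exists_pow_eq' (show SameCycle π a b from h)
    exact ⟨i, e⟩
  set k := Nat.find hex with hk
  have hkb : (π ^ k) a = b := Nat.find_spec hex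
  have hmin : ∀ i < k, (π ^ i) a ≠ b := fun i hi => Nat.find_min hex hi
  have hk0 : 0 < k := by
    rcases Nat.eq_zero_or_pos k with e | e
    · rw [e] at hkb; exact absurd hkb hab
    · exact e
  have hna : ∀ i, 0 < i → i ≤ k → (π ^ i) a ≠ a := by
    intro i hi hik e
    rcases hik.lt_or_eq with hlt | rfl
    · refine hmin (k - i) (by omega) ?_
      have : (π ^ k) a = (π ^ (k - i)) ((π ^ i) a) := by
        rw [← Perm.mul_apply, ← pow_add]; congr 2; omega
      rw [← hkb, this, e]
    · exact hab (e.symm.trans hkb)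
  have key : ∀ m : ℕ, ∃ i, 0 < i ∧ i ≤ k ∧ (π' ^ m) b = (π ^ i) a := by
    intro m
    induction m with
    | zero => exact ⟨k, hk0, le_rfl, hkb.symm⟩
    | succ m ih =>
      obtain ⟨i, hi, hik, e⟩ := ih
      rw [pow_succ', Perm.mul_apply, e]
      rcases hik.lt_or_eq with hlt | rfl
      · refine ⟨i + 1, by omega, hlt, ?_⟩
        rw [hπ, Perm.mul_apply, swap_apply_of_ne_of_ne (hna i hi hik) (hmin i hlt), pow_succ',
          Perm.mul_apply]
      · refine ⟨1, by omega, by omega, ?_⟩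
        rw [hkb, hb, pow_one]
  intro hc
  obtain ⟨m, -, e⟩ := SameCycle.exists_pow_eq' (show SameCycle π' b a from (cyc π').symm hc)
  obtain ⟨i, hi, hik, e'⟩ := key m
  exact hna i hi hik (e'.symm.trans e)

theorem fuse_mul_swap {π : Perm V} {a b : V} (h : ¬ cyc π a b) :
    Fuse (cyc π) (cyc (π * swap a b)) a b := by
  have hab := cyc_mul_swap_of_not h
  set π' := π * swap a b with hπ
  have hb : π' b = π a := by simp [hπ]
  have ha : π' a = π b := by simp [hπ]
  have hle : ∀ {u v}, cyc π u v → cyc π' u v := by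
    refine cyc_le fun v => ?_
    by_cases e1 : v = a
    · subst e1; rw [← hb]; exact (cyc π').trans hab (cyc_apply π' b)
    · by_cases e2 : v = b
      · subst e2; rw [← ha]; exact (cyc π').trans ((cyc π').symm hab) (cyc_apply π' a)
      · have : π' v = π v := by rw [hπ, Perm.mul_apply, swap_apply_of_ne_of_ne e1 e2]
        rw [← this]; exact cyc_apply π' v
  refine ⟨h, fun u v => ⟨fun k => ?_, ?_⟩⟩
  · rw [← joinPair_iff]
    refine cyc_le (fun v => ?_) k
    rw [joinPair_iff]
    by_cases e1 : v = a
    · subst e1; rw [ha]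
      exact Or.inr ⟨Or.inl ((cyc π).refl _), Or.inr ((cyc π).symm (cyc_apply π b))⟩
    · by_cases e2 : v = b
      · subst e2; rw [hb]
        exact Or.inr ⟨Or.inr ((cyc π).refl _), Or.inl ((cyc π).symm (cyc_apply π a))⟩
      · have : π' v = π v := by rw [hπ, Perm.mul_apply, swap_apply_of_ne_of_ne e1 e2]
        rw [this]; exact Or.inl (cyc_apply π v)
  · have hx : ∀ u, cyc π u a ∨ cyc π u b → cyc π' u a := fun u k => k.elim hle fun k =>
      (cyc π').trans (hle k) ((cyc π').symm hab)
    rintro (k | ⟨k1, k2⟩)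
    · exact hle k
    · exact (cyc π').trans (hx u k1) ((cyc π').symm (hx v k2))

/-- Composition with a transposition joins two cycles or splits a cycle. -/
theorem saddle_mul_swap (π : Perm V) {a b : V} (hab : a ≠ b) :
    Saddle (cyc π) (cyc (π * swap a b)) a b := by
  by_cases h : cyc π a b
  · right
    have := fuse_mul_swap (not_cyc_mul_swap hab h)
    rwa [mul_assoc, swap_mul_self, mul_one] at this
  · exact Or.inl (fuse_mul_swap h)

end Cycles

/-! ### The circles of a resolution as cycles of a permutation -/

variable {n : ℕ} (w : BraidWord n) (I : Resolution w)

/-- Points on the same circle. -/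
def circles : Setoid (Pt w) := Setoid.ker (circ w I)

variable {w I}

theorem circles_iff {u v : Pt w} : circles w I u v ↔ circ w I u = circ w I v := Iff.rfl

theorem Joined.circles {u v : Pt w} (h : Joined w I u v) : circles w I u v := Quot.sound h

theorem circles_le {E : Setoid (Pt w)} (h : ∀ u v, Joined w I u v → E u v) {u v : Pt w}
    (k : circles w I u v) : E u v := by
  have := Quot.eqvGen_exact (circles_iff.1 k)
  induction this with
  | rel _ _ h' => exact h _ _ h'
  | refl _ => exact E.refl _
  | symm _ _ _ ih => exact E.symm (ih (Quot.eqvGen_sound (by assumption)).symm.symm)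
  | trans x y z h1 h2 ih1 ih2 =>
    exact E.trans (ih1 (Quot.eqvGen_sound h1)) (ih2 (Quot.eqvGen_sound h2))

theorem lft_val (j : Fin w.length) : (lft w j).val = (w.get j).1.val := rfl
theorem rgt_val (j : Fin w.length) : (rgt w j).val = (w.get j).1.val + 1 := rfl

theorem lft_ne_rgt (j : Fin w.length) : lft w j ≠ rgt w j := fun h => by
  have := congrArg Fin.val h; simp [lft_val, rgt_val] at this

variable (w I)

/-- Go sideways at the `j`-th crossing if it turns back, and otherwise to the level `t'`. -/
def turn (j : Fin w.length) (p : Fin n) (t t' : Fin (w.length + 1)) : Pt w :=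
  if I j ≠ braidlike w j ∧ p = lft w j then (rgt w j, t)
  else if I j ≠ braidlike w j ∧ p = rgt w j then (lft w j, t) else (p, t')

/-- The neighbour of a point along its upper end. -/
def up (x : Pt w) : Pt w :=
  if h : x.2 = Fin.last _ then (x.1, 0)
  else turn w I (x.2.castPred h) x.1 x.2 (x.2.castPred h).succ

/-- The neighbour of a point along its lower end. -/
def dn (x : Pt w) : Pt w :=
  if h : x.2 = 0 then (x.1, Fin.last _)
  else turn w I (x.2.pred h) x.1 x.2 (x.2.pred h).castSucc

/-- One step along the circles; the strands in positions of parity `s` are oriented upwards. -/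
def fwd (s : Bool) (x : Pt w) : Pt w := if (x.1.val.bodd = s) then up w I x else dn w I x

variable {w I}

theorem up_last (p : Fin n) : up w I (p, Fin.last _) = (p, 0) := by simp [up]

theorem dn_zero (p : Fin n) : dn w I (p, 0) = (p, Fin.last _) := by simp [dn]

theorem up_castSucc (p : Fin n) (j : Fin w.length) :
    up w I (p, j.castSucc) = turn w I j p j.castSucc j.succ := by
  rw [up, dif_neg (by exact (Fin.castSucc_lt_last j).ne)]; simp

theorem dn_succ (p : Fin n) (j : Fin w.length) :
    dn w I (p, j.succ) = turn w I j p j.succ j.castSucc := by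
  rw [dn, dif_neg (by exact Fin.succ_ne_zero j)]; simp

theorem turn_braid {j : Fin w.length} (h : I j = braidlike w j) (p t t') :
    turn w I j p t t' = (p, t') := by simp [turn, h]

theorem turn_lft {j : Fin w.length} (h : I j ≠ braidlike w j) (t t') :
    turn w I j (lft w j) t t' = (rgt w j, t) := by simp [turn, h]

theorem turn_rgt {j : Fin w.length} (h : I j ≠ braidlike w j) (t t') :
    turn w I j (rgt w j) t t' = (lft w j, t) := by simp [turn, h, (lft_ne_rgt j).symm]

theorem turn_away {j : Fin w.length} {p : Fin n} (hl : p ≠ lft w j) (hr : p ≠ rgt w j) (t t') :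
    turn w I j p t t' = (p, t') := by simp [turn, hl, hr]

theorem bodd_rgt (j : Fin w.length) : (rgt w j).val.bodd = !(lft w j).val.bodd := by
  rw [rgt_val, lft_val, Nat.bodd_succ]

theorem turn_cases (j : Fin w.length) (p : Fin n) :
    ((∀ t t', turn w I j p t t' = (p, t')) ∧ (I j = braidlike w j ∨ (p ≠ lft w j ∧ p ≠ rgt w j))) ∨
    (I j ≠ braidlike w j ∧ p = lft w j) ∨ (I j ≠ braidlike w j ∧ p = rgt w j) := by
  by_cases h : I j = braidlike w j
  · exact Or.inl ⟨turn_braid h p, Or.inl h⟩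
  · by_cases hl : p = lft w j
    · exact Or.inr (Or.inl ⟨h, hl⟩)
    · by_cases hr : p = rgt w j
      · exact Or.inr (Or.inr ⟨h, hr⟩)
      · exact Or.inl ⟨turn_away hl hr, Or.inr ⟨hl, hr⟩⟩

theorem turn_circles_up (j : Fin w.length) (p : Fin n) :
    circles w I (p, j.castSucc) (turn w I j p j.castSucc j.succ) := by
  by_cases h : I j = braidlike w j
  · rw [turn_braid h]
    by_cases hl : p = lft w j
    · subst hl; exact (Joined.left j h).circles
    · by_cases hr : p = rgt w j
      · subst hr; exact (Joined.right j h).circles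
      · exact (Joined.away j p hl hr).circles
  · by_cases hl : p = lft w j
    · subst hl; rw [turn_lft h]; exact (Joined.cap j h).circles
    · by_cases hr : p = rgt w j
      · subst hr; rw [turn_rgt h]; exact (circles w I).symm (Joined.cap j h).circles
      · rw [turn_away hl hr]; exact (Joined.away j p hl hr).circles

theorem turn_circles_dn (j : Fin w.length) (p : Fin n) :
    circles w I (p, j.succ) (turn w I j p j.succ j.castSucc) := by
  by_cases h : I j = braidlike w j
  · have := turn_circles_up (I := I) j p
    rw [turn_braid h] at this ⊢
    exact (circles w I).symm this
  · by_cases hl : p = lft w j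
    · subst hl; rw [turn_lft h]; exact (Joined.cup j h).circles
    · by_cases hr : p = rgt w j
      · subst hr; rw [turn_rgt h]; exact (circles w I).symm (Joined.cup j h).circles
      · rw [turn_away hl hr]; exact (circles w I).symm (Joined.away j p hl hr).circles

theorem up_circles (x : Pt w) : circles w I x (up w I x) := by
  obtain ⟨p, t⟩ := x
  induction t using Fin.lastCases with
  | last => rw [up_last]; exact (Joined.closing p).circles
  | cast j => rw [up_castSucc]; exact turn_circles_up j p

theorem dn_circles (x : Pt w) : circles w I x (dn w I x) := by
  obtain ⟨p, t⟩ := x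
  induction t using Fin.cases with
  | zero => rw [dn_zero]; exact (circles w I).symm (Joined.closing p).circles
  | succ j => rw [dn_succ]; exact turn_circles_dn j p

theorem fwd_up {s : Bool} {p : Fin n} (h : p.val.bodd = s) (t) :
    fwd w I s (p, t) = up w I (p, t) := by simp [fwd, h]

theorem fwd_dn {s : Bool} {p : Fin n} (h : p.val.bodd = !s) (t) :
    fwd w I s (p, t) = dn w I (p, t) := by simp [fwd, h]

theorem bodd_cases (p : Fin n) (s : Bool) : p.val.bodd = s ∨ p.val.bodd = !s := by
  cases p.val.bodd <;> cases s <;> simp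

theorem fwd_circles (s : Bool) (x : Pt w) : circles w I x (fwd w I s x) := by
  unfold fwd; split_ifs
  exacts [up_circles x, dn_circles x]

/-- Caps and cups join neighbouring positions, which have different parity, and straight strands
keep their position. So the alternating orientation is consistent in every resolution, and reversing
it inverts the step. -/
theorem fwd_fwd (s : Bool) (x : Pt w) : fwd w I (!s) (fwd w I s x) = x := by
  obtain ⟨p, t⟩ := x
  rcases bodd_cases p s with hp | hp
  · rw [fwd_up hp]
    have hp' : p.val.bodd = !!s := by simpa using hp
    induction t using Fin.lastCases with
    | last => rw [up_last, fwd_dn hp', dn_zero]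
    | cast j =>
      rw [up_castSucc]
      rcases turn_cases (I := I) j p with ⟨h, -⟩ | ⟨h, rfl⟩ | ⟨h, rfl⟩
      · rw [h, fwd_dn hp', dn_succ, h]
      · rw [turn_lft h, fwd_up (by rw [bodd_rgt, hp]), up_castSucc, turn_rgt h]
      · rw [turn_rgt h, fwd_up (by rw [← hp, bodd_rgt, Bool.not_not]), up_castSucc, turn_lft h]
  · rw [fwd_dn hp]
    induction t using Fin.cases with
    | zero => rw [dn_zero, fwd_up hp, up_last]
    | succ j =>
      rw [dn_succ]
      rcases turn_cases (I := I) j p with ⟨h, -⟩ | ⟨h, rfl⟩ | ⟨h, rfl⟩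
      · rw [h, fwd_up hp, up_castSucc, h]
      · rw [turn_lft h, fwd_dn (by rw [bodd_rgt, hp]), dn_succ, turn_rgt h]
      · rw [turn_rgt h, fwd_dn (by rw [← hp, bodd_rgt, Bool.not_not]), dn_succ, turn_lft h]

variable (w I)

/-- The permutation of the points that goes along the circles. -/
def flow (s : Bool) : Equiv.Perm (Pt w) where
  toFun := fwd w I s
  invFun := fwd w I (!s)
  left_inv := fwd_fwd s
  right_inv x := by simpa using fwd_fwd (w := w) (I := I) (!s) x

variable {w I}

theorem flow_apply (s : Bool) (x : Pt w) : flow w I s x = fwd w I s x := rfl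

theorem cyc_up (s : Bool) (x : Pt w) : cyc (flow w I s) x (up w I x) := by
  have h1 := cyc_apply (flow w I s) x
  rw [flow_apply] at h1
  rcases bodd_cases x.1 s with h | h
  · rwa [fwd_up h] at h1
  · have h2 : flow w I s (up w I x) = x := by
      have := fwd_fwd (w := w) (I := I) (!s) x
      rw [fwd_up h, Bool.not_not] at this
      exact this
    have := cyc_apply (flow w I s) (up w I x)
    rw [h2] at this
    exact (cyc _).symm this

theorem cyc_eq_circles (s : Bool) : cyc (flow w I s) = circles w I := by
  ext u v
  refine ⟨cyc_le fun x => fwd_circles s x, circles_le fun u v h => ?_⟩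
  cases h with
  | closing p => have := cyc_up (I := I) s (p, Fin.last _); rwa [up_last] at this
  | away j p hl hr =>
    have := cyc_up (I := I) s (p, j.castSucc); rwa [up_castSucc, turn_away hl hr] at this
  | left j h =>
    have := cyc_up (I := I) s (lft w j, j.castSucc); rwa [up_castSucc, turn_braid h] at this
  | right j h =>
    have := cyc_up (I := I) s (rgt w j, j.castSucc); rwa [up_castSucc, turn_braid h] at this
  | cap j h =>
    have := cyc_up (I := I) s (lft w j, j.castSucc); rwa [up_castSucc, turn_lft h] at this
  | cup j h =>
    rcases bodd_cases (lft w j) s with k | k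
    · have := cyc_apply (flow w I s) (rgt w j, j.succ)
      rw [flow_apply, fwd_dn (by rw [bodd_rgt, k]), dn_succ, turn_rgt h] at this
      exact (cyc _).symm this
    · have := cyc_apply (flow w I s) (lft w j, j.succ)
      rw [flow_apply, fwd_dn k, dn_succ, turn_lft h] at this
      exact this

/-- The lower left corner of a crossing. -/
abbrev cornerA (w : BraidWord n) (j : Fin w.length) : Pt w := (lft w j, j.castSucc)

/-- The upper right corner of a crossing. -/
abbrev cornerB (w : BraidWord n) (j : Fin w.length) : Pt w := (rgt w j, j.succ)

theorem turn_congr {I J : Resolution w} {j : Fin w.length} (h : I j = J j) (p t t') :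
    turn w I j p t t' = turn w J j p t t' := by simp [turn, h]

theorem fwd_eq_of_ne {I J : Resolution w} {j : Fin w.length} (hIJ : ∀ k, k ≠ j → I k = J k)
    {x : Pt w} (e1 : x ≠ cornerA w j) (e2 : x ≠ cornerB w j) :
    fwd w J (lft w j).val.bodd x = fwd w I (lft w j).val.bodd x := by
  obtain ⟨p, t⟩ := x
  have key : ∀ t t', p ≠ lft w j → p ≠ rgt w j →
      turn w J j p t t' = turn w I j p t t' := fun t t' hl hr => by
    rw [turn_away hl hr, turn_away hl hr]
  rcases bodd_cases p (lft w j).val.bodd with hp | hp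
  · rw [fwd_up hp, fwd_up hp]
    induction t using Fin.lastCases with
    | last => rw [up_last, up_last]
    | cast k =>
      rw [up_castSucc, up_castSucc]
      by_cases hk : k = j
      · rw [hk] at e1 ⊢
        refine key _ _ (fun e => e1 (by rw [e])) fun e => ?_
        rw [e, bodd_rgt] at hp
        simp at hp
      · exact turn_congr (hIJ k hk).symm _ _ _
  · rw [fwd_dn hp, fwd_dn hp]
    induction t using Fin.cases with
    | zero => rw [dn_zero, dn_zero]
    | succ k =>
      rw [dn_succ, dn_succ]
      by_cases hk : k = j
      · rw [hk] at e2 ⊢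
        refine key _ _ (fun e => ?_) fun e => e2 (by rw [e])
        rw [e] at hp
        simp at hp
      · exact turn_congr (hIJ k hk).symm _ _ _

/-- With this parity the flow enters the crossing at the corners `cornerA` and `cornerB`. Passing to
the other resolution exchanges the points that follow these two corners and changes nothing else. -/
theorem flow_eq_mul_swap {I J : Resolution w} {j : Fin w.length} (hIJ : ∀ k, k ≠ j → I k = J k)
    (hb : I j = braidlike w j) (hJ : J j ≠ braidlike w j) :
    flow w J (lft w j).val.bodd =
      flow w I (lft w j).val.bodd * Equiv.swap (cornerA w j) (cornerB w j) := by
  ext1 x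
  rw [Equiv.Perm.mul_apply]
  by_cases e1 : x = cornerA w j
  · rw [e1, Equiv.swap_apply_left, flow_apply, flow_apply, fwd_up rfl, up_castSucc, turn_lft hJ,
      fwd_dn (bodd_rgt j), dn_succ, turn_braid hb]
  · by_cases e2 : x = cornerB w j
    · rw [e2, Equiv.swap_apply_right, flow_apply, flow_apply, fwd_up rfl, up_castSucc,
        turn_braid hb, fwd_dn (bodd_rgt j), dn_succ, turn_rgt hJ]
    · rw [Equiv.swap_apply_of_ne_of_ne e1 e2, flow_apply, flow_apply, fwd_eq_of_ne hIJ e1 e2]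

theorem saddle_of_braidlike {I J : Resolution w} {j : Fin w.length}
    (hIJ : ∀ k, k ≠ j → I k = J k) (hb : I j = braidlike w j) (hJ : J j ≠ braidlike w j) :
    Saddle (circles w I) (circles w J) (cornerA w j) (cornerB w j) := by
  rw [← cyc_eq_circles (lft w j).val.bodd, ← cyc_eq_circles (I := J) (lft w j).val.bodd,
    flow_eq_mul_swap hIJ hb hJ]
  exact saddle_mul_swap _ fun h => lft_ne_rgt j (congrArg Prod.fst h)

/-- Changing the resolution of a crossing joins two circles or splits a circle. -/
theorem saddle_of_ne {I J : Resolution w} (j : Fin w.length) (hj : I j ≠ J j)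
    (hIJ : ∀ k, k ≠ j → I k = J k) :
    Saddle (circles w I) (circles w J) (cornerA w j) (cornerB w j) := by
  by_cases hb : I j = braidlike w j
  · exact saddle_of_braidlike hIJ hb fun e => hj (hb.trans e.symm)
  · refine (saddle_of_braidlike (fun k hk => (hIJ k hk).symm) ?_ hb).symm
    revert hj hb
    cases I j <;> cases J j <;> cases braidlike w j <;> simp

end BraidKh

/-! ### Generators as products of operators applied to the vectors with all labels v₊. -/

namespace BraidKh

variable {n : ℕ} {w : BraidWord n}

/-- The label of a generator at a point. -/
def Gen.at (x : Gen w) (v : Pt w) : Bool := x.lab (circ w x.res v)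

theorem Gen.at_congr (x : Gen w) {u v : Pt w} (h : circles w x.res u v) : x.at u = x.at v :=
  congrArg x.lab h

theorem circ_surj {I : Resolution w} (c : Circle w I) : ∃ v, circ w I v = c :=
  Quot.exists_rep c

/-- A point on a circle. -/
def circPt {I : Resolution w} (c : Circle w I) : Pt w := (circ_surj c).choose

@[simp] theorem circ_circPt {I : Resolution w} (c : Circle w I) : circ w I (circPt c) = c :=
  (circ_surj c).choose_spec

theorem Gen.ext_at {x y : Gen w} (h : x.res = y.res) (h' : ∀ v, x.at v = y.at v) : x = y := by
  obtain ⟨I, l⟩ := x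
  obtain ⟨J, m⟩ := y
  obtain rfl : I = J := h
  congr 1
  funext c
  obtain ⟨v, rfl⟩ := circ_surj c
  exact h' v

/-- The basis vector of a generator. -/
def basisVec (x : Gen w) : CKh w := Pi.single x 1

theorem basisVec_apply (x y : Gen w) : basisVec x y = if y = x then 1 else 0 := by
  simp [basisVec, Pi.single_apply]

/-- Two linear maps that agree on generators are equal. -/
theorem linearMap_ext {M : Type*} [AddCommGroup M] [Module (ZMod 2) M] {f g : CKh w →ₗ[ZMod 2] M}
    (h : ∀ x, f (basisVec x) = g (basisVec x)) : f = g :=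
  (Pi.basisFun (ZMod 2) (Gen w)).ext fun x => by rw [Pi.basisFun_apply]; exact h x

/-- Multiplication by `v₋` at the circle through a point. -/
def mulX (v : Pt w) : Module.End (ZMod 2) (CKh w) where
  -- Chains are coefficient functions: the coefficient at `y`, labeled v₋ at `v`, comes from the
  -- generator labeled v₊ there. No term has v₊ at `v`, and v₋v₋ = 0 holds by itself.
  toFun f y := if y.at v = false then f ⟨y.res, Function.update y.lab (circ w y.res v) true⟩ else 0
  map_add' f g := by ext y; simp only [Pi.add_apply]; split_ifs <;> simp
  map_smul' c f := by ext y; simp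

theorem mulX_apply (v : Pt w) (f : CKh w) (y : Gen w) : mulX v f y =
    if y.at v = false then f ⟨y.res, Function.update y.lab (circ w y.res v) true⟩ else 0 := rfl

theorem mulX_comm (u v : Pt w) (f : CKh w) : mulX u (mulX v f) = mulX v (mulX u f) := by
  ext ⟨I, l⟩
  simp only [mulX_apply, Gen.at]
  by_cases h : circ w I u = circ w I v
  · simp [h]
  · simp only [Function.update_of_ne h, Function.update_of_ne (Ne.symm h)]
    rw [Function.update_comm h]
    split_ifs <;> rfl

theorem mulX_sq (v : Pt w) (f : CKh w) : mulX v (mulX v f) = 0 := by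
  ext ⟨I, l⟩
  simp [mulX_apply, Gen.at]

variable (w) in
/-- The chain group with the operators at all points of the diagram. -/
def khOps : FiltOps (Pt w) (CKh w) where
  X := mulX
  comm := mulX_comm
  sq := mulX_sq
  F := F w
  mono h := Submodule.span_mono fun _ ⟨x, hx, e⟩ => ⟨x, hx.trans h, e⟩

/-- The generator with all circles labeled `v₊`. -/
def vac (I : Resolution w) : CKh w := basisVec ⟨I, fun _ => true⟩

theorem vac_compat (I : Resolution w) : (khOps w).Compat (circles w I) (vac I) := by
  intro u v h
  ext ⟨J, l⟩
  change mulX u _ _ = mulX v _ _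
  simp only [mulX_apply, vac, basisVec_apply, Gen.at]
  by_cases hJ : J = I
  · subst hJ
    rw [circles_iff.1 h]
  · have : ∀ c, ¬ ((⟨J, c⟩ : Gen w) = ⟨I, fun _ => true⟩) := fun c e => hJ (congrArg Gen.res e)
    simp [this]

/-- The labels `v₋` on the circles through the points of a list, and `v₊` elsewhere. -/
def minusLab (I : Resolution w) (S : List (Pt w)) (c : Circle w I) : Bool :=
  decide (∀ v ∈ S, circ w I v ≠ c)

/-- The generator whose circles labeled `v₋` are those through the points of a list. -/
def genOf (I : Resolution w) (S : List (Pt w)) : Gen w := ⟨I, minusLab I S⟩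

theorem genOf_at (I : Resolution w) (S : List (Pt w)) (u : Pt w) :
    (genOf I S).at u = decide (∀ v ∈ S, ¬ circles w I v u) := rfl

theorem genOf_at_false {I : Resolution w} {S : List (Pt w)} {u : Pt w} :
    (genOf I S).at u = false ↔ ∃ v ∈ S, circles w I v u := by
  rw [genOf_at]; simp

theorem genOf_at_true {I : Resolution w} {S : List (Pt w)} {u : Pt w} :
    (genOf I S).at u = true ↔ ∀ v ∈ S, ¬ circles w I v u := by
  rw [genOf_at]; simp

/-- Pairwise distinct circles. -/
abbrev Dist (I : Resolution w) (S : List (Pt w)) : Prop :=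
  S.Pairwise fun u v => ¬ circles w I u v

theorem mulX_basisVec (v : Pt w) (x : Gen w) (h : x.at v = true) :
    mulX v (basisVec x) = basisVec ⟨x.res, Function.update x.lab (circ w x.res v) false⟩ := by
  obtain ⟨I, l⟩ := x
  ext ⟨J, m⟩
  simp only [mulX_apply, basisVec_apply, Gen.at]
  by_cases hJ : J = I
  · subst hJ
    have h' : l (circ w J v) = true := h
    simp only [Gen.mk.injEq, heq_eq_eq, true_and]
    by_cases hm : m (circ w J v) = false
    · rw [if_pos hm]
      congr 1
      refine propext ⟨fun e => ?_, fun e => ?_⟩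
      · rw [← e]; simp [← hm]
      · rw [e]; simp [← h']
    · rw [if_neg hm, if_neg]
      rintro rfl
      simp at hm
  · have : ∀ c c', ¬ ((⟨J, c⟩ : Gen w) = ⟨I, c'⟩) := fun c _ e => hJ (congrArg Gen.res e)
    simp [this]

/-- Each operator turns the label of a further circle from v₊ to v₋. Hence the vectors `vac I`
generate `CKh` under the operators. -/
theorem xs_vac {I : Resolution w} {S : List (Pt w)} (hS : Dist I S) :
    (khOps w).xs S (vac I) = basisVec (genOf I S) := by
  induction S with
  | nil =>
    have : minusLab I [] = fun _ => true := by funext c; simp [minusLab]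
    rw [FiltOps.xs_nil, vac, genOf, this]
  | cons v S ih =>
    rw [Dist, List.pairwise_cons] at hS
    rw [FiltOps.xs_cons, ih hS.2]
    change mulX v _ = _
    rw [mulX_basisVec]
    · congr 1
      refine Gen.ext_at rfl fun u => ?_
      change Function.update (minusLab I S) (circ w I v) false (circ w I u) = _
      rw [genOf_at]
      by_cases h : circles w I u v
      · rw [show circ w I u = circ w I v from h]
        simp only [Function.update_self, List.mem_cons, forall_eq_or_imp]
        rw [eq_comm, decide_eq_false_iff_not]
        exact fun k => k.1 ((circles w I).symm h)
      · have h' : circ w I u ≠ circ w I v := h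
        simp only [minusLab, Function.update_of_ne h', List.mem_cons, forall_eq_or_imp]
        congr 1
        refine propext ⟨fun k => ⟨fun e => h ((circles w I).symm e), k⟩, fun k => k.2⟩
    · rw [genOf_at_true]
      exact fun u hu e => hS.1 u hu ((circles w I).symm e)

/-- A list of points on the circles labeled `v₋`. -/
def minusPts (x : Gen w) : List (Pt w) :=
  (Finset.univ.filter fun c => x.lab c = false).toList.map circPt

theorem minusPts_dist (x : Gen w) : Dist x.res (minusPts x) := by
  rw [minusPts, Dist, List.pairwise_map]
  refine (Finset.nodup_toList _).imp ?_
  intro a b hab h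
  rw [circles_iff, circ_circPt, circ_circPt] at h
  exact hab h

theorem mem_minusPts {x : Gen w} {v : Pt w} :
    (∃ u ∈ minusPts x, circles w x.res u v) ↔ x.at v = false := by
  simp only [minusPts, List.mem_map, Finset.mem_toList, Finset.mem_filter, Finset.mem_univ,
    true_and]
  constructor
  · rintro ⟨u, ⟨c, hc, rfl⟩, h⟩
    rw [circles_iff, circ_circPt] at h
    rw [Gen.at, ← h, hc]
  · intro h
    exact ⟨_, ⟨circ w x.res v, h, rfl⟩, by rw [circles_iff, circ_circPt]⟩

theorem genOf_eq {x : Gen w} {S : List (Pt w)}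
    (h : ∀ v, (∃ u ∈ S, circles w x.res u v) ↔ x.at v = false) : genOf x.res S = x := by
  refine Gen.ext_at rfl fun v => ?_
  have := (genOf_at_false (I := x.res) (S := S) (u := v)).trans (h v)
  revert this
  cases (genOf x.res S).at v <;> cases x.at v <;> simp

theorem basisVec_eq_xs (x : Gen w) : basisVec x = (khOps w).xs (minusPts x) (vac x.res) := by
  rw [xs_vac (minusPts_dist x), genOf_eq fun v => mem_minusPts]

/-- Two linear maps agree if they agree on products of operators applied to the `vac I`. -/
theorem linearMap_ext_xs {M : Type*} [AddCommGroup M] [Module (ZMod 2) M]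
    {f g : CKh w →ₗ[ZMod 2] M}
    (h : ∀ I S, Dist I S → f ((khOps w).xs S (vac I)) = g ((khOps w).xs S (vac I))) : f = g :=
  linearMap_ext fun x => by rw [basisVec_eq_xs]; exact h _ _ (minusPts_dist x)

/-! ### The filtration -/

/-- The points on the closing arcs. -/
def clPt (w : BraidWord n) (p : Fin n) : Pt w := (p, 0)

theorem trace_circ (I : Resolution w) (v : Pt w) :
    trace (clPt w) (circles w I) v =
      Finset.univ.filter fun p : Fin n => circ w I (p, 0) = circ w I v := by
  ext p; rw [mem_trace]; simp only [Finset.mem_filter, Finset.mem_univ, true_and]; rfl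

theorem nontrivial_iff (I : Resolution w) (v : Pt w) :
    (circ w I v).Nontrivial ↔ NT (clPt w) (circles w I) v := by
  rw [NT, trace_circ]; rfl

theorem card_nontrivial (I : Resolution w) :
    Finset.card {c : Circle w I | c.Nontrivial} = (oddTraces (clPt w) (circles w I)).card := by
  refine Finset.card_bij (fun c _ => Finset.univ.filter fun p : Fin n => circ w I (p, 0) = c) ?_ ?_ ?_
  · intro c hc
    obtain ⟨v, rfl⟩ := circ_surj c
    rw [mem_oddTraces]
    refine ⟨(Finset.mem_filter.1 hc).2, v, (trace_circ I v).symm⟩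
  · intro c hc c' hc' h
    obtain ⟨p, hp⟩ := Finset.card_pos.1 (Odd.pos (Finset.mem_filter.1 hc).2)
    have hp' := h ▸ hp
    rw [Finset.mem_filter] at hp hp'
    exact hp.2.symm.trans hp'.2
  · intro C hC
    obtain ⟨ho, v, rfl⟩ := mem_oddTraces.1 hC
    refine ⟨circ w I v, ?_, (trace_circ I v).symm⟩
    simp only [Finset.mem_filter, Finset.mem_univ, true_and]
    exact (nontrivial_iff I v).2 ho

theorem kGrading_eq (x : Gen w) : kGrading x = (oddTraces (clPt w) (circles w x.res)).card -
    2 * (Finset.card {c : Circle w x.res | c.Nontrivial ∧ x.lab c = false} : ℤ) := by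
  have h := Finset.card_filter_add_card_filter_not
    (s := ({c : Circle w x.res | c.Nontrivial} : Finset _)) (fun c => x.lab c = true)
  rw [card_nontrivial, Finset.filter_filter, Finset.filter_filter] at h
  simp only [Bool.not_eq_true] at h
  rw [kGrading, ← h]
  push_cast
  ring

theorem sum_ind_eq {I : Resolution w} {S : List (Pt w)} (hS : Dist I S) :
    ((S.map fun v => ind (NT (clPt w) (circles w I) v)).sum : ℤ) =
      ((Finset.univ.filter fun c : Circle w I => c.Nontrivial ∧ minusLab I S c = false).card : ℤ) := by
  induction S with
  | nil => simp [minusLab]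
  | cons v S ih =>
    rw [Dist, List.pairwise_cons] at hS
    rw [List.map_cons, List.sum_cons, ih hS.2]
    by_cases hv : NT (clPt w) (circles w I) v
    · rw [ind, if_pos hv]
      have : (Finset.univ.filter fun c : Circle w I => c.Nontrivial ∧ minusLab I (v :: S) c = false) =
          insert (circ w I v)
            (Finset.univ.filter fun c : Circle w I => c.Nontrivial ∧ minusLab I S c = false) := by
        ext c
        simp only [minusLab, Finset.mem_insert, Finset.mem_filter, Finset.mem_univ, true_and,
          decide_eq_false_iff_not, List.mem_cons, forall_eq_or_imp]
        constructor
        · rintro ⟨h1, h2⟩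
          by_cases e : c = circ w I v
          · exact Or.inl e
          · exact Or.inr ⟨h1, fun h => h2 ⟨Ne.symm e, h⟩⟩
        · rintro (rfl | ⟨h1, h2⟩)
          · exact ⟨(nontrivial_iff I v).2 hv, fun h => h.1 rfl⟩
          · exact ⟨h1, fun h => h2 h.2⟩
      rw [this, Finset.card_insert_of_notMem]
      · push_cast; ring
      · simp only [minusLab, Finset.mem_filter, Finset.mem_univ, true_and, not_and,
          decide_eq_false_iff_not, not_not]
        exact fun _ u hu e => hS.1 u hu e.symm
    · rw [ind, if_neg hv, zero_add]
      congr 2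
      ext c
      simp only [minusLab, Finset.mem_filter, Finset.mem_univ, true_and,
          decide_eq_false_iff_not, List.mem_cons, forall_eq_or_imp]
      refine and_congr_right fun hc => ?_
      have : circ w I v ≠ c := by
        rintro rfl; exact hv ((nontrivial_iff I v).1 hc)
      tauto

theorem kGrading_genOf {I : Resolution w} {S : List (Pt w)} (hS : Dist I S) :
    kGrading (genOf I S) = (oddTraces (clPt w) (circles w I)).card -
      2 * (S.map fun v => ind (NT (clPt w) (circles w I) v)).sum := by
  rw [sum_ind_eq hS, kGrading_eq]; rfl

theorem basisVec_mem_F {x : Gen w} {i : ℤ} (h : kGrading x ≤ i) : basisVec x ∈ F w i :=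
  Submodule.subset_span ⟨x, h, rfl⟩

theorem vac_adm (I : Resolution w) : (khOps w).Adm (clPt w) (circles w I) (vac I) :=
  ⟨vac_compat I, fun S hS => by
    rw [xs_vac hS]; exact basisVec_mem_F (kGrading_genOf hS).le⟩

/-- A linear map that does not raise the filtration of generators is filtered. -/
theorem map_F_le {M : Type*} [AddCommGroup M] [Module (ZMod 2) M] (f : CKh w →ₗ[ZMod 2] M)
    (G : ℤ → Submodule (ZMod 2) M) (hG : ∀ {i j}, i ≤ j → G i ≤ G j)
    (h : ∀ x, f (basisVec x) ∈ G (kGrading x)) (i : ℤ) {y : CKh w} (hy : y ∈ F w i) : f y ∈ G i := by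
  suffices F w i ≤ (G i).comap f from this hy
  refine Submodule.span_le.2 ?_
  rintro _ ⟨x, hx, rfl⟩
  exact hG hx (h x)

/-! ### The differential -/

theorem d_basisVec (x y : Gen w) : d w (basisVec x) y = if ∃ j, EdgeTerm j x y then 1 else 0 := by
  rw [d, basisVec, Matrix.mulVecLin_apply, Matrix.mulVec_single_one]
  rfl

theorem edgeTerm_iff {j : Fin w.length} {x y : Gen w} : EdgeTerm j x y ↔
    x.res j = false ∧ y.res = Function.update x.res j true ∧
    (∀ v, ¬ circles w x.res v (cornerA w j) → ¬ circles w x.res v (cornerB w j) →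
      x.at v = y.at v) ∧
    (if circles w x.res (cornerA w j) (cornerB w j) then
      ComulTerm (x.at (cornerA w j)) (y.at (cornerA w j)) (y.at (cornerB w j))
    else MulTerm (x.at (cornerA w j)) (x.at (cornerB w j)) (y.at (cornerA w j))) := Iff.rfl

theorem saddle_update {I : Resolution w} {j : Fin w.length} (hj : I j = false) :
    Saddle (circles w I) (circles w (Function.update I j true)) (cornerA w j) (cornerB w j) :=
  saddle_of_ne j (by rw [hj, Function.update_self]; simp)
    fun k hk => (Function.update_of_ne hk _ _).symm

theorem mulTerm_iff (a b c : Bool) :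
    MulTerm a b c ↔ (a = true ∨ b = true) ∧ c = (a && b) := by
  cases a <;> cases b <;> cases c <;> simp [MulTerm]

theorem comulTerm_iff (a b c : Bool) :
    ComulTerm a b c ↔ (a = false ∧ b = false ∧ c = false) ∨ (a = true ∧ b = !c) := by
  cases a <;> cases b <;> cases c <;> simp [ComulTerm]

end BraidKh

/-! ### The differential as a sum of saddle maps. -/

namespace BraidKh

variable {n : ℕ} {w : BraidWord n}

open FiltOps

theorem Dist.eq_of {I : Resolution w} {S : List (Pt w)} (hS : Dist I S) {u v : Pt w} (hu : u ∈ S)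
    (hv : v ∈ S) (h : circles w I u v) : u = v := by
  by_contra hne
  have : Std.Symm fun u v : Pt w => ¬ circles w I u v := ⟨fun _ _ hr k => hr ((circles w I).symm k)⟩
  exact List.Pairwise.forall hS hu hv hne h

/-- A generator at `J` is determined by its labels at `a`, at `b` and off the circles through them.
Equality of generators thus takes the shape of the conditions in `EdgeTerm`. -/
theorem eq_iff_of_off {I J : Resolution w} {a b : Pt w} {x y z : Gen w}
    (hcov : ∀ v, circles w I v a ∨ circles w I v b → circles w J v a ∨ circles w J v b)
    (hz : z.res = J)
    (hoff : ∀ v, ¬ circles w I v a → ¬ circles w I v b → x.at v = z.at v) :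
    y = z ↔ y.res = J ∧ (∀ v, ¬ circles w I v a → ¬ circles w I v b → x.at v = y.at v) ∧
      y.at a = z.at a ∧ y.at b = z.at b := by
  constructor
  · rintro rfl; exact ⟨hz, hoff, rfl, rfl⟩
  · rintro ⟨h1, h2, h3, h4⟩
    refine Gen.ext_at (h1.trans hz.symm) fun v => ?_
    by_cases ha : circles w I v a ∨ circles w I v b
    · rcases hcov v ha with k | k
      · rw [y.at_congr (h1.symm ▸ k), z.at_congr (hz.symm ▸ k), h3]
      · rw [y.at_congr (h1.symm ▸ k), z.at_congr (hz.symm ▸ k), h4]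
    · push Not at ha
      rw [← h2 v ha.1 ha.2, hoff v ha.1 ha.2]

theorem bool_eq_of_false_iff {a b : Bool} (h : a = false ↔ b = false) : a = b := by
  cases a <;> cases b <;> simp_all

/-- For a merge the same list of points is read in the new resolution. If it meets both old circles,
it meets the new one twice and the product vanishes, as does v₋v₋. -/
theorem edge_merge {I J : Resolution w} {j : Fin w.length} (hj : I j = false)
    (hJ : J = Function.update I j true) {S : List (Pt w)} (hS : Dist I S)
    (k : Fuse (circles w I) (circles w J) (cornerA w j) (cornerB w j)) (y : Gen w) :
    (khOps w).xs S (vac J) y = if EdgeTerm j (genOf I S) y then 1 else 0 := by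
  set a := cornerA w j
  set b := cornerB w j
  set x := genOf I S with hx
  have hE : EdgeTerm j x y ↔ y.res = J ∧
      (∀ v, ¬ circles w I v a → ¬ circles w I v b → x.at v = y.at v) ∧
      (x.at a = true ∨ x.at b = true) ∧ y.at a = (x.at a && x.at b) := by
    rw [edgeTerm_iff, if_neg (show ¬ circles w x.res a b from k.ne), mulTerm_iff,
      and_iff_right (show x.res j = false from hj), hJ]
    rfl
  have hSb : ∀ v, x.at v = false ↔ ∃ u ∈ S, circles w I u v := fun v => genOf_at_false
  by_cases hab : x.at a = false ∧ x.at b = false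
  · rw [if_neg]
    · rw [(vac_compat J).xs_zero]; rfl
      intro hp
      obtain ⟨u, hu, hua⟩ := (hSb a).1 hab.1
      obtain ⟨v, hv, hvb⟩ := (hSb b).1 hab.2
      have := Dist.eq_of hp hu hv ((circles w J).trans (k.le hua)
        ((circles w J).trans k.joined ((circles w J).symm (k.le hvb))))
      subst this
      exact k.ne ((circles w I).trans ((circles w I).symm hua) hvb)
    · rw [hE]; rintro ⟨-, -, h, -⟩
      simp [hab.1, hab.2] at h
  · have hD : Dist J S := by
      refine hS.imp_of_mem fun {u v} hu hv hn e => ?_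
      rcases (k.iff u v).1 e with e | ⟨e1, e2⟩
      · exact hn e
      · rcases e1 with e1 | e1 <;> rcases e2 with e2 | e2
        · exact hn ((circles w I).trans e1 ((circles w I).symm e2))
        · exact hab ⟨(hSb a).2 ⟨u, hu, e1⟩, (hSb b).2 ⟨v, hv, e2⟩⟩
        · exact hab ⟨(hSb a).2 ⟨v, hv, e2⟩, (hSb b).2 ⟨u, hu, e1⟩⟩
        · exact hn ((circles w I).trans e1 ((circles w I).symm e2))
    rw [xs_vac hD, basisVec_apply]
    congr 1
    have hza : (genOf J S).at a = (x.at a && x.at b) := by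
      refine bool_eq_of_false_iff ?_
      rw [genOf_at_false, Bool.and_eq_false_iff, hSb, hSb]
      constructor
      · rintro ⟨u, hu, e⟩
        rcases (k.iff u a).1 e with e | ⟨e | e, -⟩
        · exact Or.inl ⟨u, hu, e⟩
        · exact Or.inl ⟨u, hu, e⟩
        · exact Or.inr ⟨u, hu, e⟩
      · rintro (⟨u, hu, e⟩ | ⟨u, hu, e⟩)
        · exact ⟨u, hu, k.le e⟩
        · exact ⟨u, hu, (circles w J).trans (k.le e) ((circles w J).symm k.joined)⟩
    rw [eq_iff_of_off (I := I) (J := J) (a := a) (b := b) (x := x) ?_ rfl ?_, hE]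
    · have hor : x.at a = true ∨ x.at b = true := by
        by_contra hc
        push Not at hc
        exact hab ⟨by simpa using hc.1, by simpa using hc.2⟩
      rw [hza, ← (genOf J S).at_congr k.joined, hza]
      refine propext (and_congr_right fun h1 => and_congr_right fun _ => ?_)
      rw [and_iff_right hor]
      refine ⟨fun h => h.1, fun h => ⟨h, ?_⟩⟩
      rw [← h]; exact (y.at_congr (h1.symm ▸ k.joined)).symm
    · intro v h
      exact h.imp k.le k.le
    · intro v ha hb
      refine bool_eq_of_false_iff ?_
      rw [hSb, genOf_at_false]
      refine exists_congr fun u => and_congr_right fun _ => ?_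
      rw [k.iff]
      exact ⟨Or.inl, fun h => h.resolve_right fun h => (h.2.elim ha hb)⟩

/-- If the circle is labeled v₋, its point in `S` lies on one of the new circles; the summand there
vanishes and the other one is v₋ ⊗ v₋. If it is labeled v₊, the two summands are the two terms of
the coproduct. -/
theorem edge_split {I J : Resolution w} {j : Fin w.length} (hj : I j = false)
    (hJ : J = Function.update I j true) {S : List (Pt w)} (hS : Dist I S)
    (k : Fuse (circles w J) (circles w I) (cornerA w j) (cornerB w j)) (y : Gen w) :
    (khOps w).xs S ((khOps w).X (cornerA w j) (vac J) + (khOps w).X (cornerB w j) (vac J)) y =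
      if EdgeTerm j (genOf I S) y then 1 else 0 := by
  set a := cornerA w j
  set b := cornerB w j
  set x := genOf I S with hx
  have hE : EdgeTerm j x y ↔ y.res = J ∧
      (∀ v, ¬ circles w I v a → ¬ circles w I v b → x.at v = y.at v) ∧
      ((x.at a = false ∧ y.at a = false ∧ y.at b = false) ∨ (x.at a = true ∧ y.at a = !y.at b)) := by
    rw [edgeTerm_iff, if_pos (show circles w x.res a b from k.joined), comulTerm_iff,
      and_iff_right (show x.res j = false from hj), hJ]
    rfl
  have hSb : ∀ v, x.at v = false ↔ ∃ u ∈ S, circles w I u v := fun v => genOf_at_false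
  have hD : Dist J S := hS.imp fun hn e => hn (k.le e)
  have hcov : ∀ v, circles w I v a ∨ circles w I v b → circles w J v a ∨ circles w J v b := by
    intro v h
    have h' : circles w I v a := h.elim id fun h => (circles w I).trans h ((circles w I).symm k.joined)
    rcases (k.iff v a).1 h' with h | h
    · exact Or.inl h
    · exact h.1
  have hoff : ∀ c, circles w I c a → ∀ v, ¬ circles w I v a → ¬ circles w I v b →
      x.at v = (genOf J (c :: S)).at v := by
    intro c hc v ha hb
    refine bool_eq_of_false_iff ?_
    rw [hSb, genOf_at_false]
    constructor
    · rintro ⟨u, hu, e⟩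
      refine ⟨u, List.mem_cons_of_mem _ hu, ?_⟩
      rcases (k.iff u v).1 e with e | ⟨-, e | e⟩
      · exact e
      · exact absurd (k.le e) ha
      · exact absurd (k.le e) hb
    · rintro ⟨u, hu, e⟩
      rcases List.mem_cons.1 hu with rfl | hu
      · exact absurd ((circles w I).trans ((circles w I).symm (k.le e)) hc) ha
      · exact ⟨u, hu, k.le e⟩
  have hba : circles w I b a := (circles w I).symm k.joined
  have eqz : ∀ c, circles w I c a → (y = genOf J (c :: S) ↔ y.res = J ∧
      (∀ v, ¬ circles w I v a → ¬ circles w I v b → x.at v = y.at v) ∧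
      y.at a = (genOf J (c :: S)).at a ∧ y.at b = (genOf J (c :: S)).at b) := fun c hc =>
    eq_iff_of_off hcov rfl (hoff c hc)
  rw [map_add, ← X_xs, ← X_xs, ← xs_cons, ← xs_cons]
  cases hxa : x.at a
  · obtain ⟨s, hs, hsa⟩ := (hSb a).1 hxa
    have huniq : ∀ u ∈ S, circles w I u a → u = s := fun u hu e =>
      Dist.eq_of hS hu hs ((circles w I).trans e ((circles w I).symm hsa))
    have fin : ∀ c, (genOf J (c :: S)).at a = false → (genOf J (c :: S)).at b = false →
        circles w I c a → (y = genOf J (c :: S) ↔ EdgeTerm j x y) := by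
      intro c h1 h2 hc
      rw [eqz c hc, hE, hxa, h1, h2]
      simp
    rcases hcov s (Or.inl hsa) with e | e
    · have hDb : Dist J (b :: S) := by
        refine List.pairwise_cons.2 ⟨fun u hu eu => ?_, hD⟩
        have : u = s := huniq u hu ((circles w I).trans ((circles w I).symm (k.le eu)) hba)
        subst this
        exact k.ne ((circles w J).symm ((circles w J).trans eu e))
      have hDa : ¬ Dist J (a :: S) := fun h =>
        (List.pairwise_cons.1 h).1 s hs ((circles w J).symm e)
      rw [(vac_compat J).xs_zero hDa, zero_add, xs_vac hDb, basisVec_apply]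
      congr 1
      refine propext (fin b ?_ ?_ hba)
      · exact genOf_at_false.2 ⟨s, by simp [hs], e⟩
      · exact genOf_at_false.2 ⟨b, by simp, (circles w J).refl b⟩
    · have hDa : Dist J (a :: S) := by
        refine List.pairwise_cons.2 ⟨fun u hu eu => ?_, hD⟩
        have : u = s := huniq u hu ((circles w I).symm (k.le eu))
        subst this
        exact k.ne ((circles w J).trans eu e)
      have hDb : ¬ Dist J (b :: S) := fun h =>
        (List.pairwise_cons.1 h).1 s hs ((circles w J).symm e)
      rw [(vac_compat J).xs_zero hDb, add_zero, xs_vac hDa, basisVec_apply]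
      congr 1
      refine propext (fin a ?_ ?_ ((circles w I).refl a))
      · exact genOf_at_false.2 ⟨a, by simp, (circles w J).refl a⟩
      · exact genOf_at_false.2 ⟨s, by simp [hs], e⟩
  · have hno : ∀ u ∈ S, ¬ circles w I u a := fun u hu e => by
      rw [(hSb a).2 ⟨u, hu, e⟩] at hxa; simp at hxa
    have hna : ∀ u ∈ S, ¬ circles w J u a := fun u hu e => hno u hu (k.le e)
    have hnb : ∀ u ∈ S, ¬ circles w J u b := fun u hu e =>
      hno u hu ((circles w I).trans (k.le e) hba)
    have hDa : Dist J (a :: S) := List.pairwise_cons.2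
      ⟨fun u hu e => hna u hu ((circles w J).symm e), hD⟩
    have hDb : Dist J (b :: S) := List.pairwise_cons.2
      ⟨fun u hu e => hnb u hu ((circles w J).symm e), hD⟩
    have h1 : (genOf J (a :: S)).at a = false :=
      genOf_at_false.2 ⟨a, by simp, (circles w J).refl a⟩
    have h2 : (genOf J (b :: S)).at b = false :=
      genOf_at_false.2 ⟨b, by simp, (circles w J).refl b⟩
    have h3 : (genOf J (a :: S)).at b = true := by
      rw [genOf_at_true]; intro v hv
      rcases List.mem_cons.1 hv with rfl | hv
      · exact k.ne
      · exact hnb v hv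
    have h4 : (genOf J (b :: S)).at a = true := by
      rw [genOf_at_true]; intro v hv
      rcases List.mem_cons.1 hv with rfl | hv
      · exact fun e => k.ne ((circles w J).symm e)
      · exact hna v hv
    rw [xs_vac hDa, xs_vac hDb, Pi.add_apply, basisVec_apply, basisVec_apply]
    have e1 := eqz a ((circles w I).refl a)
    have e2 := eqz b hba
    rw [h1, h3] at e1
    rw [h2, h4] at e2
    simp only [e1, e2, hE, hxa]
    by_cases hy : y.res = J ∧ ∀ v, ¬ circles w I v a → ¬ circles w I v b → x.at v = y.at v
    · simp only [hy.1, true_and, and_iff_right hy.2]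
      cases y.at a <;> cases y.at b <;> simp
    · rw [if_neg (fun h => hy ⟨h.1, h.2.1⟩), if_neg (fun h => hy ⟨h.1, h.2.1⟩),
        if_neg (fun h => hy ⟨h.1, h.2.1⟩), add_zero]

/-- The part of the differential of `vac I` at the `j`-th crossing. -/
def dEdge (I : Resolution w) (j : Fin w.length) : CKh w :=
  if I j = false then
    (khOps w).theta (circles w I) (cornerA w j) (cornerB w j) (vac (Function.update I j true))
  else 0

theorem dEdge_compat (I : Resolution w) (j : Fin w.length) :
    (khOps w).Compat (circles w I) (dEdge I j) := by
  unfold dEdge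
  split_ifs with h
  · exact (vac_compat _).theta (saddle_update h)
  · exact Compat.zero

theorem xs_dEdge_apply {I : Resolution w} {S : List (Pt w)} (hS : Dist I S) (j : Fin w.length)
    (y : Gen w) :
    (khOps w).xs S (dEdge I j) y = if EdgeTerm j (genOf I S) y then 1 else 0 := by
  unfold dEdge
  by_cases hj : I j = false
  · rw [if_pos hj]
    by_cases e : circles w I (cornerA w j) (cornerB w j)
    · rw [theta_of e]
      exact edge_split hj rfl hS ((saddle_update hj).fuse' e) y
    · rw [theta_of_not e]
      exact edge_merge hj rfl hS ((saddle_update hj).fuse e) y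
  · rw [if_neg hj, map_zero, if_neg fun h => hj h.1]; rfl

theorem edgeTerm_unique {j k : Fin w.length} {x y : Gen w} (hj : EdgeTerm j x y)
    (hk : EdgeTerm k x y) : j = k := by
  by_contra hne
  have h1 := congrFun hj.2.1 j
  have h2 := congrFun hk.2.1 j
  rw [Function.update_self] at h1
  rw [Function.update_of_ne hne, hj.1] at h2
  simp [h1] at h2

theorem d_xs_vac_of_dist {I : Resolution w} {S : List (Pt w)} (hS : Dist I S) :
    d w ((khOps w).xs S (vac I)) = ∑ j, (khOps w).xs S (dEdge I j) := by
  rw [xs_vac hS]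
  ext y
  rw [d_basisVec, Finset.sum_apply]
  simp only [xs_dEdge_apply hS]
  by_cases h : ∃ j, EdgeTerm j (genOf I S) y
  · obtain ⟨j, hj⟩ := h
    rw [if_pos ⟨j, hj⟩, Finset.sum_eq_single j, if_pos hj]
    · intro k _ hk
      rw [if_neg fun h => hk (edgeTerm_unique h hj)]
    · simp
  · rw [if_neg h, Finset.sum_eq_zero]
    exact fun j _ => if_neg fun k => h ⟨j, k⟩

theorem d_xs_vac (I : Resolution w) (S : List (Pt w)) :
    d w ((khOps w).xs S (vac I)) = (khOps w).xs S (∑ j, dEdge I j) := by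
  rw [map_sum]
  by_cases hS : Dist I S
  · exact d_xs_vac_of_dist hS
  -- Lists that meet a circle twice give zero on both sides, so later arguments need not require
  -- distinct circles.
  · rw [(vac_compat I).xs_zero hS, map_zero, Finset.sum_eq_zero]
    exact fun j _ => (dEdge_compat I j).xs_zero hS

theorem d_vac (I : Resolution w) : d w (vac I) = ∑ j, dEdge I j := d_xs_vac I []

/-- Merging and splitting are linear over the operators. So `d` is determined by its values on the
vectors `vac I`. -/
theorem d_X (v : Pt w) (m : CKh w) : d w ((khOps w).X v m) = (khOps w).X v (d w m) := by
  suffices d w ∘ₗ (khOps w).X v = (khOps w).X v ∘ₗ d w from LinearMap.congr_fun this m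
  refine linearMap_ext_xs fun I S _ => ?_
  rw [LinearMap.comp_apply, LinearMap.comp_apply, ← xs_cons, d_xs_vac, d_xs_vac, xs_cons]

end BraidKh

/-! ### Linear maps prescribed on the vectors with all labels v₊, for points that may miss one
circle. -/

namespace BraidKh

open FiltOps

/-- Makes products independent of the choice of representatives: the lists are matched class by
class. -/
theorem FiltOps.Compat.xs_eq_of_classes {V N : Type*} [AddCommGroup N] [Module (ZMod 2) N]
    {O : FiltOps V N} {E : Setoid V} {m : N} (h : O.Compat E m) {S T : List V}
    (hS : S.Pairwise fun u v => ¬ E u v) (hT : T.Pairwise fun u v => ¬ E u v)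
    (hST : ∀ v, (∃ u ∈ S, E u v) ↔ ∃ u ∈ T, E u v) : O.xs S m = O.xs T m := by
  induction S generalizing T with
  | nil =>
    cases T with
    | nil => rfl
    | cons t T => exact absurd ((hST t).2 ⟨t, by simp, E.refl t⟩) (by simp)
  | cons s S ih =>
    obtain ⟨t, T', hp, hts, hT'⟩ := exists_perm_cons hT ((hST s).1 ⟨s, by simp, E.refl s⟩)
    have hpT := List.pairwise_cons.1 (pairwise_of_perm hp hT)
    rw [List.pairwise_cons] at hS
    rw [O.xs_perm hp, xs_cons, xs_cons, (h.xs T') t s hts, ih hS.2 hpT.2]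
    intro v
    constructor
    · rintro ⟨u, hu, e⟩
      obtain ⟨u', hu', e'⟩ := (hST v).1 ⟨u, by simp [hu], e⟩
      rcases List.mem_cons.1 (hp.mem_iff.1 hu') with rfl | hu'
      · exact absurd (E.trans (E.symm hts) (E.trans e' (E.symm e))) (hS.1 u hu)
      · exact ⟨u', hu', e'⟩
    · rintro ⟨u, hu, e⟩
      obtain ⟨u', hu', e'⟩ := (hST v).2 ⟨u, hp.mem_iff.2 (by simp [hu]), e⟩
      rcases List.mem_cons.1 hu' with rfl | hu'
      · exact absurd (E.trans e (E.symm e')) (hT' u hu)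
      · exact ⟨u', hu', e'⟩

variable {n : ℕ}

/-- A family of points that meets all circles of the resolutions of a diagram, except possibly
the circle through one point `mid`. -/
structure Outer (w : BraidWord n) (V : Type) where
  ι : V → Pt w
  cl : Fin n → V
  mid : Resolution w → Pt w
  cl_spec : ∀ I p, circles w I (ι (cl p)) (p, 0)
  cover : ∀ I v, (∃ x, circles w I v (ι x)) ∨ circles w I v (mid I)

namespace Outer

variable {w : BraidWord n} {V : Type} (A : Outer w V)

/-- Outer points on the same circle. -/
def rel (I : Resolution w) : Setoid V := (circles w I).comap A.ι

theorem rel_iff {I : Resolution w} {u v : V} : A.rel I u v ↔ circles w I (A.ι u) (A.ι v) := Iff.rfl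

/-- The circle through `mid` meets no outer point. -/
def Circled (I : Resolution w) : Prop := ∀ x, ¬ circles w I (A.ι x) (A.mid I)

/-- The operators at the outer points. -/
abbrev ops : FiltOps V (CKh w) := (khOps w).comap A.ι

theorem ops_xs (S : List V) (m : CKh w) : A.ops.xs S m = (khOps w).xs (S.map A.ι) m := by
  simp only [xs, List.map_map]; rfl

theorem vac_compat (I : Resolution w) : A.ops.Compat (A.rel I) (vac I) :=
  fun _ _ e => BraidKh.vac_compat I _ _ e

variable [Finite V]

/-- A list of outer points on the circles labeled `v₋` that meet outer points. -/
def minus (x : Gen w) : List V :=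
  letI : Fintype (Quotient (A.rel x.res)) := Fintype.ofFinite _
  (Finset.univ.filter fun q : Quotient (A.rel x.res) => x.at (A.ι q.out) = false).toList.map
    Quotient.out

theorem minus_dist (x : Gen w) : (A.minus x).Pairwise fun u v => ¬ A.rel x.res u v := by
  rw [minus, List.pairwise_map]
  refine (Finset.nodup_toList _).imp ?_
  intro a b hab h
  exact hab (Quotient.out_equiv_out.1 h)

theorem mem_minus {x : Gen w} {v : V} :
    (∃ u ∈ A.minus x, A.rel x.res u v) ↔ x.at (A.ι v) = false := by
  simp only [minus, List.mem_map, Finset.mem_toList, Finset.mem_filter, Finset.mem_univ, true_and]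
  constructor
  · rintro ⟨u, ⟨q, hq, rfl⟩, h⟩
    rwa [x.at_congr h] at hq
  · intro h
    have : A.rel x.res (Quotient.out (Quotient.mk (A.rel x.res) v)) v := Quotient.mk_out v
    refine ⟨_, ⟨Quotient.mk _ v, ?_, rfl⟩, this⟩
    rwa [x.at_congr this]


/-- The basic vector for a generator: `mid` is labeled `v₋` or not. -/
def base (x : Gen w) : CKh w :=
  if A.Circled x.res ∧ x.at (A.mid x.res) = false then (khOps w).X (A.mid x.res) (vac x.res)
  else vac x.res

/-- Points on the circles labeled `v₋`. -/
def minusAll (x : Gen w) : List (Pt w) :=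
  if A.Circled x.res ∧ x.at (A.mid x.res) = false then A.mid x.res :: (A.minus x).map A.ι
  else (A.minus x).map A.ι

theorem minusAll_dist (x : Gen w) : Dist x.res (A.minusAll x) := by
  have h : Dist x.res ((A.minus x).map A.ι) := List.pairwise_map.2 (A.minus_dist x)
  unfold minusAll
  split_ifs with hc
  · refine List.pairwise_cons.2 ⟨fun v hv e => ?_, h⟩
    obtain ⟨u, -, rfl⟩ := List.mem_map.1 hv
    exact hc.1 u ((circles w x.res).symm e)
  · exact h

theorem genOf_minusAll (x : Gen w) : genOf x.res (A.minusAll x) = x := by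
  refine genOf_eq fun v => ?_
  have key : ∀ y, circles w x.res v (A.ι y) →
      ((∃ u ∈ (A.minus x).map A.ι, circles w x.res u v) ↔ x.at v = false) := by
    intro y hy
    rw [x.at_congr hy, ← A.mem_minus]
    simp only [List.mem_map, exists_exists_and_eq_and]
    refine exists_congr fun u => and_congr_right fun _ => ?_
    exact ⟨fun e => (circles w x.res).trans e hy,
      fun e => (circles w x.res).trans e ((circles w x.res).symm hy)⟩
  unfold minusAll
  rcases A.cover x.res v with ⟨y, hy⟩ | hm
  · split_ifs with hc
    · rw [← key y hy]
      simp only [List.mem_cons, exists_eq_or_imp]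
      refine or_iff_right fun e => hc.1 y ?_
      exact (circles w x.res).symm ((circles w x.res).trans e hy)
    · exact key y hy
  · by_cases hC : A.Circled x.res
    · rw [x.at_congr hm]
      split_ifs with hc
      · simp only [hc.2, iff_true]
        exact ⟨_, by simp, (circles w x.res).symm hm⟩
      · have hf : ¬ x.at (A.mid x.res) = false := fun h => hc ⟨hC, h⟩
        refine iff_of_false ?_ hf
        rintro ⟨u, hu, e⟩
        obtain ⟨y, -, rfl⟩ := List.mem_map.1 hu
        exact hC y ((circles w x.res).trans e hm)
    · rw [if_neg fun h => hC h.1]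
      unfold Circled at hC
      push Not at hC
      obtain ⟨y, hy⟩ := hC
      exact key y ((circles w x.res).trans hm ((circles w x.res).symm hy))

theorem basisVec_eq (x : Gen w) : basisVec x = A.ops.xs (A.minus x) (A.base x) := by
  rw [← A.genOf_minusAll x, ← xs_vac (A.minusAll_dist x), A.genOf_minusAll, ops_xs]
  unfold minusAll base
  split_ifs
  · rw [xs_cons, X_xs]
  · rfl

/-- Linear maps that commute with the outer operators agree if they agree on the basic vectors. -/
theorem linearMap_ext {M : Type*} [AddCommGroup M] [Module (ZMod 2) M] {O : FiltOps V M}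
    {f g : CKh w →ₗ[ZMod 2] M}
    (hf : ∀ v m, f (A.ops.X v m) = O.X v (f m)) (hg : ∀ v m, g (A.ops.X v m) = O.X v (g m))
    (h0 : ∀ I, f (vac I) = g (vac I))
    (h1 : ∀ I, A.Circled I → f ((khOps w).X (A.mid I) (vac I)) = g ((khOps w).X (A.mid I) (vac I))) :
    f = g := by
  have hfx : ∀ (f : CKh w →ₗ[ZMod 2] M), (∀ v m, f (A.ops.X v m) = O.X v (f m)) →
      ∀ S m, f (A.ops.xs S m) = O.xs S (f m) := by
    intro f hf S m
    induction S with
    | nil => rfl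
    | cons v S ih => rw [xs_cons, xs_cons, hf, ih]
  refine BraidKh.linearMap_ext fun x => ?_
  rw [A.basisVec_eq, hfx f hf, hfx g hg]
  congr 1
  unfold base
  split_ifs with h
  · exact h1 _ h.1
  · exact h0 _

section Lift

variable {N : Type*} [AddCommGroup N] [Module (ZMod 2) N] (O : FiltOps V N)
  (n0 n1 : Resolution w → N)

/-- The linear map with prescribed values on the basic vectors. -/
def lift : CKh w →ₗ[ZMod 2] N :=
  (Pi.basisFun (ZMod 2) (Gen w)).constr (ZMod 2) fun x => O.xs (A.minus x)
    (if A.Circled x.res ∧ x.at (A.mid x.res) = false then n1 x.res else n0 x.res)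

theorem lift_basisVec (x : Gen w) : A.lift O n0 n1 (basisVec x) = O.xs (A.minus x)
    (if A.Circled x.res ∧ x.at (A.mid x.res) = false then n1 x.res else n0 x.res) := by
  rw [lift, show basisVec x = Pi.basisFun (ZMod 2) (Gen w) x by rw [Pi.basisFun_apply]; rfl,
    Module.Basis.constr_basis]

variable {O n0 n1}

/-- The map is defined on generators with chosen representatives of their circles. Another choice
gives the same product because `n0` is compatible, and a list with repeated circles gives zero on
both sides. -/
theorem lift_xs (h0 : ∀ I, O.Compat (A.rel I) (n0 I)) (I : Resolution w) (T : List V) :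
    A.lift O n0 n1 (A.ops.xs T (vac I)) = O.xs T (n0 I) := by
  by_cases hT : T.Pairwise fun u v => ¬ A.rel I u v
  · have hD : Dist I (T.map A.ι) := List.pairwise_map.2 hT
    rw [ops_xs, xs_vac hD, lift_basisVec]
    have hm : ¬ (A.Circled I ∧ (genOf I (T.map A.ι)).at (A.mid I) = false) := by
      rintro ⟨hc, h⟩
      obtain ⟨u, hu, e⟩ := genOf_at_false.1 h
      obtain ⟨y, -, rfl⟩ := List.mem_map.1 hu
      exact hc y e
    change O.xs _ (if A.Circled I ∧ (genOf I (T.map A.ι)).at (A.mid I) = false then n1 I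
      else n0 I) = _
    rw [if_neg hm]
    refine (h0 I).xs_eq_of_classes (A.minus_dist (genOf I (T.map A.ι))) hT fun v => ?_
    refine A.mem_minus.trans ?_
    rw [genOf_at_false]
    simp only [List.mem_map, exists_exists_and_eq_and]
    rfl
  · rw [(A.vac_compat I).xs_zero hT, (h0 I).xs_zero hT, map_zero]

theorem lift_xs_mid (h1 : ∀ I, O.Compat (A.rel I) (n1 I)) {I : Resolution w} (hI : A.Circled I)
    (T : List V) :
    A.lift O n0 n1 (A.ops.xs T ((khOps w).X (A.mid I) (vac I))) = O.xs T (n1 I) := by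
  by_cases hT : T.Pairwise fun u v => ¬ A.rel I u v
  · have hD : Dist I (A.mid I :: T.map A.ι) := by
      refine List.pairwise_cons.2 ⟨fun v hv e => ?_, List.pairwise_map.2 hT⟩
      obtain ⟨u, -, rfl⟩ := List.mem_map.1 hv
      exact hI u ((circles w I).symm e)
    rw [ops_xs, ← X_xs, ← xs_cons, xs_vac hD, lift_basisVec]
    have hm : (A.Circled I ∧ (genOf I (A.mid I :: T.map A.ι)).at (A.mid I) = false) :=
      ⟨hI, genOf_at_false.2 ⟨_, by simp, (circles w I).refl _⟩⟩
    change O.xs _ (if A.Circled I ∧ (genOf I (A.mid I :: T.map A.ι)).at (A.mid I) = false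
      then n1 I else n0 I) = _
    rw [if_pos hm]
    refine (h1 I).xs_eq_of_classes (A.minus_dist (genOf I (A.mid I :: T.map A.ι))) hT fun v => ?_
    refine A.mem_minus.trans ?_
    rw [genOf_at_false]
    simp only [List.mem_cons, exists_eq_or_imp, List.mem_map, exists_exists_and_eq_and]
    exact or_iff_right fun e => hI v ((circles w I).symm e)
  · have hc : A.ops.Compat (A.rel I) ((khOps w).X (A.mid I) (vac I)) :=
      fun u v e => (BraidKh.vac_compat I).X _ _ _ e
    rw [hc.xs_zero hT, (h1 I).xs_zero hT, map_zero]

theorem lift_vac (h0 : ∀ I, O.Compat (A.rel I) (n0 I)) (I : Resolution w) :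
    A.lift O n0 n1 (vac I) = n0 I := A.lift_xs h0 I []

theorem lift_mid (h1 : ∀ I, O.Compat (A.rel I) (n1 I)) {I : Resolution w} (hI : A.Circled I) :
    A.lift O n0 n1 ((khOps w).X (A.mid I) (vac I)) = n1 I := A.lift_xs_mid h1 hI []

theorem lift_X (h0 : ∀ I, O.Compat (A.rel I) (n0 I)) (h1 : ∀ I, O.Compat (A.rel I) (n1 I))
    (v : V) (m : CKh w) : A.lift O n0 n1 (A.ops.X v m) = O.X v (A.lift O n0 n1 m) := by
  suffices A.lift O n0 n1 ∘ₗ A.ops.X v = O.X v ∘ₗ A.lift O n0 n1 from LinearMap.congr_fun this m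
  refine BraidKh.linearMap_ext fun x => ?_
  rw [LinearMap.comp_apply, LinearMap.comp_apply, A.basisVec_eq, ← xs_cons]
  unfold base
  split_ifs with h
  · rw [A.lift_xs_mid h1 h.1, A.lift_xs_mid h1 h.1, xs_cons]
  · rw [A.lift_xs h0, A.lift_xs h0, xs_cons]

theorem lift_theta (h0 : ∀ I, O.Compat (A.rel I) (n0 I)) (h1 : ∀ I, O.Compat (A.rel I) (n1 I))
    (E : Setoid V) (a b : V) (m : CKh w) :
    A.lift O n0 n1 (A.ops.theta E a b m) = O.theta E a b (A.lift O n0 n1 m) := by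
  by_cases e : E a b
  · rw [theta_of e, theta_of e, map_add, A.lift_X h0 h1, A.lift_X h0 h1]
  · rw [theta_of_not e, theta_of_not e]

theorem lift_F (h0 : ∀ I, O.Adm A.cl (A.rel I) (n0 I)) (h1 : ∀ I, O.Adm A.cl (A.rel I) (n1 I))
    (i : ℤ) {m : CKh w} (hm : m ∈ F w i) : A.lift O n0 n1 m ∈ O.F i := by
  refine map_F_le _ O.F O.mono (fun x => ?_) i hm
  rw [lift_basisVec]
  have hk : kGrading x = (oddTraces A.cl (A.rel x.res)).card -
      2 * ((A.minus x).map fun v => ind (NT A.cl (A.rel x.res) v)).sum := by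
    have hg := kGrading_genOf (A.minusAll_dist x)
    rw [A.genOf_minusAll] at hg
    have ht : ∀ v, trace A.cl (A.rel x.res) v = trace (clPt w) (circles w x.res) (A.ι v) := by
      intro v
      ext p
      rw [mem_trace, mem_trace, rel_iff]
      have := A.cl_spec x.res p
      exact ⟨fun e => (circles w x.res).trans ((circles w x.res).symm this) e,
        fun e => (circles w x.res).trans this e⟩
    have hN : oddTraces A.cl (A.rel x.res) = oddTraces (clPt w) (circles w x.res) := by
      refine oddTraces_eq fun p q => ?_
      have hp := A.cl_spec x.res p
      have hq := A.cl_spec x.res q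
      exact ⟨fun e => (circles w x.res).trans ((circles w x.res).symm hp)
          ((circles w x.res).trans e hq),
        fun e => (circles w x.res).trans hp ((circles w x.res).trans e
          ((circles w x.res).symm hq))⟩
    have hs : ((A.minusAll x).map fun v => ind (NT (clPt w) (circles w x.res) v)).sum =
        ((A.minus x).map fun v => ind (NT A.cl (A.rel x.res) v)).sum := by
      have h2 : (((A.minus x).map A.ι).map fun v => ind (NT (clPt w) (circles w x.res) v)) =
          (A.minus x).map fun v => ind (NT A.cl (A.rel x.res) v) := by
        rw [List.map_map]
        refine List.map_congr_left fun v _ => ?_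
        simp only [Function.comp, NT, ht]
      unfold minusAll
      split_ifs with hc
      -- Every closing arc is represented by an outer point, so a circle without outer points is
      -- trivial, and its label does not matter for k.
      · rw [List.map_cons, List.sum_cons, h2, add_eq_right, ind, if_neg]
        intro hn
        obtain ⟨p, hp⟩ := Finset.card_pos.1 (Odd.pos hn)
        rw [mem_trace] at hp
        exact hc.1 _ ((circles w x.res).trans (A.cl_spec x.res p) hp)
      · rw [h2]
    rw [hg, hN, hs]
  rw [hk]
  split_ifs
  · exact (h1 x.res).mem _ (A.minus_dist x)
  · exact (h0 x.res).mem _ (A.minus_dist x)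

end Lift

end Outer

/-! ### Filtered chain maps that preserve `ψ` -/

/-- There is a filtered chain map that maps `ψ` to `ψ`. -/
structure FMap {n : ℕ} (w w' : BraidWord n) where
  f : CKh w →ₗ[ZMod 2] CKh w'
  comm : ∀ m, f (d w m) = d w' (f m)
  filt : ∀ i m, m ∈ F w i → f m ∈ F w' i
  map_psi : f (psi w) = psi w'

theorem psiVanishes_iff {w : BraidWord n} {i : ℤ} :
    PsiVanishes w i ↔ psi w ∈ F w i ∧ d w (psi w) = 0 ∧ ∃ y ∈ F w i, d w y = psi w := by
  unfold PsiVanishes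
  constructor
  · rintro ⟨h, h0⟩
    rw [Submodule.Quotient.mk_eq_zero] at h0
    obtain ⟨y, hy, e⟩ := h0
    exact ⟨h.1, h.2, y, hy, e⟩
  · rintro ⟨h1, h2, y, hy, e⟩
    refine ⟨⟨h1, h2⟩, ?_⟩
    rw [Submodule.Quotient.mk_eq_zero]
    exact ⟨y, hy, e⟩

theorem FMap.psiVanishes {w w' : BraidWord n} (g : FMap w w') {i : ℤ} (h : PsiVanishes w i) :
    PsiVanishes w' i := by
  rw [psiVanishes_iff] at h ⊢
  obtain ⟨h1, h2, y, hy, e⟩ := h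
  refine ⟨?_, ?_, g.f y, g.filt i y hy, ?_⟩
  · rw [← g.map_psi]; exact g.filt i _ h1
  · rw [← g.map_psi, ← g.comm, h2, map_zero]
  · rw [← g.comm, e, g.map_psi]

theorem FMap.range {w w' : BraidWord n} (g : FMap w w') (h : psi w ∈ LinearMap.range (d w)) :
    psi w' ∈ LinearMap.range (d w') := by
  obtain ⟨y, hy⟩ := h
  exact ⟨g.f y, by rw [← g.comm, hy, g.map_psi]⟩

/-- There are filtered chain maps in both directions that map `ψ` to `ψ`. -/
def KEquiv {n : ℕ} (w w' : BraidWord n) : Prop := Nonempty (FMap w w') ∧ Nonempty (FMap w' w)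

/-- A filtered map that preserves ψ carries chains with boundary ψ to such chains in the same level.
The two maps need not be inverse to each other, not even up to homotopy. -/
theorem KEquiv.kappa_eq {w w' : BraidWord n} (h : KEquiv w w') : kappa w = kappa w' := by
  obtain ⟨⟨f⟩, ⟨g⟩⟩ := h
  have h1 : psi w ∈ LinearMap.range (d w) ↔ psi w' ∈ LinearMap.range (d w') :=
    ⟨f.range, g.range⟩
  have h2 : {i : ℤ | PsiVanishes w i} = {i : ℤ | PsiVanishes w' i} :=
    Set.ext fun i => ⟨f.psiVanishes, g.psiVanishes⟩
  unfold kappa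
  rw [h2]
  by_cases h : psi w ∈ LinearMap.range (d w)
  · rw [if_pos h, if_pos (h1.1 h)]
  · rw [if_neg h, if_neg fun k => h (h1.2 k)]

/-- The identity. -/
def FMap.refl (w : BraidWord n) : FMap w w := ⟨LinearMap.id, fun _ => rfl, fun _ _ h => h, rfl⟩

/-- Composition. -/
def FMap.trans {w w' w'' : BraidWord n} (f : FMap w w') (g : FMap w' w'') : FMap w w'' where
  f := g.f ∘ₗ f.f
  comm m := by rw [LinearMap.comp_apply, f.comm, g.comm]; rfl
  filt i m h := g.filt i _ (f.filt i m h)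
  map_psi := by rw [LinearMap.comp_apply, f.map_psi, g.map_psi]

theorem psi_eq (w : BraidWord n) : psi w = basisVec ⟨braidlike w, fun _ => false⟩ := rfl

theorem xs_vac_eq_psi {w : BraidWord n} {S : List (Pt w)} (hS : Dist (braidlike w) S)
    (h : ∀ v, ∃ u ∈ S, circles w (braidlike w) u v) :
    (khOps w).xs S (vac (braidlike w)) = psi w := by
  rw [xs_vac hS, psi_eq, ← genOf_eq (x := ⟨braidlike w, fun _ => false⟩) (S := S)]
  intro v
  exact iff_of_true (h v) rfl

/-- In the braidlike resolution no strand leaves its position, so the circles are the `n` closed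
strands. In particular ψ is the product of the operators at any `n` points, one on each strand,
applied to `vac`. -/
theorem braidlike_circles {w : BraidWord n} {u v : Pt w} :
    circles w (braidlike w) u v ↔ u.1 = v.1 := by
  constructor
  · refine circles_le (E := Setoid.ker Prod.fst) fun u v h => ?_
    cases h with
    | closing p => rfl
    | away j p hl hr => rfl
    | left j h => rfl
    | right j h => rfl
    | cap j h => exact absurd rfl h
    | cup j h => exact absurd rfl h
  · obtain ⟨p, t⟩ := u
    obtain ⟨q, s⟩ := v
    rintro (rfl : p = q)
    have key : ∀ t, circles w (braidlike w) (p, t) (p, 0) := by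
      intro t
      induction t using Fin.induction with
      | zero => exact (circles w _).refl _
      | succ j ih =>
        refine (circles w _).trans ((circles w _).symm ?_) ih
        have := turn_circles_up (I := braidlike w) j p
        rwa [turn_braid rfl] at this
    exact (circles w _).trans (key t) ((circles w _).symm (key s))

/-- `ψ` in terms of any points that represent the strands. -/
theorem psi_eq_xs (w : BraidWord n) (c : Fin n → Pt w) (hc : ∀ p, (c p).1 = p) :
    (khOps w).xs ((List.finRange n).map c) (vac (braidlike w)) = psi w := by
  refine xs_vac_eq_psi ?_ fun v => ?_
  · rw [Dist, List.pairwise_map]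
    refine (List.nodup_finRange n).imp fun {p q} hpq e => hpq ?_
    rwa [braidlike_circles, hc, hc] at e
  · exact ⟨c v.1, List.mem_map.2 ⟨v.1, List.mem_finRange _, rfl⟩, by rw [braidlike_circles, hc]⟩

theorem Outer.psi_eq {w : BraidWord n} {V : Type} (A : Outer w V) :
    psi w = A.ops.xs ((List.finRange n).map A.cl) (vac (braidlike w)) := by
  rw [A.ops_xs, List.map_map, psi_eq_xs]
  exact fun p => braidlike_circles.1 (A.cl_spec _ p)

/-- A filtered chain map from its values on the basic vectors. -/
def Outer.fmap {w w' : BraidWord n} {V : Type} [Finite V] (A : Outer w V) (ι' : V → Pt w')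
    (n0 n1 : Resolution w → CKh w') (h0 : ∀ I, ((khOps w').comap ι').Adm A.cl (A.rel I) (n0 I))
    (h1 : ∀ I, ((khOps w').comap ι').Adm A.cl (A.rel I) (n1 I))
    (hd0 : ∀ I, A.lift ((khOps w').comap ι') n0 n1 (d w (vac I)) = d w' (n0 I))
    (hd1 : ∀ I, A.Circled I →
      A.lift ((khOps w').comap ι') n0 n1 ((khOps w).X (A.mid I) (d w (vac I))) = d w' (n1 I))
    (hpsi : ((khOps w').comap ι').xs ((List.finRange n).map A.cl) (n0 (braidlike w)) = psi w') : FMap w w' where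
  f := A.lift ((khOps w').comap ι') n0 n1
  comm := by
    have c0 := fun I => (h0 I).compat
    have c1 := fun I => (h1 I).compat
    suffices A.lift ((khOps w').comap ι') n0 n1 ∘ₗ d w = d w' ∘ₗ A.lift ((khOps w').comap ι') n0 n1 from
      fun m => LinearMap.congr_fun this m
    refine A.linearMap_ext (O := ((khOps w').comap ι')) (fun v m => ?_) (fun v m => ?_) (fun I => ?_)
      (fun I hI => ?_)
    · rw [LinearMap.comp_apply, LinearMap.comp_apply, ← A.lift_X c0 c1]
      congr 1
      exact d_X _ _
    · rw [LinearMap.comp_apply, LinearMap.comp_apply, A.lift_X c0 c1]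
      exact d_X _ _
    · rw [LinearMap.comp_apply, LinearMap.comp_apply, hd0, A.lift_vac c0]
    · rw [LinearMap.comp_apply, LinearMap.comp_apply, d_X, hd1 I hI, A.lift_mid c1 hI]
  filt i _ hm := A.lift_F h0 h1 i hm
  map_psi := by rw [A.psi_eq, A.lift_xs fun I => (h0 I).compat, hpsi]

end BraidKh

namespace BraidKh

open FiltOps

variable {n : ℕ}

/-! ### Slabs: the part of a diagram between two levels -/

/-- The left strand of a letter. -/
def letL (s : Fin (n - 1) × Bool) : Fin n := ⟨s.1.val, by have := s.1.isLt; omega⟩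

/-- The right strand of a letter. -/
def letR (s : Fin (n - 1) × Bool) : Fin n := ⟨s.1.val + 1, by have := s.1.isLt; omega⟩


/-- The points `bot p` and `top p` are connected by `E` as at a crossing `s` with resolution `b`. -/
structure Slab {V : Type*} (E : Setoid V) (bot top : Fin n → V) (s : Fin (n - 1) × Bool)
    (b : Bool) : Prop where
  away : ∀ p, p ≠ letL s → p ≠ letR s → E (bot p) (top p)
  left : b = !s.2 → E (bot (letL s)) (top (letL s))
  right : b = !s.2 → E (bot (letR s)) (top (letR s))
  cap : b ≠ !s.2 → E (bot (letL s)) (bot (letR s))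
  cup : b ≠ !s.2 → E (top (letL s)) (top (letR s))

theorem Slab.symm {V : Type*} {E : Setoid V} {bot top : Fin n → V} {s : Fin (n - 1) × Bool}
    {b : Bool} (h : Slab E bot top s b) : Slab E top bot s b :=
  ⟨fun p h1 h2 => E.symm (h.away p h1 h2), fun k => E.symm (h.left k), fun k => E.symm (h.right k),
    h.cup, h.cap⟩

theorem Slab.congr {V : Type*} {E : Setoid V} {bot top bot' top' : Fin n → V}
    {s : Fin (n - 1) × Bool} {b : Bool} (h : Slab E bot top s b) (hb : ∀ p, E (bot p) (bot' p))
    (ht : ∀ p, E (top p) (top' p)) : Slab E bot' top' s b where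
  away p h1 h2 := E.trans (E.symm (hb p)) (E.trans (h.away p h1 h2) (ht p))
  left k := E.trans (E.symm (hb _)) (E.trans (h.left k) (ht _))
  right k := E.trans (E.symm (hb _)) (E.trans (h.right k) (ht _))
  cap k := E.trans (E.symm (hb _)) (E.trans (h.cap k) (hb _))
  cup k := E.trans (E.symm (ht _)) (E.trans (h.cup k) (ht _))

theorem Slab.straight {V : Type*} {E : Setoid V} {bot top : Fin n → V} {s : Fin (n - 1) × Bool}
    {b : Bool} (h : Slab E bot top s b) (hb : b = !s.2) (p : Fin n) : E (bot p) (top p) := by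
  by_cases h1 : p = letL s
  · subst h1; exact h.left hb
  · by_cases h2 : p = letR s
    · subst h2; exact h.right hb
    · exact h.away p h1 h2

theorem circles_slab {w : BraidWord n} {I : Resolution w} (j : Fin w.length) :
    Slab (circles w I) (fun p => (p, j.castSucc)) (fun p => (p, j.succ)) (w.get j) (I j) :=
  ⟨fun p h1 h2 => (Joined.away j p h1 h2).circles, fun h => (Joined.left j h).circles,
    fun h => (Joined.right j h).circles, fun h => (Joined.cap j h).circles,
    fun h => (Joined.cup j h).circles⟩

theorem circles_closing {w : BraidWord n} {I : Resolution w} (p : Fin n) :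
    circles w I (p, Fin.last _) (p, 0) := (Joined.closing p).circles

theorem circles_map {V : Type*} {w : BraidWord n} {I : Resolution w} {E : Setoid V} (f : Pt w → V)
    (hc : ∀ p, E (f (p, Fin.last _)) (f (p, 0)))
    (hs : ∀ j, Slab E (fun p => f (p, j.castSucc)) (fun p => f (p, j.succ)) (w.get j) (I j))
    {u v : Pt w} (h : circles w I u v) : E (f u) (f v) := by
  refine circles_le (E := E.comap f) (fun u v h => ?_) h
  cases h with
  | closing p => exact hc p
  | away j p hl hr => exact (hs j).away p hl hr
  | left j h => exact (hs j).left h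
  | right j h => exact (hs j).right h
  | cap j h => exact (hs j).cap h
  | cup j h => exact (hs j).cup h

/-! ### The arc may be placed at any level -/

theorem card_oddTraces_congr {V : Type*} [Finite V] {cl cl' : Fin n → V} {E : Setoid V}
    (h : ∀ v, NT cl E v ↔ NT cl' E v) :
    (oddTraces cl E).card = (oddTraces cl' E).card := by
  have : Fintype (Quotient E) := Fintype.ofFinite _
  have key : ∀ cl : Fin n → V, (oddTraces cl E).card =
      (Finset.univ.filter fun q : Quotient E => NT cl E q.out).card := by
    intro cl
    symm
    refine Finset.card_bij (fun q _ => trace cl E q.out) ?_ ?_ ?_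
    · intro q hq
      exact mem_oddTraces.2 ⟨(Finset.mem_filter.1 hq).2, _, rfl⟩
    · intro q hq q' hq' e
      obtain ⟨p, hp⟩ := Finset.card_pos.1 (Odd.pos (Finset.mem_filter.1 hq).2)
      have hp' := e ▸ hp
      rw [mem_trace] at hp hp'
      exact Quotient.out_equiv_out.1 (E.trans (E.symm hp) hp')
    · intro C hC
      obtain ⟨ho, v, rfl⟩ := mem_oddTraces.1 hC
      have hv : E (Quotient.out (Quotient.mk E v)) v := Quotient.mk_out v
      refine ⟨Quotient.mk E v, Finset.mem_filter.2 ⟨Finset.mem_univ _, ?_⟩, trace_congr hv⟩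
      exact (NT_congr hv).2 ho
  rw [key, key]
  simp only [h]

/-- At a bent crossing the two strands are joined below and joined above. On each side they
contribute both or neither to a class, so the parity is the same on both sides. -/
theorem NT_slab {V : Type*} {E : Setoid V} {bot top : Fin n → V} {s : Fin (n - 1) × Bool}
    {b : Bool} (h : Slab E bot top s b) (v : V) : NT bot E v ↔ NT top E v := by
  by_cases hb : b = !s.2
  · have : trace bot E v = trace top E v := by
      ext p; rw [mem_trace, mem_trace]
      have := h.straight hb p
      exact ⟨fun e => E.trans (E.symm this) e, fun e => E.trans this e⟩
    rw [NT, NT, this]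
  · have hne : letL s ≠ letR s := fun e => by
      have := congrArg Fin.val e; simp [letL, letR] at this
    have parity : ∀ c : Fin n → V, E (c (letL s)) (c (letR s)) →
        (NT c E v ↔ Odd ((trace c E v).filter fun p => p ≠ letL s ∧ p ≠ letR s).card) := by
      intro c hc
      by_cases hl : E (c (letL s)) v
      · have hr : E (c (letR s)) v := E.trans (E.symm hc) hl
        have : trace c E v = insert (letL s) (insert (letR s)
            ((trace c E v).filter fun p => p ≠ letL s ∧ p ≠ letR s)) := by
          ext p
          simp only [Finset.mem_insert, Finset.mem_filter, mem_trace]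
          constructor
          · intro hp; tauto
          · rintro (rfl | rfl | hp)
            exacts [hl, hr, hp.1]
        rw [NT]
        conv_lhs => rw [this]
        rw [Finset.card_insert_of_notMem (by simp [hne]), Finset.card_insert_of_notMem (by simp),
          Nat.odd_iff, Nat.odd_iff]
        omega
      · have hr : ¬ E (c (letR s)) v := fun e => hl (E.trans hc e)
        have : trace c E v = (trace c E v).filter fun p => p ≠ letL s ∧ p ≠ letR s := by
          ext p
          simp only [Finset.mem_filter, mem_trace, iff_self_and]
          intro hp
          exact ⟨fun e => hl (e ▸ hp), fun e => hr (e ▸ hp)⟩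
        rw [NT]
        conv_lhs => rw [this]
    rw [parity bot (h.cap hb), parity top (h.cup hb)]
    have : ((trace bot E v).filter fun p => p ≠ letL s ∧ p ≠ letR s) =
        (trace top E v).filter fun p => p ≠ letL s ∧ p ≠ letR s := by
      ext p
      simp only [Finset.mem_filter, mem_trace]
      refine and_congr_left fun hp => ?_
      have := h.away p hp.1 hp.2
      exact ⟨fun e => E.trans (E.symm this) e, fun e => E.trans this e⟩
    rw [this]

theorem NT_level {w : BraidWord n} {I : Resolution w} (t : Fin (w.length + 1)) (v : Pt w) :
    NT (fun p => ((p, t) : Pt w)) (circles w I) v ↔ NT (clPt w) (circles w I) v := by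
  induction t using Fin.induction with
  | zero => rfl
  | succ j ih => rw [← ih]; exact (NT_slab (circles_slab j) v).symm

theorem vac_adm_level {w : BraidWord n} (I : Resolution w) (t : Fin (w.length + 1)) :
    (khOps w).Adm (fun p => ((p, t) : Pt w)) (circles w I) (vac I) := by
  refine ⟨vac_compat I, fun S hS => ?_⟩
  have := (vac_adm I).mem S hS
  rw [card_oddTraces_congr (fun v => NT_level t v)]
  simpa only [NT_level t] using this

/-! ### Isomorphisms of complexes -/

/-- A filtered chain map from a bijection of crossings and a map of points that induces bijections
of circles. -/
def FMap.ofIso {w w' : BraidWord n} (x0 : Pt w) (σ : Fin w.length ≃ Fin w'.length)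
    (ρ : Pt w → Pt w') (hlet : ∀ j, w'.get (σ j) = w.get j)
    (hrel : ∀ (I : Resolution w) u v, circles w I u v ↔ circles w' (I ∘ σ.symm) (ρ u) (ρ v))
    (t0 : Fin (w'.length + 1)) (hcl : ∀ (I : Resolution w') p, circles w' I (ρ (p, 0)) (p, t0))
    (hth : ∀ (I : Resolution w) j, I j = false →
      (khOps w').theta (circles w' (I ∘ σ.symm)) (ρ (cornerA w j)) (ρ (cornerB w j))
        (vac (Function.update (I ∘ σ.symm) (σ j) true)) =
      (khOps w').theta (circles w' (I ∘ σ.symm)) (cornerA w' (σ j)) (cornerB w' (σ j))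
        (vac (Function.update (I ∘ σ.symm) (σ j) true))) : FMap w w' :=
  -- All points are outer points here, so no circle is missed and `x0` only fills the place of a
  -- middle point.
  let A : Outer w (Pt w) := ⟨id, clPt w, fun _ => x0, fun _ _ => (circles w _).refl _,
    fun _ v => Or.inl ⟨v, (circles w _).refl _⟩⟩
  have h0 : ∀ I : Resolution w, ((khOps w').comap ρ).Adm A.cl (A.rel I) (vac (I ∘ σ.symm)) := by
    intro I
    have : A.rel I = (circles w' (I ∘ σ.symm)).comap ρ := Setoid.ext fun u v => hrel I u v
    rw [this]
    exact (vac_adm_level _ t0).comap ρ fun p => hcl _ p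
  have h1 : ∀ I : Resolution w, ((khOps w').comap ρ).Adm A.cl (A.rel I) (0 : CKh w') :=
    fun _ => Adm.zero
  A.fmap ρ (fun I => vac (I ∘ σ.symm)) (fun _ => 0) h0 h1
    (by
      intro I
      rw [d_vac, d_vac, map_sum, ← Equiv.sum_comp σ]
      refine Finset.sum_congr rfl fun j _ => ?_
      have hs : (I ∘ σ.symm) (σ j) = I j := by simp
      unfold dEdge
      rw [hs]
      by_cases hj : I j = false
      · rw [if_pos hj, if_pos hj]
        have hu : Function.update I j true ∘ σ.symm = Function.update (I ∘ σ.symm) (σ j) true := by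
          funext k
          by_cases hk : k = σ j
          · subst hk; simp
          · rw [Function.update_of_ne hk, Function.comp, Function.update_of_ne]; rfl
            rintro rfl; simp at hk
        have e1 := A.lift_theta (fun I => (h0 I).compat) (fun I => (h1 I).compat) (A.rel I)
          (cornerA w j) (cornerB w j) (vac (Function.update I j true))
        rw [A.lift_vac (fun I => (h0 I).compat), hu] at e1
        refine Eq.trans e1 (Eq.trans ?_ (hth I j hj))
        by_cases e : circles w I (cornerA w j) (cornerB w j)
        · rw [theta_of ((hrel I _ _).1 e), theta_of (show A.rel I _ _ from e)]; rfl
        · rw [theta_of_not fun k => e ((hrel I _ _).2 k),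
            theta_of_not (show ¬ A.rel I _ _ from e)]
      · rw [if_neg hj, if_neg hj, map_zero])
    (fun I hI => absurd ((circles w I).refl _) (hI x0))
    (by
      have hb : braidlike w ∘ σ.symm = braidlike w' := by
        funext k
        obtain ⟨j, rfl⟩ := σ.surjective k
        simp only [Function.comp, Equiv.symm_apply_apply, braidlike, hlet]
      rw [show ∀ S m, ((khOps w').comap ρ).xs S m = (khOps w').xs (S.map ρ) m from
        fun S m => by simp only [xs, List.map_map]; rfl, hb, List.map_map, psi_eq_xs]
      exact fun p => braidlike_circles.1 (hcl _ p))

theorem theta_congr_corners {w : BraidWord n} {I J : Resolution w} {a b a' b' : Pt w}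
    (ha : ∀ K, circles w K a a') (hb : ∀ K, circles w K b b') :
    (khOps w).theta (circles w I) a b (vac J) = (khOps w).theta (circles w I) a' b' (vac J) :=
  (vac_compat J).theta_congr (ha I) (hb I) (ha J) (hb J)

end BraidKh

namespace BraidKh

open FiltOps

variable {n : ℕ}

/-! ### Conjugation and far commutation -/

/-- The circles of two resolutions correspond under maps of points that preserve slabs. -/
theorem circles_iff_of_maps {w w' : BraidWord n} {I : Resolution w} {I' : Resolution w'}
    (ρ : Pt w → Pt w') (ρ' : Pt w' → Pt w)
    (hc : ∀ p, circles w' I' (ρ (p, Fin.last _)) (ρ (p, 0)))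
    (hs : ∀ j, Slab (circles w' I') (fun p => ρ (p, j.castSucc)) (fun p => ρ (p, j.succ))
      (w.get j) (I j))
    (hc' : ∀ p, circles w I (ρ' (p, Fin.last _)) (ρ' (p, 0)))
    (hs' : ∀ j, Slab (circles w I) (fun p => ρ' (p, j.castSucc)) (fun p => ρ' (p, j.succ))
      (w'.get j) (I' j))
    (hρ : ∀ v, circles w I (ρ' (ρ v)) v) (u v : Pt w) :
    circles w I u v ↔ circles w' I' (ρ u) (ρ v) :=
  ⟨circles_map ρ hc hs, fun h => (circles w I).trans ((circles w I).symm (hρ u))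
    ((circles w I).trans (circles_map ρ' hc' hs' h) (hρ v))⟩

theorem circles_slab_nat {w : BraidWord n} {I : Resolution w} (k : ℕ) (hk : k < w.length)
    {bot top : Fin n → Pt w} (hb : ∀ p, bot p = (p, ⟨k, by omega⟩))
    (ht : ∀ p, top p = (p, ⟨k + 1, by omega⟩)) :
    Slab (circles w I) bot top w[k] (I ⟨k, hk⟩) := by
  rw [show bot = fun p => (p, ⟨k, by omega⟩) from funext hb,
    show top = fun p => (p, ⟨k + 1, by omega⟩) from funext ht]
  exact circles_slab (w := w) (I := I) ⟨k, hk⟩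

theorem circles_closing_of_val {w : BraidWord n} {I : Resolution w} {u v : Pt w} (h : u.1 = v.1)
    (hu : u.2.val = w.length) (hv : v.2.val = 0) : circles w I u v := by
  obtain ⟨p, s⟩ := u
  obtain ⟨q, t⟩ := v
  obtain rfl : p = q := h
  obtain rfl : s = Fin.last _ := Fin.ext hu
  obtain rfl : t = 0 := Fin.ext hv
  exact circles_closing p

section Rotate

variable (a : Fin (n - 1) × Bool) (u : BraidWord n)

/-- The permutation of crossings under rotation of a word. -/
def rotCross : Fin (a :: u).length ≃ Fin (u ++ [a]).length where
  toFun j := if h : j.val = 0 then ⟨u.length, by simp⟩ else ⟨j.val - 1, by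
    have := j.isLt; simp only [List.length_cons, List.length_append, List.length_nil] at this ⊢; omega⟩
  invFun j := if h : j.val = u.length then ⟨0, by simp⟩ else ⟨j.val + 1, by
    have := j.isLt; simp only [List.length_cons, List.length_append, List.length_nil] at this ⊢; omega⟩
  left_inv j := by
    have := j.isLt
    simp only [List.length_cons] at this
    ext
    by_cases h : j.val = 0
    · simp [h]
    · have h1 : ¬ j.val - 1 = u.length := by omega
      simp only [h, dite_false, h1]
      omega
  right_inv j := by
    have := j.isLt
    simp only [List.length_append, List.length_cons, List.length_nil] at this
    ext
    by_cases h : j.val = u.length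
    · simp [h]
    · simp [h]

/-- The map of points under rotation of a word. -/
def rotPt (v : Pt (a :: u)) : Pt (u ++ [a]) :=
  -- Level 0 lies just before the letter `a`, which now stands at the end of the word. All other
  -- levels move down by one.
  (v.1, if v.2.val = 0 then ⟨u.length, by simp⟩ else ⟨v.2.val - 1, by
    have := v.2.isLt
    simp only [List.length_cons, List.length_append, List.length_nil] at this ⊢; omega⟩)

/-- The inverse map of points, up to the circles. -/
def rotPtInv (v : Pt (u ++ [a])) : Pt (a :: u) :=
  -- The last level and level 0 of `u ++ [a]` are joined by the closing arcs and both go to the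
  -- level just after `a`.
  (v.1, if h : v.2.val ≤ u.length then ⟨v.2.val + 1, by simp only [List.length_cons]; omega⟩
    else ⟨1, by simp⟩)

theorem rot_slab (I' : Resolution (u ++ [a])) (j : Fin (a :: u).length) :
    Slab (circles _ I') (fun p => rotPt a u (p, j.castSucc)) (fun p => rotPt a u (p, j.succ))
      ((a :: u).get j) (I' (rotCross a u j)) := by
  obtain ⟨j, hj⟩ := j
  rcases j with _ | k
  · have hl : u.length < (u ++ [a]).length := by simp
    have := circles_slab_nat (w := u ++ [a]) (I := I') u.length hl (fun _ => rfl) (fun _ => rfl)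
    simp only [List.getElem_concat_length] at this
    refine this.congr (fun p => (circles _ I').refl _) fun p => ?_
    exact circles_closing_of_val rfl (by simp) (by simp [rotPt])
  · have hk : k < u.length := by simpa using hj
    have hl : k < (u ++ [a]).length := by simp; omega
    have := circles_slab_nat (w := u ++ [a]) (I := I') k hl (fun _ => rfl) (fun _ => rfl)
    rw [List.getElem_append_left hk] at this
    exact this

theorem rot_slab' (I : Resolution (a :: u)) (j : Fin (u ++ [a]).length) :
    Slab (circles _ I) (fun p => rotPtInv a u (p, j.castSucc))
      (fun p => rotPtInv a u (p, j.succ)) ((u ++ [a]).get j) (I ((rotCross a u).symm j)) := by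
  obtain ⟨j, hj⟩ := j
  have hj' : j < u.length + 1 := by simpa using hj
  by_cases hk : j = u.length
  · subst hk
    have := circles_slab_nat (w := a :: u) (I := I) 0 (by simp) (fun _ => rfl) (fun _ => rfl)
    simp only [List.get_eq_getElem, List.getElem_concat_length]
    have e : (rotCross a u).symm ⟨u.length, hj⟩ = ⟨0, by simp⟩ := by
      simp [rotCross]
    rw [e]
    refine this.congr (fun p => ?_) fun p => ?_
    · exact (circles _ I).symm (circles_closing_of_val rfl (by simp [rotPtInv]) rfl)
    · have : rotPtInv a u (p, (⟨u.length, hj⟩ : Fin (u ++ [a]).length).succ) = (p, ⟨1, by simp⟩) := by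
        simp [rotPtInv]
      rw [this]
  · have hlt : j < u.length := by omega
    have := circles_slab_nat (w := a :: u) (I := I) (j + 1) (by simpa using hlt)
      (fun _ => rfl) (fun _ => rfl)
    have e : (rotCross a u).symm ⟨j, hj⟩ = ⟨j + 1, by simpa using hlt⟩ := by
      simp [rotCross, hk]
    rw [e]
    simp only [List.get_eq_getElem, List.getElem_append_left hlt]
    refine this.congr (fun p => ?_) fun p => ?_
    · have : rotPtInv a u (p, (⟨j, hj⟩ : Fin (u ++ [a]).length).castSucc) =
          (p, ⟨j + 1, by simp; omega⟩) := by simp [rotPtInv, hlt.le]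
      rw [this]
    · have : rotPtInv a u (p, (⟨j, hj⟩ : Fin (u ++ [a]).length).succ) =
          (p, ⟨j + 1 + 1, by simp; omega⟩) := by simp [rotPtInv, Nat.succ_le_of_lt hlt]
      rw [this]

theorem rot_rel (I : Resolution (a :: u)) (v v' : Pt (a :: u)) :
    circles _ I v v' ↔
      circles _ (I ∘ (rotCross a u).symm) (rotPt a u v) (rotPt a u v') := by
  refine circles_iff_of_maps (rotPt a u) (rotPtInv a u) (fun p => ?_) (fun j => ?_) (fun p => ?_)
    (fun j => rot_slab' a u I j) (fun v => ?_) v v'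
  · have : rotPt a u (p, Fin.last _) = rotPt a u (p, 0) := by simp [rotPt]
    rw [this]
  · have := rot_slab a u (I ∘ (rotCross a u).symm) j
    rwa [Function.comp_apply, Equiv.symm_apply_apply] at this
  · have : rotPtInv a u (p, Fin.last _) = rotPtInv a u (p, 0) := by simp [rotPtInv]
    rw [this]
  · obtain ⟨p, t⟩ := v
    by_cases h : t = 0
    · subst h
      exact circles_closing_of_val rfl (by simp [rotPt, rotPtInv]) rfl
    · have hlt := t.isLt
      simp only [List.length_cons] at hlt
      have h0 : t.val ≠ 0 := fun e => h (Fin.ext e)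
      have h1 : t.val - 1 ≤ u.length := by omega
      have : rotPtInv a u (rotPt a u (p, t)) = (p, t) := by
        simp only [rotPt, rotPtInv, h0, if_false, h1, dite_true, Prod.mk.injEq, true_and]
        ext; simp; omega
      rw [this]

/-- Rotation of a word. -/
def FMap.rotate : FMap (a :: u) (u ++ [a]) :=
  FMap.ofIso (letL a, 0) (rotCross a u) (rotPt a u)
    (fun j => by
      obtain ⟨j, hj⟩ := j
      rcases j with _ | k
      · simp [rotCross]
      · have hk : k < u.length := by simpa using hj
        simp [rotCross, List.getElem_append_left hk])
    (rot_rel a u) ⟨u.length, by simp⟩ (fun I p => (circles _ I).refl _) fun I j _ => by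
      refine theta_congr_corners (fun K => ?_) fun K => ?_
      · obtain ⟨j, hj⟩ := j
        rcases j with _ | k
        · have : rotPt a u (cornerA (a :: u) ⟨0, hj⟩) =
              cornerA (u ++ [a]) (rotCross a u ⟨0, hj⟩) := by
            simp [rotPt, cornerA, rotCross, lft]
          rw [this]
        · have hk : k < u.length := by simpa using hj
          have : rotPt a u (cornerA (a :: u) ⟨k + 1, hj⟩) =
              cornerA (u ++ [a]) (rotCross a u ⟨k + 1, hj⟩) := by
            simp [rotPt, cornerA, rotCross, lft, List.getElem_append_left hk]
          rw [this]
      · obtain ⟨j, hj⟩ := j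
        rcases j with _ | k
        · refine (circles _ K).symm (circles_closing_of_val ?_ ?_ ?_)
          · simp [rotPt, rotCross, rgt]
          · simp [rotCross]
          · simp [rotPt]
        · have hk : k < u.length := by simpa using hj
          have : rotPt a u (cornerB (a :: u) ⟨k + 1, hj⟩) =
              cornerB (u ++ [a]) (rotCross a u ⟨k + 1, hj⟩) := by
            simp [rotPt, cornerB, rotCross, rgt, List.getElem_append_left hk]
          rw [this]

end Rotate

theorem nonempty_FMap_append_comm (u v : BraidWord n) : Nonempty (FMap (u ++ v) (v ++ u)) := by
  induction u generalizing v with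
  | nil => rw [List.append_nil]; exact ⟨FMap.refl v⟩
  | cons a u ih =>
    obtain ⟨f⟩ := ih (v ++ [a])
    have g : FMap (a :: u ++ v) (u ++ (v ++ [a])) := by
      rw [← List.append_assoc]; exact FMap.rotate a (u ++ v)
    have h := g.trans f
    rw [List.append_assoc, List.singleton_append] at h
    exact ⟨h⟩

theorem KEquiv.append_comm (u v : BraidWord n) : KEquiv (u ++ v) (v ++ u) :=
  ⟨nonempty_FMap_append_comm u v, nonempty_FMap_append_comm v u⟩

/-- The strands of two letters are disjoint. -/
def FarApart (a b : Fin (n - 1) × Bool) : Prop :=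
  a.1.val + 2 ≤ b.1.val ∨ b.1.val + 2 ≤ a.1.val

/-- The strands of a letter. -/
def OnLetter (a : Fin (n - 1) × Bool) (p : Fin n) : Prop := p = letL a ∨ p = letR a

theorem FarApart.not_onLetter {a b : Fin (n - 1) × Bool} (h : FarApart a b) {p : Fin n}
    (hp : OnLetter a p) : ¬ OnLetter b p := by
  rintro (e | e) <;> rcases hp with rfl | rfl <;>
    · have := congrArg Fin.val e
      simp only [letL, letR] at this
      rcases h with h | h <;> omega

theorem Slab.off {V : Type*} {E : Setoid V} {bot top : Fin n → V} {s : Fin (n - 1) × Bool}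
    {b : Bool} (h : Slab E bot top s b) {p : Fin n} (hp : ¬ OnLetter s p) : E (bot p) (top p) :=
  h.away p (fun e => hp (Or.inl e)) fun e => hp (Or.inr e)

/-- The level between two crossings after exchanging them. -/
def exchange {V : Type*} (a b : Fin (n - 1) × Bool) (c0 c1 c2 : Fin n → V) (p : Fin n) : V :=
  -- Between `a` and `b` the strands of `a` have passed `a`, which in the exchanged order happens at
  -- the level after both. Those of `b` have not reached `b`, as at the level before both.
  if OnLetter a p then c2 p else if OnLetter b p then c0 p else c1 p

theorem Slab.exchange_bot {V : Type*} {E : Setoid V} {a b : Fin (n - 1) × Bool} {x y : Bool}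
    {c0 c1 c2 : Fin n → V} (hab : FarApart a b) (h0 : Slab E c0 c1 b y) (h1 : Slab E c1 c2 a x) :
    Slab E c0 (exchange a b c0 c1 c2) a x := by
  have h0' : ∀ p, OnLetter a p → E (c0 p) (c1 p) := fun p hp => h0.off (hab.not_onLetter hp)
  have hL : OnLetter a (letL a) := Or.inl rfl
  have hR : OnLetter a (letR a) := Or.inr rfl
  have eL : exchange a b c0 c1 c2 (letL a) = c2 (letL a) := if_pos hL
  have eR : exchange a b c0 c1 c2 (letR a) = c2 (letR a) := if_pos hR
  refine ⟨fun p hl hr => ?_, fun k => ?_, fun k => ?_, fun k => ?_, fun k => ?_⟩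
  · have ha : ¬ OnLetter a p := by rintro (e | e); exacts [hl e, hr e]
    unfold exchange
    rw [if_neg ha]
    split_ifs with hb
    · exact E.refl _
    · exact h0.off hb
  · rw [eL]; exact E.trans (h0' _ hL) (h1.left k)
  · rw [eR]; exact E.trans (h0' _ hR) (h1.right k)
  · exact E.trans (h0' _ hL) (E.trans (h1.cap k) (E.symm (h0' _ hR)))
  · rw [eL, eR]; exact h1.cup k

theorem Slab.exchange_top {V : Type*} {E : Setoid V} {a b : Fin (n - 1) × Bool} {x y : Bool}
    {c0 c1 c2 : Fin n → V} (hab : FarApart a b) (h0 : Slab E c0 c1 b y) (h1 : Slab E c1 c2 a x) :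
    Slab E (exchange a b c0 c1 c2) c2 b y := by
  have hba : FarApart b a := Or.symm hab
  have e : exchange a b c0 c1 c2 = exchange b a c2 c1 c0 := by
    funext p
    unfold exchange
    by_cases ha : OnLetter a p
    · rw [if_pos ha, if_neg (hab.not_onLetter ha), if_pos ha]
    · rw [if_neg ha, if_neg ha]
  rw [e]
  exact (Slab.exchange_bot hba h1.symm h0.symm).symm

section Far

variable {a b : Fin (n - 1) × Bool} (u : BraidWord n)

/-- The exchange of the first two crossings. -/
def farCross (a b : Fin (n - 1) × Bool) (u : BraidWord n) :
    Fin (a :: b :: u).length ≃ Fin (b :: a :: u).length :=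
  Equiv.swap (⟨0, Nat.succ_pos _⟩ : Fin (u.length + 2)) ⟨1, Nat.succ_lt_succ (Nat.succ_pos _)⟩

/-- The map of points under the exchange of the first two crossings. -/
def farPt (a b : Fin (n - 1) × Bool) (u : BraidWord n) (v : Pt (a :: b :: u)) :
    Pt (b :: a :: u) :=
  if v.2.val = 1 then exchange a b (fun p => (p, ⟨0, Nat.succ_pos _⟩))
    (fun p => (p, ⟨1, Nat.succ_lt_succ (Nat.succ_pos _)⟩))
    (fun p => (p, ⟨2, Nat.succ_lt_succ (Nat.succ_lt_succ (Nat.succ_pos _))⟩)) v.1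
  else v

theorem farPt_of_ne {v : Pt (a :: b :: u)} (h : v.2.val ≠ 1) : farPt a b u v = v := if_neg h

theorem farPt_one {v : Pt (a :: b :: u)} (h : v.2.val = 1) :
    farPt a b u v = exchange a b (fun p => (p, ⟨0, Nat.succ_pos _⟩))
      (fun p => (p, ⟨1, Nat.succ_lt_succ (Nat.succ_pos _)⟩))
      (fun p => (p, ⟨2, Nat.succ_lt_succ (Nat.succ_lt_succ (Nat.succ_pos _))⟩)) v.1 := if_pos h

theorem farCross_zero (h : 0 < (a :: b :: u).length) :
    farCross a b u ⟨0, h⟩ = ⟨1, by simp⟩ := Equiv.swap_apply_left _ _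

theorem farCross_one (h : 1 < (a :: b :: u).length) :
    farCross a b u ⟨1, h⟩ = ⟨0, by simp⟩ := Equiv.swap_apply_right _ _

theorem farCross_add_two (k : ℕ) (h : k + 2 < (a :: b :: u).length) :
    farCross a b u ⟨k + 2, h⟩ = ⟨k + 2, h⟩ :=
  Equiv.swap_apply_of_ne_of_ne (by simp) (by simp)

theorem far_slab (hab : FarApart a b) (I' : Resolution (b :: a :: u)) (j : Fin (a :: b :: u).length) :
    Slab (circles _ I') (fun p => farPt a b u (p, j.castSucc)) (fun p => farPt a b u (p, j.succ))
      ((a :: b :: u).get j) (I' (farCross a b u j)) := by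
  have h0 := circles_slab_nat (w := b :: a :: u) (I := I') 0 (by simp) (fun _ => rfl) (fun _ => rfl)
  have h1 := circles_slab_nat (w := b :: a :: u) (I := I') 1 (by simp) (fun _ => rfl) (fun _ => rfl)
  obtain ⟨j, hj⟩ := j
  rcases j with _ | _ | k
  · rw [farCross_zero]
    exact Slab.exchange_bot hab h0 h1
  · rw [farCross_one]
    exact Slab.exchange_top hab h0 h1
  · rw [farCross_add_two]
    exact circles_slab_nat (w := b :: a :: u) (I := I') (k + 2) hj
      (fun p => farPt_of_ne u (by simp)) (fun p => farPt_of_ne u (by simp))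

theorem far_rel (hab : FarApart a b) (I : Resolution (a :: b :: u)) (v v' : Pt (a :: b :: u)) :
    circles _ I v v' ↔
      circles _ (I ∘ (farCross a b u).symm) (farPt a b u v) (farPt a b u v') := by
  have hba : FarApart b a := Or.symm hab
  refine circles_iff_of_maps (farPt a b u) (farPt b a u) (fun p => ?_) (fun j => ?_) (fun p => ?_)
    (fun j => ?_) (fun v => ?_) v v'
  · exact circles_closing p
  · have := far_slab u hab (I ∘ (farCross a b u).symm) j
    rwa [Function.comp_apply, Equiv.symm_apply_apply] at this
  · exact circles_closing p
  · exact far_slab u hba I j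
  · by_cases h : v.2.val = 1
    · obtain ⟨p, t⟩ := v
      obtain rfl : t = ⟨1, by simp⟩ := Fin.ext h
      have h0 := circles_slab_nat (w := a :: b :: u) (I := I) 0 (by simp) (fun _ => rfl)
        (fun _ => rfl)
      have h1 := circles_slab_nat (w := a :: b :: u) (I := I) 1 (by simp) (fun _ => rfl)
        (fun _ => rfl)
      rw [farPt_one u h, exchange]
      split_ifs with ha hb
      · rw [farPt_of_ne _ (by simp)]
        exact (circles _ I).symm (h1.off (hab.not_onLetter ha))
      · rw [farPt_of_ne _ (by simp)]
        exact h0.off ha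
      · rw [farPt_one _ rfl, exchange, if_neg hb, if_neg ha]

    · rw [farPt_of_ne u h, farPt_of_ne (a := b) (b := a) u h]


theorem far_corner (hab : FarApart a b) (K : Resolution (b :: a :: u)) (j : Fin (a :: b :: u).length) :
    circles _ K (farPt a b u (cornerA _ j)) (cornerA _ (farCross a b u j)) ∧
    circles _ K (farPt a b u (cornerB _ j)) (cornerB _ (farCross a b u j)) := by
  have h0 := circles_slab_nat (w := b :: a :: u) (I := K) 0 (by simp) (fun _ => rfl) (fun _ => rfl)
  have h1 := circles_slab_nat (w := b :: a :: u) (I := K) 1 (by simp) (fun _ => rfl) (fun _ => rfl)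
  have hba : FarApart b a := Or.symm hab
  obtain ⟨j, hj⟩ := j
  rcases j with _ | _ | k
  · rw [farCross_zero]
    constructor
    · exact h0.off (hab.not_onLetter (Or.inl rfl))
    · have : farPt a b u (cornerB (a :: b :: u) ⟨0, hj⟩) = (letR a, ⟨2, by simp⟩) := by
        rw [farPt_one _ (by simp)]; exact if_pos (Or.inr rfl)
      rw [this]
      exact (circles _ K).refl _
  · rw [farCross_one]
    constructor
    · have : farPt a b u (cornerA (a :: b :: u) ⟨1, hj⟩) = (letL b, ⟨0, by simp⟩) := by
        rw [farPt_one _ (by simp), exchange]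
        exact (if_neg (hba.not_onLetter (Or.inl rfl))).trans (if_pos (Or.inl rfl))
      rw [this]
      exact (circles _ K).refl _
    · rw [farPt_of_ne _ (show (2 : ℕ) ≠ 1 by decide)]
      exact (circles _ K).symm (h1.off (hba.not_onLetter (Or.inr rfl)))
  · rw [farCross_add_two, farPt_of_ne _ (by simp), farPt_of_ne _ (by simp)]
    exact ⟨(circles _ K).refl _, (circles _ K).refl _⟩

/-- Far commutation. -/
def FMap.far (hab : FarApart a b) : FMap (a :: b :: u) (b :: a :: u) :=
  FMap.ofIso (letL a, 0) (farCross a b u) (farPt a b u)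
    (fun j => by
      obtain ⟨j, hj⟩ := j
      rcases j with _ | _ | k
      · rw [farCross_zero]; rfl
      · rw [farCross_one]; rfl
      · rw [farCross_add_two]; rfl)
    (far_rel u hab) 0 (fun I p => (circles _ I).refl _) fun I j _ =>
      theta_congr_corners (fun K => (far_corner u hab K j).1) fun K => (far_corner u hab K j).2

theorem KEquiv.far (hab : FarApart a b) : KEquiv (a :: b :: u) (b :: a :: u) :=
  ⟨⟨FMap.far u hab⟩, ⟨FMap.far u (Or.symm hab)⟩⟩

end Far

end BraidKh

namespace BraidKh

open FiltOps

variable {n : ℕ}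

/-! ### Saddles at pairs of points -/

section Saddles

variable {V : Type*} {E E' : Setoid V} {a b a' b' : V}

theorem Fuse.congr (h : Fuse E E' a b) (ha : E a a') (hb : E b b') : Fuse E E' a' b' := by
  have e1 : ∀ u, E u a ↔ E u a' := fun u =>
    ⟨fun k => E.trans k ha, fun k => E.trans k (E.symm ha)⟩
  have e2 : ∀ u, E u b ↔ E u b' := fun u =>
    ⟨fun k => E.trans k hb, fun k => E.trans k (E.symm hb)⟩
  refine ⟨fun k => h.ne (E.trans ha (E.trans k (E.symm hb))), fun u v => ?_⟩
  rw [h.iff, e1, e1, e2, e2]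

theorem Fuse.swap (h : Fuse E E' a b) : Fuse E E' b a :=
  ⟨fun k => h.ne (E.symm k), fun u v => by rw [h.iff, or_comm (a := E u a), or_comm (a := E v a)]⟩

theorem Saddle.swap (h : Saddle E E' a b) : Saddle E E' b a := h.imp Fuse.swap Fuse.swap

/-- The saddle at the other pair of opposite corners. -/
theorem Saddle.flip (h : Saddle E E' a b) (h1 : E a b') (h2 : E b a') (h3 : E' a a')
    (h4 : E' b b') : Saddle E E' a' b' :=
  h.imp (fun k => (k.congr h1 h2).swap) fun k => k.congr h3 h4

/-- The saddle map depends only on the equivalence relations. -/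
theorem theta_unique {N : Type*} [AddCommGroup N] [Module (ZMod 2) N] {O : FiltOps V N} {m : N}
    (h : Saddle E E' a b) (h' : Saddle E E' a' b') (hm : O.Compat E' m) :
    O.theta E a b m = O.theta E a' b' m := by
  by_cases e : E a b
  · have f := h.fuse' e
    have e' : E a' b' := by
      by_contra k
      exact f.ne ((h'.fuse k).le e)
    rw [theta_of e, theta_of e']
    -- Both pairs mark the two halves of the same split, possibly in the other order.
    have hne := (h'.fuse' e').ne
    rcases (f.iff a' b').1 e' with k | ⟨k1 | k1, k2 | k2⟩
    · exact absurd k hne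
    · exact absurd (E'.trans k1 (E'.symm k2)) hne
    · rw [hm _ _ k1, hm _ _ k2]
    · rw [hm _ _ k1, hm _ _ k2, add_comm]
    · exact absurd (E'.trans k1 (E'.symm k2)) hne
  · have f := h.fuse e
    have e' : ¬ E a' b' := by
      intro k
      exact (h'.fuse' k).ne (f.le k)
    rw [theta_of_not e, theta_of_not e']

end Saddles

/-! ### Slabs in terms of unordered pairs of strands -/

/-- The two strands of a letter, in some order. -/
def Strands (s : Fin (n - 1) × Bool) (p q : Fin n) : Prop :=
  (p = letL s ∧ q = letR s) ∨ (p = letR s ∧ q = letL s)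

theorem Strands.symm {s : Fin (n - 1) × Bool} {p q : Fin n} (h : Strands s p q) :
    Strands s q p := by
  rcases h with h | h
  · exact Or.inr ⟨h.2, h.1⟩
  · exact Or.inl ⟨h.2, h.1⟩

theorem Strands.ne {s : Fin (n - 1) × Bool} {p q : Fin n} (h : Strands s p q) : p ≠ q := by
  rintro rfl
  rcases h with ⟨h1, h2⟩ | ⟨h1, h2⟩ <;>
  · have := congrArg Fin.val (h1.symm.trans h2)
    simp [letL, letR] at this

section SlabPairs

variable {V : Type*} {E : Setoid V} {bot top : Fin n → V} {s : Fin (n - 1) × Bool} {b : Bool}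
  {p q : Fin n}

theorem Slab.of_straight (hb : b = !s.2) (h : ∀ r, E (bot r) (top r)) : Slab E bot top s b :=
  ⟨fun r _ _ => h r, fun _ => h _, fun _ => h _, fun k => absurd hb k, fun k => absurd hb k⟩

theorem Slab.of_bent (hs : Strands s p q) (hb : b ≠ !s.2) (h1 : E (bot p) (bot q))
    (h2 : E (top p) (top q)) (h3 : ∀ r, r ≠ p → r ≠ q → E (bot r) (top r)) :
    Slab E bot top s b := by
  rcases hs with ⟨rfl, rfl⟩ | ⟨rfl, rfl⟩
  · exact ⟨h3, fun k => absurd k hb, fun k => absurd k hb, fun _ => h1, fun _ => h2⟩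
  · exact ⟨fun r hl hr => h3 r hr hl, fun k => absurd k hb, fun k => absurd k hb,
      fun _ => E.symm h1, fun _ => E.symm h2⟩

theorem Slab.bent_bot (h : Slab E bot top s b) (hs : Strands s p q) (hb : b ≠ !s.2) :
    E (bot p) (bot q) := by
  rcases hs with ⟨rfl, rfl⟩ | ⟨rfl, rfl⟩
  · exact h.cap hb
  · exact E.symm (h.cap hb)

theorem Slab.bent_top (h : Slab E bot top s b) (hs : Strands s p q) (hb : b ≠ !s.2) :
    E (top p) (top q) := by
  rcases hs with ⟨rfl, rfl⟩ | ⟨rfl, rfl⟩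
  · exact h.cup hb
  · exact E.symm (h.cup hb)

theorem Slab.side (h : Slab E bot top s b) (hs : Strands s p q) {r : Fin n} (h1 : r ≠ p)
    (h2 : r ≠ q) : E (bot r) (top r) := by
  rcases hs with ⟨rfl, rfl⟩ | ⟨rfl, rfl⟩
  · exact h.away r h1 h2
  · exact h.away r h2 h1

end SlabPairs

/-- The edge maps use the lower left and the upper right corner. The other pair of opposite corners
gives the same saddle, since in each resolution every corner is joined to one of the first two. -/
theorem saddle_strands {w : BraidWord n} {I : Resolution w} {j : Fin w.length} {p q : Fin n}
    (hs : Strands (w.get j) p q) (hj : I j = false) :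
    Saddle (circles w I) (circles w (Function.update I j true)) (p, j.castSucc) (q, j.succ) := by
  have h := saddle_update hj
  rcases hs with ⟨rfl, rfl⟩ | ⟨rfl, rfl⟩
  · exact h
  · have s1 := circles_slab (I := I) j
    have s2 := circles_slab (I := Function.update I j true) j
    rw [Function.update_self] at s2
    rw [hj] at s1
    by_cases hb : false = !(w.get j).2
    · have hb' : true ≠ !(w.get j).2 := by rw [← hb]; simp
      exact h.flip (s1.left hb) ((circles w I).symm (s1.right hb)) (s2.cap hb')
        ((circles w _).symm (s2.cup hb'))
    · have hb' : true = !(w.get j).2 := by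
        revert hb; cases (w.get j).2 <;> simp
      exact (h.symm.flip (s2.left hb') ((circles w _).symm (s2.right hb')) (s1.cap hb)
        ((circles w _).symm (s1.cup hb))).symm

/-! ### Diagrams with a part replaced -/

section Open

variable (u : BraidWord n)

/-- The equivalence relation on the points of `u` that is generated by the resolution `J` and by the
condition `P` in place of the closing arcs. -/
def openRel (P : Setoid (Pt u) → Prop) (J : Resolution u) : Setoid (Pt u) :=
  sInf {E | P E ∧ ∀ j, Slab E (fun p => (p, j.castSucc)) (fun p => (p, j.succ)) (u.get j) (J j)}

variable {u} {P : Setoid (Pt u) → Prop} {J : Resolution u}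

theorem openRel_slab (j : Fin u.length) :
    Slab (openRel u P J) (fun p => (p, j.castSucc)) (fun p => (p, j.succ)) (u.get j) (J j) :=
  ⟨fun p h1 h2 _ hE => (hE.2 j).away p h1 h2, fun h _ hE => (hE.2 j).left h,
    fun h _ hE => (hE.2 j).right h, fun h _ hE => (hE.2 j).cap h, fun h _ hE => (hE.2 j).cup h⟩

theorem openRel_le {V : Type*} {E : Setoid V} (ι : Pt u → V) (hP : P (E.comap ι))
    (hs : ∀ j, Slab E (fun p => ι (p, j.castSucc)) (fun p => ι (p, j.succ)) (u.get j) (J j))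
    {v v' : Pt u} (h : openRel u P J v v') : E (ι v) (ι v') :=
  h (E.comap ι) ⟨hP, fun j => ⟨(hs j).away, (hs j).left, (hs j).right, (hs j).cap, (hs j).cup⟩⟩

/-- The terms of the differential at the crossings of `u`. -/
def outD {N : Type*} [AddCommGroup N] [Module (ZMod 2) N] (O : FiltOps (Pt u) N)
    (R : Resolution u → Setoid (Pt u)) (m : Resolution u → N) (J : Resolution u) : N :=
  ∑ j, if J j = false then
    O.theta (R J) (cornerA u j) (cornerB u j) (m (Function.update J j true)) else 0

/-- The relations for the resolutions of `u` differ by saddles. -/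
def OutSaddle (R : Resolution u → Setoid (Pt u)) : Prop :=
  ∀ J j, J j = false → Saddle (R J) (R (Function.update J j true)) (cornerA u j) (cornerB u j)

section OutD

variable {N : Type*} [AddCommGroup N] [Module (ZMod 2) N] {O : FiltOps (Pt u) N}
  {R R' : Resolution u → Setoid (Pt u)} {m m' : Resolution u → N}

theorem outD_zero : outD O R (fun _ => 0) J = 0 := by simp [outD]

theorem outD_add : outD O R (fun J => m J + m' J) J = outD O R m J + outD O R m' J := by
  rw [outD, outD, outD, ← Finset.sum_add_distrib]
  refine Finset.sum_congr rfl fun j _ => ?_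
  split_ifs
  · rw [map_add]
  · rw [add_zero]

/-- A crossing of `u` and a saddle in the replaced part form a square of saddles, which commutes by
`Compat.face`. -/
theorem outD_theta {p q : Pt u} (hR : OutSaddle R) (hR' : OutSaddle R')
    (h : ∀ J, Saddle (R J) (R' J) p q) (hm : ∀ J, O.Compat (R' J) (m J)) :
    outD O R (fun J => O.theta (R J) p q (m J)) J = O.theta (R J) p q (outD O R' m J) := by
  rw [outD, outD, map_sum]
  refine Finset.sum_congr rfl fun j _ => ?_
  split_ifs with hj
  · exact (hm _).face (hR J j hj) (h _) (h _) (hR' J j hj)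
  · rw [map_zero]

theorem outD_map {N' : Type*} [AddCommGroup N'] [Module (ZMod 2) N'] {O' : FiltOps (Pt u) N'}
    (f : N →ₗ[ZMod 2] N') (hf : ∀ v x, f (O.X v x) = O'.X v (f x)) :
    f (outD O R m J) = outD O' R (fun J => f (m J)) J := by
  rw [outD, outD, map_sum]
  refine Finset.sum_congr rfl fun j _ => ?_
  split_ifs
  · by_cases e : R J (cornerA u j) (cornerB u j)
    · rw [theta_of e, theta_of e, map_add, hf, hf]
    · rw [theta_of_not e, theta_of_not e]
  · rw [map_zero]

theorem outD_congr (h : ∀ J, m J = m' J) : outD O R m J = outD O R m' J := by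
  rw [show m = m' from funext h]

end OutD

/-- The strands go straight from the end of `u` to its beginning. -/
def TanId (E : Setoid (Pt u)) : Prop := ∀ p, E (p, Fin.last _) (p, 0)

/-- The strands `p` and `q` turn back, the others go straight from the end of `u` to its
beginning. -/
def TanBent (p q : Fin n) (E : Setoid (Pt u)) : Prop :=
  E (p, Fin.last _) (q, Fin.last _) ∧ E (p, 0) (q, 0) ∧
    ∀ r, r ≠ p → r ≠ q → E (r, Fin.last _) (r, 0)

/-- The diagram with the strands `p`, `q` bent, followed by the strands `p`, `r` bent. -/
def TanBent₂ (p q r : Fin n) (E : Setoid (Pt u)) : Prop :=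
  E (p, Fin.last _) (q, Fin.last _) ∧ E (p, 0) (r, 0) ∧ E (r, Fin.last _) (q, 0) ∧
    ∀ s, s ≠ p → s ≠ q → s ≠ r → E (s, Fin.last _) (s, 0)

/-- The condition only asks certain pairs to be related. Hence it passes to intersections and holds
for the relation that is generated; the same goes for the other two conditions. -/
theorem openRel_tanId : TanId (openRel u TanId J) := fun p _ hE => hE.1 p

theorem openRel_tanBent {p q : Fin n} : TanBent p q (openRel u (TanBent p q) J) :=
  ⟨fun _ hE => hE.1.1, fun _ hE => hE.1.2.1, fun r h1 h2 _ hE => hE.1.2.2 r h1 h2⟩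

theorem openRel_tanBent₂ {p q r : Fin n} : TanBent₂ p q r (openRel u (TanBent₂ p q r) J) :=
  ⟨fun _ hE => hE.1.1, fun _ hE => hE.1.2.1, fun _ hE => hE.1.2.2.1,
    fun s h1 h2 h3 _ hE => hE.1.2.2.2 s h1 h2 h3⟩

theorem openRel_id_eq : openRel u TanId J = circles u J := by
  ext v v'
  exact ⟨openRel_le id (fun p => circles_closing p) fun j => circles_slab j,
    circles_map id openRel_tanId fun j => openRel_slab j⟩

end Open

end BraidKh

namespace BraidKh

open FiltOps

variable {n : ℕ}

theorem dEdge_eq {w : BraidWord n} {I : Resolution w} {j : Fin w.length} (hj : I j = false)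
    {c c' : Pt w}
    (h : Saddle (circles w I) (circles w (Function.update I j true)) c c') :
    dEdge I j = (khOps w).theta (circles w I) c c' (vac (Function.update I j true)) := by
  rw [dEdge, if_pos hj]
  exact theta_unique (saddle_update hj) h (vac_compat _)

theorem dEdge_of_true {w : BraidWord n} {I : Resolution w} {j : Fin w.length} (hj : I j = true) :
    dEdge I j = 0 := by
  rw [dEdge, if_neg (by simp [hj])]

theorem d_theta_comap {w : BraidWord n} {V : Type*} (ι : V → Pt w) (E : Setoid V) (p q : V)
    (m : CKh w) : d w (((khOps w).comap ι).theta E p q m) =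
      ((khOps w).comap ι).theta E p q (d w m) := by
  by_cases e : E p q
  · rw [theta_of e, theta_of e, map_add]
    exact congrArg₂ _ (d_X _ _) (d_X _ _)
  · rw [theta_of_not e, theta_of_not e]

theorem theta_comap {V W N : Type*} [AddCommGroup N] [Module (ZMod 2) N] {O : FiltOps V N}
    (ι : W → V) (E : Setoid V) (p q : W) (m : N) :
    (O.comap ι).theta (E.comap ι) p q m = O.theta E (ι p) (ι q) m := by
  by_cases e : E (ι p) (ι q)
  · rw [theta_of e, theta_of (show E.comap ι p q from e)]; rfl
  · rw [theta_of_not e, theta_of_not (show ¬ E.comap ι p q from e)]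

/-! ### Two letters in front of a word -/

section Two

variable {s0 s1 : Fin (n - 1) × Bool} {u : BraidWord n}

/-- A resolution of a word with two letters in front. -/
def res2 (x y : Bool) (J : Resolution u) : Resolution (s0 :: s1 :: u) :=
  Fin.cons (α := fun _ : Fin (u.length + 2) => Bool) x (Fin.cons (α := fun _ => Bool) y J)

/-- The points after two letters. -/
def shift2 (v : Pt u) : Pt (s0 :: s1 :: u) := (v.1, v.2.succ.succ)

theorem eq_res2 (I : Resolution (s0 :: s1 :: u)) : ∃ x y J, I = res2 x y J := by
  refine ⟨I ⟨0, by simp⟩, I ⟨1, by simp⟩, fun j => I j.succ.succ, ?_⟩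
  funext j
  obtain ⟨j, hj⟩ := j
  rcases j with _ | _ | j <;> rfl

variable {x y : Bool} {J : Resolution u}

theorem update_res2_zero (h : 0 < (s0 :: s1 :: u).length) :
    Function.update (res2 x y J : Resolution (s0 :: s1 :: u)) ⟨0, h⟩ true = res2 true y J := by
  funext j
  obtain ⟨j, hj⟩ := j
  rcases j with _ | _ | j
  · rw [Function.update_self]; rfl
  · rw [Function.update_of_ne (by simp)]; rfl
  · rw [Function.update_of_ne (by simp)]; rfl

theorem update_res2_one (h : 1 < (s0 :: s1 :: u).length) :
    Function.update (res2 x y J : Resolution (s0 :: s1 :: u)) ⟨1, h⟩ true = res2 x true J := by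
  funext j
  obtain ⟨j, hj⟩ := j
  rcases j with _ | _ | j
  · rw [Function.update_of_ne (by simp)]; rfl
  · rw [Function.update_self]; rfl
  · rw [Function.update_of_ne (by simp)]; rfl

theorem update_res2_add (j : Fin u.length) :
    Function.update (res2 x y J : Resolution (s0 :: s1 :: u)) j.succ.succ true =
      res2 x y (Function.update J j true) := by
  unfold res2
  rw [Fin.cons_update, Fin.cons_update]

theorem two_slab0 : Slab (circles (s0 :: s1 :: u) (res2 x y J)) (fun p => (p, ⟨0, by simp⟩))
    (fun p => (p, ⟨1, by simp⟩)) s0 x :=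
  circles_slab_nat (w := s0 :: s1 :: u) 0 (by simp) (fun _ => rfl) (fun _ => rfl)

theorem two_slab1 : Slab (circles (s0 :: s1 :: u) (res2 x y J)) (fun p => (p, ⟨1, by simp⟩))
    (fun p => shift2 (p, 0)) s1 y :=
  circles_slab_nat (w := s0 :: s1 :: u) 1 (by simp) (fun _ => rfl) (fun _ => rfl)

theorem two_outer (j : Fin u.length) : Slab (circles (s0 :: s1 :: u) (res2 x y J))
    (fun p => shift2 (p, j.castSucc)) (fun p => shift2 (p, j.succ)) (u.get j) (J j) :=
  circles_slab_nat (w := s0 :: s1 :: u) (j.val + 2) (by simp) (fun _ => rfl) (fun _ => rfl)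

theorem two_closing (p : Fin n) : circles (s0 :: s1 :: u) (res2 x y J) (shift2 (p, Fin.last _))
    (p, ⟨0, by simp⟩) := circles_closing p

/-- A map on the points of a word with two letters in front. -/
def twoMap {V : Type*} (c0 c1 : Fin n → V) (g : Pt u → V) (v : Pt (s0 :: s1 :: u)) : V :=
  Fin.cons (α := fun _ : Fin (u.length + 1 + 1 + 1) => V) (c0 v.1)
    (Fin.cons (α := fun _ => V) (c1 v.1) fun t => g (v.1, t)) v.2

theorem two_map {V : Type*} {E : Setoid V} {c0 c1 : Fin n → V} {g : Pt u → V}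
    (hc : ∀ p, E (g (p, Fin.last _)) (c0 p)) (h0 : Slab E c0 c1 s0 x)
    (h1 : Slab E c1 (fun p => g (p, 0)) s1 y)
    (hg : ∀ j, Slab E (fun p => g (p, j.castSucc)) (fun p => g (p, j.succ)) (u.get j) (J j))
    {v v' : Pt (s0 :: s1 :: u)} (h : circles (s0 :: s1 :: u) (res2 x y J) v v') :
    E (twoMap c0 c1 g v) (twoMap c0 c1 g v') := by
  refine circles_map (w := s0 :: s1 :: u) (twoMap c0 c1 g) hc (fun j => ?_) h
  obtain ⟨j, hj⟩ := j
  rcases j with _ | _ | j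
  · exact h0
  · exact h1
  · exact hg ⟨j, by simpa using hj⟩

/-- The circles through the points after two letters. -/
def rel2 (s0 s1 : Fin (n - 1) × Bool) (x y : Bool) (J : Resolution u) : Setoid (Pt u) :=
  (circles (s0 :: s1 :: u) (res2 x y J)).comap shift2

/-- The relation satisfies the condition `P`, so it contains the generated one. Conversely `c1`
replaces the points between the letters by points of `u` in the same class of the generated
relation, and this yields a map back. -/
theorem rel2_eq {P : Setoid (Pt u) → Prop} (c1 : Fin n → Pt u)
    (hP : P (rel2 s0 s1 x y J))
    (h0 : Slab (openRel u P J) (fun p => (p, Fin.last _)) c1 s0 x)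
    (h1 : Slab (openRel u P J) c1 (fun p => (p, 0)) s1 y) :
    rel2 s0 s1 x y J = openRel u P J := by
  ext v v'
  exact ⟨fun h => two_map (g := id) (c0 := fun p => (p, Fin.last _)) (fun p => (openRel u P J).refl _)
    h0 h1 (fun j => openRel_slab j) h, openRel_le shift2 hP fun j => two_outer j⟩

theorem rel2_outSaddle : OutSaddle (rel2 s0 s1 x y : Resolution u → Setoid (Pt u)) := by
  intro J j hj
  have h := saddle_update (w := s0 :: s1 :: u) (I := res2 x y J) (j := j.succ.succ) hj
  rw [update_res2_add] at h
  exact h.comap shift2 ((circles _ _).refl _) ((circles _ _).refl _) ((circles _ _).refl _)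
    ((circles _ _).refl _)

theorem d_res2 : d (s0 :: s1 :: u) (vac (res2 x y J)) =
    dEdge (res2 x y J) ⟨0, by simp⟩ + (dEdge (res2 x y J) ⟨1, by simp⟩ +
      outD ((khOps (s0 :: s1 :: u)).comap shift2) (rel2 s0 s1 x y) (fun J => vac (res2 x y J)) J) := by
  rw [d_vac]
  refine (Fin.sum_univ_succ (n := u.length + 1) _).trans (congrArg₂ _ rfl ?_)
  refine (Fin.sum_univ_succ (n := u.length) _).trans (congrArg₂ _ rfl ?_)
  refine Finset.sum_congr rfl fun j _ => ?_
  unfold dEdge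
  rw [update_res2_add]
  refine if_congr Iff.rfl ?_ rfl
  exact (theta_comap shift2 (circles (s0 :: s1 :: u) (res2 x y J)) (cornerA u j) (cornerB u j) _).symm

end Two

end BraidKh

namespace BraidKh

open FiltOps

variable {n : ℕ}

section Two

variable {s0 s1 : Fin (n - 1) × Bool} {u : BraidWord n} {x y : Bool} {J : Resolution u}
  {p q : Fin n}

theorem rel2_straight (hx : x = !s0.2) (hy : y = !s1.2) : rel2 s0 s1 x y J = circles u J := by
  rw [← openRel_id_eq]
  refine rel2_eq (fun r => (r, 0)) (fun r => ?_) (Slab.of_straight hx openRel_tanId)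
    (Slab.of_straight hy fun r => (openRel u TanId J).refl _)
  exact (circles _ _).trans (two_closing r)
    ((circles _ _).trans (two_slab0.straight hx r) (two_slab1.straight hy r))

theorem rel2_bent (h0 : Strands s0 p q) (h1 : Strands s1 p q) (hxy : x ≠ !s0.2 ∨ y ≠ !s1.2) :
    rel2 s0 s1 x y J = openRel u (TanBent p q) J := by
  have hT := openRel_tanBent (u := u) (J := J) (p := p) (q := q)
  set E := openRel u (TanBent p q) J with hE
  have t := openRel_tanBent (u := u) (J := J) (p := p) (q := q)
  set C := circles (s0 :: s1 :: u) (res2 x y J)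
  have hP : TanBent p q (rel2 s0 s1 x y J) := by
    have side : ∀ r, r ≠ p → r ≠ q → C (shift2 (r, Fin.last _)) (shift2 (r, 0)) := fun r hr hr' =>
      C.trans (two_closing r) (C.trans (two_slab0.side h0 hr hr') (two_slab1.side h1 hr hr'))
    have cl : ∀ r r', C (r, ⟨0, by simp⟩) (r', ⟨0, by simp⟩) →
        C (shift2 (r, Fin.last _)) (shift2 (r', Fin.last _)) := fun r r' h =>
      C.trans (two_closing r) (C.trans h (C.symm (two_closing r')))
    by_cases hx : x = !s0.2
    · have hy := hxy.resolve_left fun k => k hx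
      exact ⟨cl _ _ (C.trans (two_slab0.straight hx p) (C.trans (two_slab1.bent_bot h1 hy)
        (C.symm (two_slab0.straight hx q)))), two_slab1.bent_top h1 hy, side⟩
    · by_cases hy : y = !s1.2
      · exact ⟨cl _ _ (two_slab0.bent_bot h0 hx), C.trans (C.symm (two_slab1.straight hy p))
          (C.trans (two_slab0.bent_top h0 hx) (two_slab1.straight hy q)), side⟩
      · exact ⟨cl _ _ (two_slab0.bent_bot h0 hx), two_slab1.bent_top h1 hy, side⟩
  by_cases hy : y = !s1.2
  · have hx := hxy.resolve_right fun k => k hy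
    exact rel2_eq (fun r => (r, 0)) hP (Slab.of_bent h0 hx t.1 t.2.1 t.2.2)
      (Slab.of_straight hy fun r => E.refl _)
  · refine rel2_eq (fun r => (r, Fin.last _)) hP ?_ (Slab.of_bent h1 hy t.1 t.2.1 t.2.2)
    by_cases hx : x = !s0.2
    · exact Slab.of_straight hx fun r => E.refl _
    · exact Slab.of_bent h0 hx t.1 t.1 fun r _ _ => E.refl _

theorem two_cover (h0 : Strands s0 p q) (v : Pt (s0 :: s1 :: u)) :
    (∃ z : Pt u, circles (s0 :: s1 :: u) (res2 x y J) v (shift2 z)) ∨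
      circles (s0 :: s1 :: u) (res2 x y J) v (p, ⟨1, by simp⟩) := by
  set C := circles (s0 :: s1 :: u) (res2 x y J)
  obtain ⟨r, t, ht⟩ := v
  rcases t with _ | _ | t
  · exact Or.inl ⟨(r, Fin.last _), C.symm (two_closing r)⟩
  · have key : C (r, ⟨1, ht⟩) (r, ⟨0, by simp⟩) →
        (∃ z : Pt u, C (r, ⟨1, ht⟩) (shift2 z)) := fun h =>
      ⟨(r, Fin.last _), C.trans h (C.symm (two_closing r))⟩
    by_cases hx : x = !s0.2
    · exact Or.inl (key (C.symm (two_slab0.straight hx r)))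
    · by_cases hp : r = p
      · subst hp; exact Or.inr (C.refl _)
      · by_cases hq : r = q
        · subst hq; exact Or.inr (C.symm (two_slab0.bent_top h0 hx))
        · exact Or.inl (key (C.symm (two_slab0.side h0 hp hq)))
  · exact Or.inl ⟨(r, ⟨t, by simpa using ht⟩), C.refl _⟩

theorem two_circled (h0 : Strands s0 p q) (h1 : Strands s1 p q) (hx : x ≠ !s0.2)
    (hy : y ≠ !s1.2) (z : Pt u) :
    ¬ circles (s0 :: s1 :: u) (res2 x y J) (shift2 z) (p, ⟨1, by simp⟩) := by
  intro h
  -- The points between the letters on the strands `p` and `q` get the value `True`, all others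
  -- `False`. This is constant along the resolved diagram and separates the middle circle from the
  -- rest.
  have := two_map (E := ⊥) (c0 := fun _ => False) (c1 := fun r => r = p ∨ r = q)
    (g := fun _ => False) (fun _ => rfl)
    (Slab.of_bent h0 hx rfl (by change (_ ∨ _) = (_ ∨ _); simp)
      fun r hr hr' => by change False = (_ ∨ _); simp [hr, hr'])
    (Slab.of_bent h1 hy (by change (_ ∨ _) = (_ ∨ _); simp) rfl
      fun r hr hr' => by change (_ ∨ _) = False; simp [hr, hr'])
    (fun j => ⟨fun _ _ _ => rfl, fun _ => rfl, fun _ => rfl, fun _ => rfl, fun _ => rfl⟩) h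
  change False = (p = p ∨ p = q) at this
  simp at this

end Two

end BraidKh

namespace BraidKh

open FiltOps

variable {n : ℕ}

theorem Saddle.congr {V : Type*} {E E' : Setoid V} {a b a' b' : V} (h : Saddle E E' a b)
    (h1 : E a a') (h2 : E b b') (h3 : E' a a') (h4 : E' b b') : Saddle E E' a' b' :=
  h.imp (fun k => k.congr h1 h2) fun k => k.congr h3 h4

theorem d_vac_eq_outD {u : BraidWord n} (J : Resolution u) :
    d u (vac J) = outD (khOps u) (circles u) vac J := d_vac J

theorem circles_outSaddle {u : BraidWord n} : OutSaddle (circles u) := fun _ _ hj => saddle_update hj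

/-! ### Cancellation of a letter and its inverse -/

section Cancel

variable {a : Fin (n - 1)} {s : Bool} {u : BraidWord n} {J : Resolution u}

/-- The left strand of a generator. -/
def genL (a : Fin (n - 1)) : Fin n := letL (a, true)

/-- The right strand of a generator. -/
def genR (a : Fin (n - 1)) : Fin n := letR (a, true)

theorem strands_gen (a : Fin (n - 1)) (s : Bool) : Strands (a, s) (genL a) (genR a) :=
  Or.inl ⟨rfl, rfl⟩

/-- The relation for the resolution of `u` with a cap and a cup in front. -/
def bentRel (a : Fin (n - 1)) (J : Resolution u) : Setoid (Pt u) :=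
  openRel u (TanBent (genL a) (genR a)) J

theorem cancel_rel_id : rel2 (a, s) (a, !s) (!s) s J = circles u J :=
  rel2_straight rfl (by simp)

theorem cancel_rel_bent {x y : Bool} (h : x ≠ !s ∨ y ≠ s) :
    rel2 (a, s) (a, !s) x y J = bentRel a J :=
  rel2_bent (strands_gen a s) (strands_gen a _) (h.imp (fun h => h) fun h => by simpa using h)

/-- The middle circle. -/
def cancelMid (a : Fin (n - 1)) (s : Bool) (u : BraidWord n) : Pt ((a, s) :: (a, !s) :: u) :=
  (genL a, ⟨1, by simp⟩)

/-- The complex of a word with a cancelling pair in front. -/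
abbrev cancelOps (a : Fin (n - 1)) (s : Bool) (u : BraidWord n) :
    FiltOps (Pt u) (CKh ((a, s) :: (a, !s) :: u)) :=
  (khOps ((a, s) :: (a, !s) :: u)).comap shift2

/-- The resolutions 00 and 11 differ from the straight one at a single crossing; which crossing
depends on the sign. In each case the corner between the letters is joined to a point of `u`, and
the result is the same pair of points. -/
theorem cancel_saddle_id (b : Bool) : Saddle
    (circles ((a, s) :: (a, !s) :: u) (res2 (!s) s J))
    (circles ((a, s) :: (a, !s) :: u) (res2 b b J)) (shift2 (genL a, Fin.last _))
    (shift2 (genR a, 0)) := by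
  have g0 := strands_gen a s
  have g1 := strands_gen a (!s)
  have key0 : ∀ y, (y = s) → Saddle
      (circles ((a, s) :: (a, !s) :: u) (res2 false y J))
      (circles ((a, s) :: (a, !s) :: u) (res2 true y J)) (shift2 (genL a, Fin.last _))
      (shift2 (genR a, 0)) := fun y hy => by
    have h := saddle_strands (w := (a, s) :: (a, !s) :: u) (I := res2 false y J)
      (j := ⟨0, by simp⟩) g0 rfl
    rw [update_res2_zero] at h
    exact h.congr ((circles _ _).symm (two_closing _)) (two_slab1.straight (by simp [hy]) _)
      ((circles _ _).symm (two_closing _)) (two_slab1.straight (by simp [hy]) _)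
  have key1 : ∀ x, (x = !s) → Saddle
      (circles ((a, s) :: (a, !s) :: u) (res2 x false J))
      (circles ((a, s) :: (a, !s) :: u) (res2 x true J)) (shift2 (genL a, Fin.last _))
      (shift2 (genR a, 0)) := fun x hx => by
    have h := saddle_strands (w := (a, s) :: (a, !s) :: u) (I := res2 x false J)
      (j := ⟨1, by simp⟩) g1 rfl
    rw [update_res2_one] at h
    have e : ∀ y, circles ((a, s) :: (a, !s) :: u) (res2 x y J) (genL a, ⟨1, by simp⟩)
        (shift2 (genL a, Fin.last _)) := fun y =>
      (circles _ _).symm ((circles _ _).trans (two_closing _) (two_slab0.straight hx _))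
    exact h.congr (e _) ((circles _ _).refl _) (e _) ((circles _ _).refl _)
  cases s <;> cases b
  · exact (key0 false rfl).symm
  · exact key1 true rfl
  · exact (key1 false rfl).symm
  · exact key0 true rfl

theorem cancel_saddle : Saddle (circles u J) (bentRel a J) (genL a, Fin.last _) (genR a, 0) := by
  have h := (cancel_saddle_id (a := a) (s := true) (J := J) true).comap shift2
    ((circles _ _).refl _) ((circles _ _).refl _) ((circles _ _).refl _) ((circles _ _).refl _)
  have e1 : rel2 (a, true) (a, !true) (!true) true J = circles u J := cancel_rel_id
  have e2 : rel2 (a, true) (a, !true) true true J = bentRel a J := cancel_rel_bent (by simp)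
  rw [← e1, ← e2]
  exact h

theorem bentRel_outSaddle : OutSaddle (bentRel a : Resolution u → Setoid (Pt u)) := by
  have h := rel2_outSaddle (s0 := (a, true)) (s1 := (a, false)) (u := u) (x := true) (y := true)
  rwa [show (rel2 (a, true) (a, false) true true : Resolution u → Setoid (Pt u)) = bentRel a from
    funext fun J => cancel_rel_bent (s := true) (by simp)] at h

theorem cancel_circled (z : Pt u) : ¬ circles ((a, s) :: (a, !s) :: u) (res2 s (!s) J) (shift2 z)
    (cancelMid a s u) :=
  two_circled (strands_gen a s) (strands_gen a _) (by simp) (by simp) z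

theorem theta_shift2 {x y : Bool} {R : Setoid (Pt u)} (h : rel2 (a, s) (a, !s) x y J = R)
    (v v' : Pt u) (m) : (khOps ((a, s) :: (a, !s) :: u)).theta
      (circles ((a, s) :: (a, !s) :: u) (res2 x y J)) (shift2 v) (shift2 v') m =
      (cancelOps a s u).theta R v v' m := by
  rw [← h]
  exact (theta_comap shift2 _ _ _ _).symm

theorem d_cancel_id : d ((a, s) :: (a, !s) :: u) (vac (res2 (!s) s J)) =
    (cancelOps a s u).theta (circles u J) (genL a, Fin.last _) (genR a, 0)
      (vac (res2 true true J)) +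
    outD (cancelOps a s u) (circles u) (fun J => vac (res2 (!s) s J)) J := by
  rw [d_res2, show (rel2 (a, s) (a, !s) (!s) s : Resolution u → _) = circles u from
    funext fun J => cancel_rel_id, ← add_assoc]
  congr 1
  rw [← theta_shift2 cancel_rel_id]
  have h := cancel_saddle_id (a := a) (s := s) (J := J) true
  cases s
  · rw [dEdge_of_true rfl, zero_add, dEdge_eq rfl (by rw [update_res2_one]; exact h),
      update_res2_one]
    rfl
  · rw [dEdge_of_true (j := ⟨1, _⟩) rfl, add_zero,
      dEdge_eq rfl (by rw [update_res2_zero]; exact h), update_res2_zero]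

/-- The first term merges the middle circle, labeled v₊, with an outer circle, so its saddle map is
the identity. This is one of the two isomorphisms that are eliminated. -/
theorem d_cancel_bent : d ((a, s) :: (a, !s) :: u) (vac (res2 s (!s) J)) =
    vac (res2 true true J) +
    outD (cancelOps a s u) (bentRel a) (fun J => vac (res2 s (!s) J)) J := by
  rw [d_res2, show (rel2 (a, s) (a, !s) s (!s) : Resolution u → _) = bentRel a from
    funext fun J => cancel_rel_bent (by simp), ← add_assoc]
  congr 1
  have hc := cancel_circled (a := a) (s := s) (J := J)
  cases s
  · have E0 : dEdge (res2 false true J : Resolution ((a, false) :: (a, !false) :: u)) ⟨0, by simp⟩ =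
        vac (res2 true true J) := by
      rw [dEdge_eq rfl (saddle_strands (strands_gen a _).symm rfl), update_res2_zero]
      exact theta_of_not (fun k => hc _ ((circles _ _).trans (two_closing _) k)) _
    have E1 : dEdge (res2 false true J : Resolution ((a, false) :: (a, !false) :: u))
        ⟨1, by simp⟩ = 0 := dEdge_of_true rfl
    exact (congrArg₂ _ E0 E1).trans (add_zero _)
  · have E1 : dEdge (res2 true false J : Resolution ((a, true) :: (a, !true) :: u)) ⟨1, by simp⟩ =
        vac (res2 true true J) := by
      rw [dEdge_eq rfl (saddle_strands (strands_gen a _) rfl), update_res2_one]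
      exact theta_of_not (fun k => hc (genR a, 0) ((circles _ _).symm k)) _
    have E0 : dEdge (res2 true false J : Resolution ((a, true) :: (a, !true) :: u))
        ⟨0, by simp⟩ = 0 := dEdge_of_true rfl
    exact (congrArg₂ _ E0 E1).trans (zero_add _)

/-- The term with the operator at `cancelMid` is the other isomorphism to be eliminated: it splits
off the middle circle with label v₋. The point `z` is on the outer circle from which it is split
off. -/
theorem d_cancel_zero : ∃ z : Pt u, d ((a, s) :: (a, !s) :: u) (vac (res2 false false J)) =
    (cancelOps a s u).theta (bentRel a J) (genL a, Fin.last _) (genR a, 0)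
      (vac (res2 (!s) s J)) +
    ((khOps ((a, s) :: (a, !s) :: u)).X (cancelMid a s u) (vac (res2 s (!s) J)) +
      (cancelOps a s u).X z (vac (res2 s (!s) J)) +
    outD (cancelOps a s u) (bentRel a) (fun J => vac (res2 false false J)) J) := by
  have h := (cancel_saddle_id (a := a) (s := s) (J := J) false).symm
  have e : ∀ J : Resolution u, rel2 (a, s) (a, !s) false false J = bentRel a J := fun J =>
    cancel_rel_bent (by cases s <;> simp)
  simp only [← theta_shift2 (e J)]
  rw [d_res2, show (rel2 (a, s) (a, !s) false false : Resolution u → _) = bentRel a from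
    funext e]
  have g1 := strands_gen a (!s)
  have g0 := strands_gen a s
  cases s
  · refine ⟨(genR a, 0), ?_⟩
    have E0 : dEdge (res2 false false J : Resolution ((a, false) :: (a, !false) :: u))
        ⟨0, by simp⟩ = _ := dEdge_eq rfl (by rw [update_res2_zero]; exact h)
    rw [update_res2_zero] at E0
    have E1 : dEdge (res2 false false J : Resolution ((a, false) :: (a, !false) :: u))
        ⟨1, by simp⟩ = _ := dEdge_eq rfl (saddle_strands g1 rfl)
    have r : circles ((a, false) :: (a, !false) :: u) (res2 false false J)
        (genL a, ⟨1, by simp⟩) (shift2 (genR a, 0)) :=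
      (circles _ _).trans (two_slab0.bent_top g0 (by simp)) (two_slab1.straight rfl _)
    rw [update_res2_one] at E1
    rw [E0, E1.trans (theta_of r _)]
    rfl
  · refine ⟨(genR a, Fin.last _), ?_⟩
    have E1 : dEdge (res2 false false J : Resolution ((a, true) :: (a, !true) :: u))
        ⟨1, by simp⟩ = _ := dEdge_eq rfl (by rw [update_res2_one]; exact h)
    rw [update_res2_one] at E1
    have E0 : dEdge (res2 false false J : Resolution ((a, true) :: (a, !true) :: u))
        ⟨0, by simp⟩ = _ := dEdge_eq rfl (saddle_strands g0.symm rfl)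
    have r : circles ((a, true) :: (a, !true) :: u) (res2 false false J)
        (genR a, ⟨0, by simp⟩) (genL a, ⟨1, by simp⟩) :=
      (circles _ _).trans (two_slab0.straight rfl _) (two_slab1.bent_bot g1.symm (by simp))
    rw [update_res2_zero] at E0
    replace E0 := E0.trans (theta_of r _)
    have c := vac_compat _ _ _ (((circles _ _).symm (two_closing (genR a))) :
      circles ((a, true) :: (a, !true) :: u) (res2 true false J) _ _)
    rw [E0.trans ((add_comm _ _).trans (congrArg _ c)), E1]
    exact add_left_comm _ _ _

theorem d_cancel_one : d ((a, s) :: (a, !s) :: u) (vac (res2 true true J)) =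
    outD (cancelOps a s u) (bentRel a) (fun J => vac (res2 true true J)) J := by
  rw [d_res2, show (rel2 (a, s) (a, !s) true true : Resolution u → _) = bentRel a from
    funext fun J => cancel_rel_bent (by cases s <;> simp), dEdge_of_true rfl, dEdge_of_true rfl,
    zero_add, zero_add]

theorem cancel_outer {x y : Bool} (h : x = (!s) ∨ y = s) :
    ∃ z : Pt u, circles ((a, s) :: (a, !s) :: u) (res2 x y J) (cancelMid a s u) (shift2 z) := by
  rcases h with rfl | rfl
  · exact ⟨(genL a, Fin.last _), (circles _ _).symm
      ((circles _ _).trans (two_closing _) (two_slab0.straight rfl _))⟩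
  · exact ⟨(genL a, 0), two_slab1.straight (by simp) _⟩

theorem cancel_braidlike : (braidlike ((a, s) :: (a, !s) :: u)) = res2 (!s) s (braidlike u) := by
  funext j
  obtain ⟨j, hj⟩ := j
  rcases j with _ | _ | j
  · rfl
  · simp [braidlike, res2]
  · rfl

theorem bits_cases (s x y : Bool) : (x = (!s) ∧ y = s) ∨ (x = s ∧ y = (!s)) ∨
    (x = false ∧ y = false) ∨ (x = true ∧ y = true) := by
  cases s <;> cases x <;> cases y <;> simp

end Cancel

/-- Shows that a correction term at a resolution that joins two strands does not contribute to the
image of ψ: all strands are labeled v₋, and v₋v₋ = 0. -/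
theorem xs_all_eq_zero {V N : Type*} [AddCommGroup N] [Module (ZMod 2) N] {O : FiltOps V N}
    {E : Setoid V} {m : N} (h : O.Compat E m) {cl : Fin n → V} {p q : Fin n} (hpq : p ≠ q)
    (e : E (cl p) (cl q)) : O.xs ((List.finRange n).map cl) m = 0 := by
  refine h.xs_zero fun hp => ?_
  rw [List.pairwise_map] at hp
  have : Std.Symm fun a b => ¬ E (cl a) (cl b) := ⟨fun _ _ h k => h (E.symm k)⟩
  exact hp.forall (List.mem_finRange p) (List.mem_finRange q) hpq e

theorem xs_comap {V W N : Type*} [AddCommGroup N] [Module (ZMod 2) N] {O : FiltOps V N}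
    (ι : W → V) (S : List W) (m : N) : (O.comap ι).xs S m = O.xs (S.map ι) m := by
  simp only [xs, List.map_map]; rfl

theorem Outer.lift_outD {w u : BraidWord n} (A : Outer w (Pt u)) {N : Type*} [AddCommGroup N]
    [Module (ZMod 2) N] {O : FiltOps (Pt u) N} {n0 n1 : Resolution w → N}
    (h0 : ∀ I, O.Compat (A.rel I) (n0 I)) (h1 : ∀ I, O.Compat (A.rel I) (n1 I))
    (R : Resolution u → Setoid (Pt u)) (m : Resolution u → CKh w) (J : Resolution u) :
    A.lift O n0 n1 (outD A.ops R m J) = outD O R (fun J => A.lift O n0 n1 (m J)) J :=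
  outD_map _ (A.lift_X h0 h1)

/-- All points of a diagram as outer points. -/
def Outer.all (u : BraidWord n) (x0 : Pt u) : Outer u (Pt u) :=
  ⟨id, clPt u, fun _ => x0, fun _ _ => (circles u _).refl _,
    fun _ v => Or.inl ⟨v, (circles u _).refl _⟩⟩

/-- The inclusion of the complex of `u`. -/
def FMap.insertPair (a : Fin (n - 1)) (s : Bool) (u : BraidWord n) :
    FMap u ((a, s) :: (a, !s) :: u) :=
  let A : Outer u (Pt u) := Outer.all u (genL a, 0)
  -- The boundary of the first summand has a component at the resolution 11. The second summand,
  -- with v₊ on the middle circle, has the same component, and they cancel.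
  let m : Resolution u → CKh ((a, s) :: (a, !s) :: u) := fun J => vac (res2 (!s) s J) +
    (cancelOps a s u).theta (circles u J) (genL a, Fin.last _) (genR a, 0) (vac (res2 s (!s) J))
  have hid : ∀ J, (cancelOps a s u).Adm (clPt u) (circles u J) (vac (res2 (!s) s J)) := fun J => by
    rw [← cancel_rel_id (a := a) (s := s)]
    exact (vac_adm_level _ ⟨2, by simp⟩).comap shift2 fun p => (circles _ _).refl _
  have hbent : ∀ J, (cancelOps a s u).Adm (clPt u) (bentRel a J) (vac (res2 s (!s) J)) :=
    fun J => by
      rw [← cancel_rel_bent (a := a) (s := s) (x := s) (y := !s) (by simp)]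
      exact (vac_adm_level _ ⟨2, by simp⟩).comap shift2 fun p => (circles _ _).refl _
  have h0 : ∀ J, (cancelOps a s u).Adm (clPt u) (circles u J) (m J) := fun J =>
    (hid J).add ((hbent J).theta cancel_saddle)
  have h1 : ∀ J, (cancelOps a s u).Adm (clPt u) (circles u J) 0 := fun _ => Adm.zero
  A.fmap shift2 m (fun _ => 0) h0 h1
    (fun J => by
      have c0 := fun I => (h0 I).compat
      have e := A.lift_outD (n1 := fun _ => 0) c0 (fun I => (h1 I).compat) (circles u) vac J
      rw [outD_congr fun J => A.lift_vac c0 J] at e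
      rw [d_vac_eq_outD]
      refine e.trans ?_
      rw [outD_add, outD_theta circles_outSaddle bentRel_outSaddle (fun _ => cancel_saddle)
        fun J => (hbent J).compat, map_add, d_theta_comap, d_cancel_id, d_cancel_bent, map_add,
        add_add_add_comm, add_self_zmod2, zero_add])
    (fun I hI => absurd ((circles u I).refl _) (hI (genL a, 0)))
    (by
      -- The correction joins the two strands of the pair and vanishes once all strands are labeled
      -- v₋.
      rw [map_add, xs_theta, xs_all_eq_zero (hbent _).compat (strands_gen a s).ne
        openRel_tanBent.2.1, map_zero, add_zero, xs_comap, List.map_map, ← cancel_braidlike]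
      exact psi_eq_xs _ _ fun p => rfl)

/-- The projection to the complex of `u`. -/
def FMap.cancelPair (a : Fin (n - 1)) (s : Bool) (u : BraidWord n) :
    FMap ((a, s) :: (a, !s) :: u) u :=
  let A : Outer ((a, s) :: (a, !s) :: u) (Pt u) := ⟨shift2, fun p => (p, Fin.last _),
    fun _ => cancelMid a s u, fun _ p => circles_closing p, fun I v => by
      obtain ⟨x, y, J, rfl⟩ := eq_res2 I
      exact two_cover (strands_gen a s) v⟩
  let tl : Resolution ((a, s) :: (a, !s) :: u) → Resolution u := fun I j => I j.succ.succ
  let θ : Resolution u → CKh u := fun J =>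
    ((khOps u).comap id).theta (bentRel a J) (genL a, Fin.last _) (genR a, 0) (vac J)
  let m0 : Resolution ((a, s) :: (a, !s) :: u) → CKh u := fun I =>
    if I ⟨0, by simp⟩ = (!s) ∧ I ⟨1, by simp⟩ = s then vac (tl I) else 0
  -- This value is forced. The boundary at 00 contains both the saddle to the straight resolution
  -- and the middle circle labeled v₋, and the map is zero at 00.
  let m1 : Resolution ((a, s) :: (a, !s) :: u) → CKh u := fun I =>
    if I ⟨0, by simp⟩ = s ∧ I ⟨1, by simp⟩ = (!s) then θ (tl I) else 0
  have m0_id : ∀ J, m0 (res2 (!s) s J) = vac J := fun J => if_pos ⟨rfl, rfl⟩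
  have m0_bent : ∀ J, m0 (res2 s (!s) J) = 0 := fun J => if_neg (by simp [res2])
  have m0_diag : ∀ b J, m0 (res2 b b J) = 0 := fun b J => if_neg (by
    rintro ⟨h, h'⟩
    exact absurd (h.symm.trans h') (by simp))
  have m1_id : ∀ J, m1 (res2 (!s) s J) = 0 := fun J => if_neg (by simp [res2])
  have m1_bent : ∀ J, m1 (res2 s (!s) J) = θ J := fun J => if_pos ⟨rfl, rfl⟩
  have m1_diag : ∀ b J, m1 (res2 b b J) = 0 := fun b J => if_neg (by
    rintro ⟨h, h'⟩
    exact absurd (h.symm.trans h') (by simp))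
  have hvac : ∀ J, ((khOps u).comap id).Adm A.cl (circles u J) (vac J) := fun J =>
    (vac_adm_level J (Fin.last _)).comap id fun p => (circles u J).refl _
  have h0 : ∀ I, ((khOps u).comap id).Adm A.cl (A.rel I) (m0 I) := fun I => by
    obtain ⟨x, y, J, rfl⟩ := eq_res2 I
    rcases bits_cases s x y with ⟨rfl, rfl⟩ | ⟨rfl, rfl⟩ | ⟨rfl, rfl⟩ | ⟨rfl, rfl⟩
    · rw [m0_id, show A.rel _ = circles u J from cancel_rel_id]; exact hvac J
    · rw [m0_bent]; exact Adm.zero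
    · rw [m0_diag]; exact Adm.zero
    · rw [m0_diag]; exact Adm.zero
  have h1 : ∀ I, ((khOps u).comap id).Adm A.cl (A.rel I) (m1 I) := fun I => by
    obtain ⟨x, y, J, rfl⟩ := eq_res2 I
    rcases bits_cases s x y with ⟨rfl, rfl⟩ | ⟨rfl, rfl⟩ | ⟨rfl, rfl⟩ | ⟨rfl, rfl⟩
    · rw [m1_id]; exact Adm.zero
    · rw [m1_bent, show A.rel _ = bentRel a J from cancel_rel_bent (by simp)]
      exact (hvac J).theta cancel_saddle.symm
    · rw [m1_diag]; exact Adm.zero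
    · rw [m1_diag]; exact Adm.zero
  have c0 := fun I => (h0 I).compat
  have c1 := fun I => (h1 I).compat
  A.fmap id m0 m1 h0 h1
    (fun I => by
      obtain ⟨x, y, J, rfl⟩ := eq_res2 I
      rcases bits_cases s x y with ⟨rfl, rfl⟩ | ⟨rfl, rfl⟩ | ⟨rfl, rfl⟩ | ⟨rfl, rfl⟩
      · rw [m0_id, d_cancel_id, map_add, A.lift_theta c0 c1, A.lift_vac c0, m0_diag, map_zero,
          zero_add, A.lift_outD c0 c1, d_vac_eq_outD]
        exact outD_congr fun J => (A.lift_vac c0 _).trans (m0_id J)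
      · rw [m0_bent, d_cancel_bent, map_add, A.lift_vac c0, m0_diag, zero_add, A.lift_outD c0 c1,
          outD_congr fun J => (A.lift_vac c0 _).trans (m0_bent J), outD_zero, map_zero]
      · obtain ⟨z, hz⟩ := d_cancel_zero (a := a) (s := s) (J := J)
        rw [hz, map_add, map_add, map_add, A.lift_theta c0 c1, A.lift_vac c0, m0_id,
          A.lift_mid c1 (I := res2 s (!s) J) cancel_circled, m1_bent, A.lift_X c0 c1,
          A.lift_vac c0, m0_bent, map_zero, add_zero, A.lift_outD c0 c1,
          outD_congr fun J => (A.lift_vac c0 _).trans (m0_diag false J), outD_zero, add_zero,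
          add_self_zmod2, m0_diag, map_zero]
      · rw [d_cancel_one, A.lift_outD c0 c1,
          outD_congr fun J => (A.lift_vac c0 _).trans (m0_diag true J), outD_zero, m0_diag,
          map_zero])
    (fun I hI => by
      obtain ⟨x, y, J, rfl⟩ := eq_res2 I
      have hno : ∀ {x y : Bool} {J}, x = (!s) ∨ y = s → ¬ A.Circled (res2 x y J) := fun h hI => by
        obtain ⟨z, hz⟩ := cancel_outer (a := a) (u := u) h
        exact hI z ((circles _ _).symm hz)
      rcases bits_cases s x y with ⟨rfl, rfl⟩ | ⟨rfl, rfl⟩ | ⟨rfl, rfl⟩ | ⟨rfl, rfl⟩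
      · exact absurd hI (hno (Or.inl rfl))
      -- At 11 the middle point lies on an outer circle, so its operator is an outer one and that
      -- term maps to zero.
      · obtain ⟨z, hz⟩ := cancel_outer (a := a) (s := x) (u := u) (J := J) (x := true) (y := true)
          (by cases x <;> simp)
        have hX : (khOps ((a, x) :: (a, !x) :: u)).X (cancelMid a x u) (vac (res2 true true J)) =
          A.ops.X z (vac (res2 true true J)) := vac_compat _ _ _ hz
        have e : (khOps ((a, x) :: (a, !x) :: u)).X (cancelMid a x u)
            (outD (cancelOps a x u) (bentRel a) (fun J => vac (res2 x (!x) J)) J) = _ :=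
          outD_map (O' := cancelOps a x u) _ fun v x => (khOps _).comm _ _ _
        rw [d_cancel_bent, map_add, map_add]
        refine (congrArg₂ (· + ·) (congrArg _ hX) (congrArg _ e)).trans ?_
        rw [A.lift_X c0 c1, A.lift_vac c0, m0_diag, map_zero, zero_add, A.lift_outD c0 c1, m1_bent,
          outD_congr fun J => (A.lift_mid c1 cancel_circled).trans (m1_bent J),
          outD_theta bentRel_outSaddle circles_outSaddle (fun J => cancel_saddle.symm)
            fun J => (hvac J).compat]
        exact (d_theta_comap id _ _ _ _).symm ▸ congrArg _ (d_vac_eq_outD J).symm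
      · exact absurd hI (hno (by cases s <;> simp))
      · exact absurd hI (hno (by cases s <;> simp)))
    (by
      rw [cancel_braidlike, m0_id, xs_comap, List.map_id]
      exact psi_eq_xs u _ fun p => rfl)

theorem KEquiv.cancelPair (a : Fin (n - 1)) (s : Bool) (u : BraidWord n) :
    KEquiv ((a, s) :: (a, !s) :: u) u :=
  ⟨⟨FMap.cancelPair a s u⟩, ⟨FMap.insertPair a s u⟩⟩

end BraidKh

namespace BraidKh

open FiltOps

variable {n : ℕ}

/-! ### Three letters in front of a word -/

section Three

variable {s0 s1 s2 : Fin (n - 1) × Bool} {u : BraidWord n}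

/-- A resolution of a word with three letters in front. -/
def res3 (x y z : Bool) (J : Resolution u) : Resolution (s0 :: s1 :: s2 :: u) :=
  Fin.cons (α := fun _ : Fin (u.length + 3) => Bool) x (res2 (s0 := s1) (s1 := s2) y z J)

/-- The points after three letters. -/
def shift3 (v : Pt u) : Pt (s0 :: s1 :: s2 :: u) := (v.1, v.2.succ.succ.succ)

theorem eq_res3 (I : Resolution (s0 :: s1 :: s2 :: u)) : ∃ x y z J, I = res3 x y z J := by
  refine ⟨I ⟨0, by simp⟩, I ⟨1, by simp⟩, I ⟨2, by simp⟩, fun j => I j.succ.succ.succ, ?_⟩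
  funext j
  obtain ⟨j, hj⟩ := j
  rcases j with _ | _ | _ | j <;> rfl

variable {x y z : Bool} {J : Resolution u}

theorem update_res3_zero (h : 0 < (s0 :: s1 :: s2 :: u).length) :
    Function.update (res3 x y z J : Resolution (s0 :: s1 :: s2 :: u)) ⟨0, h⟩ true =
      res3 true y z J := by
  funext j
  obtain ⟨j, hj⟩ := j
  rcases j with _ | j
  · rw [Function.update_self]; rfl
  · rw [Function.update_of_ne (by simp)]; rfl

theorem update_res3_one (h : 1 < (s0 :: s1 :: s2 :: u).length) :
    Function.update (res3 x y z J : Resolution (s0 :: s1 :: s2 :: u)) ⟨1, h⟩ true =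
      res3 x true z J := by
  funext j
  obtain ⟨j, hj⟩ := j
  rcases j with _ | _ | j
  · rw [Function.update_of_ne (by simp)]; rfl
  · rw [Function.update_self]; rfl
  · rw [Function.update_of_ne (by simp)]; rfl

theorem update_res3_two (h : 2 < (s0 :: s1 :: s2 :: u).length) :
    Function.update (res3 x y z J : Resolution (s0 :: s1 :: s2 :: u)) ⟨2, h⟩ true =
      res3 x y true J := by
  funext j
  obtain ⟨j, hj⟩ := j
  rcases j with _ | _ | _ | j
  · rw [Function.update_of_ne (by simp)]; rfl
  · rw [Function.update_of_ne (by simp)]; rfl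
  · rw [Function.update_self]; rfl
  · rw [Function.update_of_ne (by simp)]; rfl

theorem update_res3_add (j : Fin u.length) :
    Function.update (res3 x y z J : Resolution (s0 :: s1 :: s2 :: u)) j.succ.succ.succ true =
      res3 x y z (Function.update J j true) := by
  have h := update_res2_add (s0 := s1) (s1 := s2) (x := y) (y := z) (J := J) j
  unfold res3
  rw [← h]
  exact (Fin.cons_update (α := fun _ : Fin (u.length + 3) => Bool) _ _ _ _).symm

theorem three_slab0 : Slab (circles (s0 :: s1 :: s2 :: u) (res3 x y z J))
    (fun p => (p, ⟨0, by simp⟩)) (fun p => (p, ⟨1, by simp⟩)) s0 x :=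
  circles_slab_nat (w := s0 :: s1 :: s2 :: u) 0 (by simp) (fun _ => rfl) (fun _ => rfl)

theorem three_slab1 : Slab (circles (s0 :: s1 :: s2 :: u) (res3 x y z J))
    (fun p => (p, ⟨1, by simp⟩)) (fun p => (p, ⟨2, by simp⟩)) s1 y :=
  circles_slab_nat (w := s0 :: s1 :: s2 :: u) 1 (by simp) (fun _ => rfl) (fun _ => rfl)

theorem three_slab2 : Slab (circles (s0 :: s1 :: s2 :: u) (res3 x y z J))
    (fun p => (p, ⟨2, by simp⟩)) (fun p => shift3 (p, 0)) s2 z :=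
  circles_slab_nat (w := s0 :: s1 :: s2 :: u) 2 (by simp) (fun _ => rfl) (fun _ => rfl)

theorem three_outer (j : Fin u.length) : Slab (circles (s0 :: s1 :: s2 :: u) (res3 x y z J))
    (fun p => shift3 (p, j.castSucc)) (fun p => shift3 (p, j.succ)) (u.get j) (J j) :=
  circles_slab_nat (w := s0 :: s1 :: s2 :: u) (j.val + 3) (by simp) (fun _ => rfl) (fun _ => rfl)

theorem three_closing (p : Fin n) : circles (s0 :: s1 :: s2 :: u) (res3 x y z J)
    (shift3 (p, Fin.last _)) (p, ⟨0, by simp⟩) := circles_closing p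

/-- A map on the points of a word with three letters in front. -/
def threeMap {V : Type*} (c0 c1 c2 : Fin n → V) (g : Pt u → V) (v : Pt (s0 :: s1 :: s2 :: u)) : V :=
  Fin.cons (α := fun _ : Fin (u.length + 1 + 1 + 1 + 1) => V) (c0 v.1)
    (Fin.cons (α := fun _ : Fin (u.length + 1 + 1 + 1) => V) (c1 v.1)
      (Fin.cons (α := fun _ => V) (c2 v.1) fun t => g (v.1, t))) v.2

theorem three_map {V : Type*} {E : Setoid V} {c0 c1 c2 : Fin n → V} {g : Pt u → V}
    (hc : ∀ p, E (g (p, Fin.last _)) (c0 p)) (h0 : Slab E c0 c1 s0 x) (h1 : Slab E c1 c2 s1 y)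
    (h2 : Slab E c2 (fun p => g (p, 0)) s2 z)
    (hg : ∀ j, Slab E (fun p => g (p, j.castSucc)) (fun p => g (p, j.succ)) (u.get j) (J j))
    {v v' : Pt (s0 :: s1 :: s2 :: u)} (h : circles (s0 :: s1 :: s2 :: u) (res3 x y z J) v v') :
    E (threeMap c0 c1 c2 g v) (threeMap c0 c1 c2 g v') := by
  refine circles_map (w := s0 :: s1 :: s2 :: u) (threeMap c0 c1 c2 g) hc (fun j => ?_) h
  obtain ⟨j, hj⟩ := j
  rcases j with _ | _ | _ | j
  · exact h0
  · exact h1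
  · exact h2
  · exact hg ⟨j, by simpa using hj⟩

/-- The circles through the points after three letters. -/
def rel3 (s0 s1 s2 : Fin (n - 1) × Bool) (x y z : Bool) (J : Resolution u) : Setoid (Pt u) :=
  (circles (s0 :: s1 :: s2 :: u) (res3 x y z J)).comap shift3

theorem rel3_eq {P : Setoid (Pt u) → Prop} (c1 c2 : Fin n → Pt u)
    (hP : P (rel3 s0 s1 s2 x y z J))
    (h0 : Slab (openRel u P J) (fun p => (p, Fin.last _)) c1 s0 x)
    (h1 : Slab (openRel u P J) c1 c2 s1 y)
    (h2 : Slab (openRel u P J) c2 (fun p => (p, 0)) s2 z) :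
    rel3 s0 s1 s2 x y z J = openRel u P J := by
  ext v v'
  exact ⟨fun h => three_map (g := id) (c0 := fun p => (p, Fin.last _))
    (fun p => (openRel u P J).refl _) h0 h1 h2 (fun j => openRel_slab j) h,
    openRel_le shift3 hP fun j => three_outer j⟩

theorem rel3_outSaddle : OutSaddle (rel3 s0 s1 s2 x y z : Resolution u → Setoid (Pt u)) := by
  intro J j hj
  have h := saddle_update (w := s0 :: s1 :: s2 :: u) (I := res3 x y z J) (j := j.succ.succ.succ) hj
  rw [update_res3_add] at h
  exact h.comap shift3 ((circles _ _).refl _) ((circles _ _).refl _) ((circles _ _).refl _)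
    ((circles _ _).refl _)

theorem d_res3 : d (s0 :: s1 :: s2 :: u) (vac (res3 x y z J)) =
    dEdge (res3 x y z J) ⟨0, by simp⟩ + (dEdge (res3 x y z J) ⟨1, by simp⟩ +
      (dEdge (res3 x y z J) ⟨2, by simp⟩ + outD ((khOps (s0 :: s1 :: s2 :: u)).comap shift3)
        (rel3 s0 s1 s2 x y z) (fun J => vac (res3 x y z J)) J)) := by
  rw [d_vac]
  refine (Fin.sum_univ_succ (n := u.length + 2) _).trans (congrArg₂ _ rfl ?_)
  refine (Fin.sum_univ_succ (n := u.length + 1) _).trans (congrArg₂ _ rfl ?_)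
  refine (Fin.sum_univ_succ (n := u.length) _).trans (congrArg₂ _ rfl ?_)
  refine Finset.sum_congr rfl fun j _ => ?_
  unfold dEdge
  rw [update_res3_add]
  refine if_congr Iff.rfl ?_ rfl
  exact (theta_comap shift3 (circles (s0 :: s1 :: s2 :: u) (res3 x y z J)) (cornerA u j)
    (cornerB u j) _).symm

theorem rel3_adm : ((khOps (s0 :: s1 :: s2 :: u)).comap shift3).Adm (fun p => (p, Fin.last _))
    (rel3 s0 s1 s2 x y z J) (vac (res3 x y z J)) :=
  (vac_adm _).comap shift3 fun p => circles_closing p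

end Three

end BraidKh

namespace BraidKh

open FiltOps

variable {n : ℕ}

/-! ### The diagrams in the braid relation -/

/-- The strands of two adjacent generators: `a` crosses `m` and `x`, `b` crosses `m` and `y`. -/
structure Adjacent (a b : Fin (n - 1)) (m x y : Fin n) : Prop where
  left : Strands (a, true) m x
  right : Strands (b, true) m y
  ne : x ≠ y

theorem Adjacent.symm {a b : Fin (n - 1)} {m x y : Fin n} (h : Adjacent a b m x y) :
    Adjacent b a m y x := ⟨h.right, h.left, h.ne.symm⟩

theorem adjacent_of_val {a b : Fin (n - 1)} (h : a.val + 1 = b.val) :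
    Adjacent a b (letR (a, true)) (letL (a, true)) (letR (b, true)) where
  left := Or.inr ⟨rfl, rfl⟩
  right := Or.inl ⟨Fin.ext h, rfl⟩
  ne e := by
    have := congrArg Fin.val e
    simp only [letL, letR] at this
    omega

section Braid

variable {a b : Fin (n - 1)} {m x y : Fin n} {u : BraidWord n} {J : Resolution u}

/-- The word `a b a u`. -/
abbrev aba (a b : Fin (n - 1)) (u : BraidWord n) : BraidWord n :=
  (a, true) :: (b, true) :: (a, true) :: u

/-- The circles through the points of `u` in a resolution of `a b a u`. -/
abbrev abaRel (a b : Fin (n - 1)) (i j k : Bool) (J : Resolution u) : Setoid (Pt u) :=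
  rel3 (a, true) (b, true) (a, true) i j k J

/-- A resolution of `a b a u`. -/
abbrev abaRes (a b : Fin (n - 1)) (i j k : Bool) (J : Resolution u) : Resolution (aba a b u) :=
  res3 i j k J

/-- The last points of `u` are below the letters in front. -/
abbrev ptB (u : BraidWord n) (p : Fin n) : Pt u := (p, Fin.last _)

/-- The first points of `u` are above the letters in front. -/
abbrev ptT (u : BraidWord n) (p : Fin n) : Pt u := (p, 0)

theorem abaRel_id : abaRel a b false false false J = circles u J := by
  rw [← openRel_id_eq]
  refine rel3_eq (ptT u) (ptT u) (fun r => ?_) (Slab.of_straight rfl openRel_tanId)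
    (Slab.of_straight rfl fun r => (openRel u TanId J).refl _)
    (Slab.of_straight rfl fun r => (openRel u TanId J).refl _)
  exact (circles _ _).trans (three_closing r) ((circles _ _).trans (three_slab0.straight rfl r)
    ((circles _ _).trans (three_slab1.straight rfl r) (three_slab2.straight rfl r)))

theorem three_bottom {s0 s1 s2 : Fin (n - 1) × Bool} {i j k : Bool} {p q : Fin n}
    (h : circles (s0 :: s1 :: s2 :: u) (res3 i j k J) (p, ⟨0, by simp⟩) (q, ⟨0, by simp⟩)) :
    rel3 s0 s1 s2 i j k J (ptB u p) (ptB u q) :=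
  (circles _ _).trans (three_closing p) ((circles _ _).trans h ((circles _ _).symm
    (three_closing q)))

theorem abaRel_100 (h : Adjacent a b m x y) :
    abaRel a b true false false J = openRel u (TanBent m x) J := by
  have t := openRel_tanBent (u := u) (J := J) (p := m) (q := x)
  set E := openRel u (TanBent m x) J
  set C := circles (aba a b u) (abaRes a b true false false J)
  have up : ∀ r, C (r, ⟨1, by simp⟩) (shift3 (ptT u r)) := fun r =>
    C.trans (three_slab1.straight rfl r) (three_slab2.straight rfl r)
  refine rel3_eq (ptT u) (ptT u) ⟨three_bottom (three_slab0.bent_bot h.left (by simp)),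
    C.trans (C.symm (up _)) (C.trans (three_slab0.bent_top h.left (by simp)) (up _)),
    fun r h1 h2 => C.trans (three_closing r) (C.trans (three_slab0.side h.left h1 h2) (up r))⟩
    (Slab.of_bent h.left (by simp) t.1 t.2.1 t.2.2) (Slab.of_straight rfl fun r => E.refl _)
    (Slab.of_straight rfl fun r => E.refl _)

theorem abaRel_001 (h : Adjacent a b m x y) :
    abaRel a b false false true J = openRel u (TanBent m x) J := by
  have t := openRel_tanBent (u := u) (J := J) (p := m) (q := x)
  set E := openRel u (TanBent m x) J
  set C := circles (aba a b u) (abaRes a b false false true J)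
  have up : ∀ r, C (r, ⟨0, by simp⟩) (r, ⟨2, by simp⟩) := fun r =>
    C.trans (three_slab0.straight rfl r) (three_slab1.straight rfl r)
  refine rel3_eq (ptB u) (ptB u) ⟨three_bottom (C.trans (up _)
    (C.trans (three_slab2.bent_bot h.left (by simp)) (C.symm (up _)))),
    three_slab2.bent_top h.left (by simp),
    fun r h1 h2 => C.trans (three_closing r) (C.trans (up r) (three_slab2.side h.left h1 h2))⟩
    (Slab.of_straight rfl fun r => E.refl _) (Slab.of_straight rfl fun r => E.refl _)
    (Slab.of_bent h.left (by simp) t.1 t.2.1 t.2.2)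

theorem abaRel_010 (h : Adjacent a b m x y) :
    abaRel a b false true false J = openRel u (TanBent m y) J := by
  have t := openRel_tanBent (u := u) (J := J) (p := m) (q := y)
  set E := openRel u (TanBent m y) J
  set C := circles (aba a b u) (abaRes a b false true false J)
  have lo : ∀ r, C (r, ⟨0, by simp⟩) (r, ⟨1, by simp⟩) := fun r => three_slab0.straight rfl r
  have up : ∀ r, C (r, ⟨2, by simp⟩) (shift3 (ptT u r)) := fun r => three_slab2.straight rfl r
  refine rel3_eq (ptB u) (ptT u) ⟨three_bottom (C.trans (lo _)
    (C.trans (three_slab1.bent_bot h.right (by simp)) (C.symm (lo _)))),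
    C.trans (C.symm (up _)) (C.trans (three_slab1.bent_top h.right (by simp)) (up _)),
    fun r h1 h2 => C.trans (three_closing r) (C.trans (lo r)
      (C.trans (three_slab1.side h.right h1 h2) (up r)))⟩
    (Slab.of_straight rfl fun r => E.refl _) (Slab.of_bent h.right (by simp) t.1 t.2.1 t.2.2)
    (Slab.of_straight rfl fun r => E.refl _)

theorem abaRel_101 (h : Adjacent a b m x y) :
    abaRel a b true false true J = openRel u (TanBent m x) J := by
  have t := openRel_tanBent (u := u) (J := J) (p := m) (q := x)
  set E := openRel u (TanBent m x) J
  set C := circles (aba a b u) (abaRes a b true false true J)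
  set c : Fin n → Pt u := fun r => if r = m ∨ r = x then ptB u m else ptT u r
  have cm : c m = ptB u m := if_pos (Or.inl rfl)
  have cx : c x = ptB u m := if_pos (Or.inr rfl)
  have cr : ∀ r, r ≠ m → r ≠ x → c r = ptT u r := fun r h1 h2 => if_neg (by tauto)
  refine rel3_eq c c ⟨three_bottom (three_slab0.bent_bot h.left (by simp)),
    three_slab2.bent_top h.left (by simp), fun r h1 h2 => C.trans (three_closing r)
      (C.trans (three_slab0.side h.left h1 h2) (C.trans (three_slab1.straight rfl r)
        (three_slab2.side h.left h1 h2)))⟩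
    (Slab.of_bent h.left (by simp) t.1 (by rw [cm, cx]) fun r h1 h2 => by
      rw [cr r h1 h2]; exact t.2.2 r h1 h2)
    (Slab.of_straight rfl fun r => E.refl _)
    (Slab.of_bent h.left (by simp) (by rw [cm, cx]) t.2.1 fun r h1 h2 => by rw [cr r h1 h2])

theorem abaRel_111 (h : Adjacent a b m x y) :
    abaRel a b true true true J = openRel u (TanBent m x) J := by
  have t := openRel_tanBent (u := u) (J := J) (p := m) (q := x)
  set E := openRel u (TanBent m x) J
  set C := circles (aba a b u) (abaRes a b true true true J)
  set c : Fin n → Pt u := fun r => if r = m ∨ r = x then ptT u y else ptT u r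
  have cm : c m = ptT u y := if_pos (Or.inl rfl)
  have cx : c x = ptT u y := if_pos (Or.inr rfl)
  have cr : ∀ r, r ≠ m → r ≠ x → c r = ptT u r := fun r h1 h2 => if_neg (by tauto)
  have cy : c y = ptT u y := cr y h.right.ne.symm h.ne.symm
  -- The strand `y` zigzags: past the first letter, back at the cap of `b`, through the cup of the
  -- first and the cap of the last letter, and out at the cup of `b`.
  have hy : C (shift3 (ptB u y)) (shift3 (ptT u y)) :=
    C.trans (three_closing y) <| C.trans (three_slab0.side h.left h.right.ne.symm h.ne.symm) <|
    C.trans (C.symm (three_slab1.bent_bot h.right (by simp))) <|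
    C.trans (three_slab0.bent_top h.left (by simp)) <|
    C.trans (three_slab1.side h.right h.left.ne.symm h.ne) <|
    C.trans (C.symm (three_slab2.bent_bot h.left (by simp))) <|
    C.trans (three_slab1.bent_top h.right (by simp))
      (three_slab2.side h.left h.right.ne.symm h.ne.symm)
  refine rel3_eq c c ⟨three_bottom (three_slab0.bent_bot h.left (by simp)),
    three_slab2.bent_top h.left (by simp), fun r h1 h2 => ?_⟩
    (Slab.of_bent h.left (by simp) t.1 (by rw [cm, cx]) fun r h1 h2 => by
      rw [cr r h1 h2]; exact t.2.2 r h1 h2)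
    (Slab.of_bent h.right (by simp) (by rw [cm, cy]) (by rw [cm, cy]) fun r h1 h2 => E.refl _)
    (Slab.of_bent h.left (by simp) (by rw [cm, cx]) t.2.1 fun r h1 h2 => by rw [cr r h1 h2])
  by_cases hr : r = y
  · subst hr; exact hy
  · exact C.trans (three_closing r) (C.trans (three_slab0.side h.left h1 h2)
      (C.trans (three_slab1.side h.right h1 hr) (three_slab2.side h.left h1 h2)))

theorem abaRel_110 (h : Adjacent a b m x y) :
    abaRel a b true true false J = openRel u (TanBent₂ m x y) J := by
  have t := openRel_tanBent₂ (u := u) (J := J) (p := m) (q := x) (r := y)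
  set E := openRel u (TanBent₂ m x y) J
  set C := circles (aba a b u) (abaRes a b true true false J)
  set c : Fin n → Pt u := fun r => if r = m ∨ r = y then ptT u x else ptT u r
  have cm : c m = ptT u x := if_pos (Or.inl rfl)
  have cy : c y = ptT u x := if_pos (Or.inr rfl)
  have cr : ∀ r, r ≠ m → r ≠ y → c r = ptT u r := fun r h1 h2 => if_neg (by tauto)
  have cx : c x = ptT u x := cr x h.left.ne.symm h.ne
  have up : ∀ r, C (r, ⟨2, by simp⟩) (shift3 (ptT u r)) := fun r => three_slab2.straight rfl r
  refine rel3_eq c (ptT u) ⟨three_bottom (three_slab0.bent_bot h.left (by simp)),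
    C.trans (C.symm (up _)) (C.trans (three_slab1.bent_top h.right (by simp)) (up _)), ?_,
    fun r h1 h2 h3 => C.trans (three_closing r) (C.trans (three_slab0.side h.left h1 h2)
      (C.trans (three_slab1.side h.right h1 h3) (up r)))⟩
    (Slab.of_bent h.left (by simp) t.1 (by rw [cm, cx]) fun r h1 h2 => ?_)
    (Slab.of_bent h.right (by simp) (by rw [cm, cy]) t.2.1 fun r h1 h2 => by rw [cr r h1 h2])
    (Slab.of_straight rfl fun r => E.refl _)
  · exact C.trans (three_closing y) <|
      C.trans (three_slab0.side h.left h.right.ne.symm h.ne.symm) <|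
      C.trans (C.symm (three_slab1.bent_bot h.right (by simp))) <|
      C.trans (three_slab0.bent_top h.left (by simp)) <|
      C.trans (three_slab1.side h.right h.left.ne.symm h.ne) (up x)
  · by_cases hr : r = y
    · subst hr; rw [cy]; exact t.2.2.1
    · rw [cr r h1 hr]; exact t.2.2.2 r h1 h2 hr

theorem abaRel_011 (h : Adjacent a b m x y) :
    abaRel a b false true true J = openRel u (TanBent₂ m y x) J := by
  have t := openRel_tanBent₂ (u := u) (J := J) (p := m) (q := y) (r := x)
  set E := openRel u (TanBent₂ m y x) J
  set C := circles (aba a b u) (abaRes a b false true true J)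
  set c : Fin n → Pt u := fun r => if r = m ∨ r = y then ptB u x else ptB u r
  have cm : c m = ptB u x := if_pos (Or.inl rfl)
  have cy : c y = ptB u x := if_pos (Or.inr rfl)
  have cr : ∀ r, r ≠ m → r ≠ y → c r = ptB u r := fun r h1 h2 => if_neg (by tauto)
  have cx : c x = ptB u x := cr x h.left.ne.symm h.ne
  have lo : ∀ r, C (r, ⟨0, by simp⟩) (r, ⟨1, by simp⟩) := fun r => three_slab0.straight rfl r
  refine rel3_eq (ptB u) c ⟨three_bottom (C.trans (lo _)
    (C.trans (three_slab1.bent_bot h.right (by simp)) (C.symm (lo _)))),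
    three_slab2.bent_top h.left (by simp), ?_,
    fun r h1 h2 h3 => C.trans (three_closing r) (C.trans (lo r)
      (C.trans (three_slab1.side h.right h1 h2) (three_slab2.side h.left h1 h3)))⟩
    (Slab.of_straight rfl fun r => E.refl _)
    (Slab.of_bent h.right (by simp) t.1 (by rw [cm, cy]) fun r h1 h2 => by rw [cr r h1 h2])
    (Slab.of_bent h.left (by simp) (by rw [cm, cx]) t.2.1 fun r h1 h2 => ?_)
  · exact C.trans (three_closing x) <| C.trans (lo x) <|
      C.trans (three_slab1.side h.right h.left.ne.symm h.ne) <|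
      C.trans (C.symm (three_slab2.bent_bot h.left (by simp))) <|
      C.trans (three_slab1.bent_top h.right (by simp))
        (three_slab2.side h.left h.right.ne.symm h.ne.symm)
  · by_cases hr : r = y
    · subst hr; rw [cy]; exact t.2.2.1
    · rw [cr r h1 hr]; exact t.2.2.2 r h1 hr h2

theorem aba_cover (h : Adjacent a b m x y) {i j k : Bool} (v : Pt (aba a b u)) :
    (∃ z : Pt u, circles (aba a b u) (abaRes a b i j k J) v (shift3 z)) ∨
      circles (aba a b u) (abaRes a b i j k J) v (m, ⟨1, by simp⟩) := by
  set C := circles (aba a b u) (abaRes a b i j k J)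
  have one : ∀ r, (∃ z : Pt u, C (r, ⟨1, by simp⟩) (shift3 z)) ∨
      C (r, ⟨1, by simp⟩) (m, ⟨1, by simp⟩) := by
    intro r
    have key : C (r, ⟨0, by simp⟩) (r, ⟨1, by simp⟩) →
        (∃ z : Pt u, C (r, ⟨1, by simp⟩) (shift3 z)) := fun h =>
      ⟨ptB u r, C.trans (C.symm h) (C.symm (three_closing r))⟩
    by_cases hi : i = false
    · exact Or.inl (key (three_slab0.straight hi r))
    · by_cases hp : r = m
      · subst hp; exact Or.inr (C.refl _)
      · by_cases hq : r = x
        · subst hq; exact Or.inr (C.symm (three_slab0.bent_top h.left hi))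
        · exact Or.inl (key (three_slab0.side h.left hp hq))
  obtain ⟨r, t, ht⟩ := v
  rcases t with _ | _ | _ | t
  · exact Or.inl ⟨ptB u r, C.symm (three_closing r)⟩
  · exact one r
  · have two : C (r, ⟨2, ht⟩) (x, ⟨2, ht⟩) →
        (∃ z : Pt u, C (r, ⟨2, ht⟩) (shift3 z)) ∨ C (r, ⟨2, ht⟩) (m, ⟨1, by simp⟩) := by
      intro e
      have e' := C.trans e (C.symm (three_slab1.side h.right h.left.ne.symm h.ne))
      exact (one x).imp (fun ⟨z, hz⟩ => ⟨z, C.trans e' hz⟩) fun hz => C.trans e' hz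
    by_cases hk : k = false
    · exact Or.inl ⟨ptT u r, three_slab2.straight hk r⟩
    · by_cases hp : r = m
      · subst hp; exact two (three_slab2.bent_bot h.left hk)
      · by_cases hq : r = x
        · subst hq; exact two (C.refl _)
        · exact Or.inl ⟨ptT u r, three_slab2.side h.left hp hq⟩
  · exact Or.inl ⟨(r, ⟨t, by simpa using ht⟩), C.refl _⟩

/-- Together with `aba_circled`: the resolution 101 is the only one with a circle inside the three
crossings. -/
theorem aba_not_circled (h : Adjacent a b m x y) {i j k : Bool}
    (hb : i = false ∨ j = true ∨ k = false) :
    ∃ z : Pt u, circles (aba a b u) (abaRes a b i j k J) (m, ⟨1, by simp⟩) (shift3 z) := by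
  set C := circles (aba a b u) (abaRes a b i j k J)
  by_cases hi : i = false
  · exact ⟨ptB u m, C.trans (C.symm (three_slab0.straight hi m)) (C.symm (three_closing m))⟩
  · by_cases hj : j = false
    · have hk : k = false := by subst hj; simpa [hi] using hb
      exact ⟨ptT u m, C.trans (three_slab1.straight hj m) (three_slab2.straight hk m)⟩
    · exact ⟨ptB u y, C.trans (three_slab1.bent_bot h.right hj) (C.trans (C.symm
        (three_slab0.side h.left h.right.ne.symm h.ne.symm)) (C.symm (three_closing y)))⟩

theorem aba_circled (h : Adjacent a b m x y) (z : Pt u) :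
    ¬ circles (aba a b u) (abaRes a b true false true J) (shift3 z) (m, ⟨1, by simp⟩) := by
  intro e
  have := three_map (E := ⊥) (c0 := fun _ => False) (c1 := fun r => r = m ∨ r = x)
    (c2 := fun r => r = m ∨ r = x) (g := fun _ => False) (fun _ => rfl)
    (Slab.of_bent h.left (by simp) rfl (by change (_ ∨ _) = (_ ∨ _); simp)
      fun r hr hr' => by change False = (_ ∨ _); simp [hr, hr'])
    (Slab.of_straight rfl fun _ => rfl)
    (Slab.of_bent h.left (by simp) (by change (_ ∨ _) = (_ ∨ _); simp) rfl
      fun r hr hr' => by change (_ ∨ _) = False; simp [hr, hr'])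
    (fun j => ⟨fun _ _ _ => rfl, fun _ => rfl, fun _ => rfl, fun _ => rfl, fun _ => rfl⟩) e
  change False = (m = m ∨ m = x) at this
  simp at this

end Braid

end BraidKh

/-! ### The differential at the eight resolutions of `a b a u`. -/

namespace BraidKh

open FiltOps

variable {n : ℕ}

theorem theta_comm {V N : Type*} [AddCommGroup N] [Module (ZMod 2) N] {O : FiltOps V N}
    (E : Setoid V) (p q : V) (m : N) : O.theta E p q m = O.theta E q p m := by
  by_cases e : E p q
  · rw [theta_of e, theta_of (E.symm e), add_comm]
  · rw [theta_of_not e, theta_of_not fun k => e (E.symm k)]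

section Braid

variable {a b : Fin (n - 1)} {m x y : Fin n} {u : BraidWord n} {J : Resolution u}

/-- The circles of a resolution of `a b a u`. -/
abbrev abaCirc (a b : Fin (n - 1)) (i j k : Bool) (J : Resolution u) :
    Setoid (Pt (aba a b u)) := circles (aba a b u) (abaRes a b i j k J)

/-- The operators at the points of `u` on the complex of `a b a u`. -/
abbrev abaOps (a b : Fin (n - 1)) (u : BraidWord n) : FiltOps (Pt u) (CKh (aba a b u)) :=
  (khOps (aba a b u)).comap shift3

theorem aba_saddle0 {s t : Fin n} (hs : Strands (a, true) s t) (j k : Bool) :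
    Saddle (abaCirc a b false j k J) (abaCirc a b true j k J) (s, ⟨0, by simp⟩)
      (t, ⟨1, by simp⟩) := by
  have h := saddle_strands (w := aba a b u) (I := abaRes a b false j k J) (j := ⟨0, by simp⟩) hs rfl
  rwa [update_res3_zero] at h

theorem aba_saddle1 {s t : Fin n} (hs : Strands (b, true) s t) (i k : Bool) :
    Saddle (abaCirc a b i false k J) (abaCirc a b i true k J) (s, ⟨1, by simp⟩)
      (t, ⟨2, by simp⟩) := by
  have h := saddle_strands (w := aba a b u) (I := abaRes a b i false k J) (j := ⟨1, by simp⟩) hs rfl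
  rwa [update_res3_one] at h

theorem aba_saddle2 {s t : Fin n} (hs : Strands (a, true) s t) (i j : Bool) :
    Saddle (abaCirc a b i j false J) (abaCirc a b i j true J) (s, ⟨2, by simp⟩)
      (shift3 (ptT u t)) := by
  have h := saddle_strands (w := aba a b u) (I := abaRes a b i j false J) (j := ⟨2, by simp⟩) hs rfl
  rwa [update_res3_two] at h


/-- The corners at the crossing are moved along their circles, in both resolutions, to points of
`u`. Then the edge map is written with operators at outer points; likewise for the other edges
below. -/
theorem aba_edge0 (h : Adjacent a b m x y) : Saddle (abaCirc a b false false false J)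
    (abaCirc a b true false false J) (shift3 (ptB u x)) (shift3 (ptT u m)) :=
  have e : ∀ i, abaCirc a b i false false J (m, ⟨1, by simp⟩) (shift3 (ptT u m)) := fun _ =>
    (circles _ _).trans (three_slab1.straight rfl m) (three_slab2.straight rfl m)
  (aba_saddle0 h.left.symm false false).congr ((circles _ _).symm (three_closing x)) (e _)
    ((circles _ _).symm (three_closing x)) (e _)

theorem aba_edge0' (h : Adjacent a b m x y) (k : Bool) : Saddle (abaCirc a b false true k J)
    (abaCirc a b true true k J) (shift3 (ptB u x)) (shift3 (ptB u y)) :=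
  have e : ∀ i, abaCirc a b i true k J (m, ⟨1, by simp⟩) (shift3 (ptB u y)) := fun _ =>
    (circles _ _).trans (three_slab1.bent_bot h.right (by simp)) <| (circles _ _).trans
      ((circles _ _).symm (three_slab0.side h.left h.right.ne.symm h.ne.symm))
      ((circles _ _).symm (three_closing y))
  (aba_saddle0 h.left.symm true k).congr ((circles _ _).symm (three_closing x)) (e _)
    ((circles _ _).symm (three_closing x)) (e _)

theorem aba_edge2 (h : Adjacent a b m x y) : Saddle (abaCirc a b false false false J)
    (abaCirc a b false false true J) (shift3 (ptB u x)) (shift3 (ptT u m)) :=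
  have e : ∀ k, abaCirc a b false false k J (x, ⟨2, by simp⟩) (shift3 (ptB u x)) := fun _ =>
    (circles _ _).symm <| (circles _ _).trans (three_closing x) <|
      (circles _ _).trans (three_slab0.straight rfl x) (three_slab1.straight rfl x)
  (aba_saddle2 h.left.symm false false).congr (e _) ((circles _ _).refl _) (e _)
    ((circles _ _).refl _)

theorem aba_edge2' (h : Adjacent a b m x y) (i : Bool) : Saddle (abaCirc a b i true false J)
    (abaCirc a b i true true J) (shift3 (ptT u y)) (shift3 (ptT u x)) :=
  have e : ∀ k, abaCirc a b i true k J (m, ⟨2, by simp⟩) (shift3 (ptT u y)) := fun _ =>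
    (circles _ _).trans (three_slab1.bent_top h.right (by simp))
      (three_slab2.side h.left h.right.ne.symm h.ne.symm)
  (aba_saddle2 h.left i true).congr (e _) ((circles _ _).refl _) (e _) ((circles _ _).refl _)

theorem aba_edge1 (h : Adjacent a b m x y) : Saddle (abaCirc a b false false false J)
    (abaCirc a b false true false J) (shift3 (ptB u y)) (shift3 (ptT u m)) :=
  have e1 : ∀ j, abaCirc a b false j false J (y, ⟨1, by simp⟩) (shift3 (ptB u y)) := fun _ =>
    (circles _ _).symm <| (circles _ _).trans (three_closing y) (three_slab0.straight rfl y)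
  have e2 : ∀ j, abaCirc a b false j false J (m, ⟨2, by simp⟩) (shift3 (ptT u m)) := fun _ =>
    three_slab2.straight rfl m
  (aba_saddle1 h.right.symm false false).congr (e1 _) (e2 _) (e1 _) (e2 _)

theorem aba_edge1_top (h : Adjacent a b m x y) : Saddle (abaCirc a b true false false J)
    (abaCirc a b true true false J) (shift3 (ptT u x)) (shift3 (ptT u y)) :=
  have e1 : ∀ j, abaCirc a b true j false J (m, ⟨1, by simp⟩) (shift3 (ptT u x)) := fun _ =>
    (circles _ _).trans (three_slab0.bent_top h.left (by simp)) <| (circles _ _).trans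
      (three_slab1.side h.right h.left.ne.symm h.ne) (three_slab2.straight rfl x)
  have e2 : ∀ j, abaCirc a b true j false J (y, ⟨2, by simp⟩) (shift3 (ptT u y)) := fun _ =>
    three_slab2.straight rfl y
  (aba_saddle1 h.right true false).congr (e1 _) (e2 _) (e1 _) (e2 _)

theorem aba_edge1_bottom (h : Adjacent a b m x y) : Saddle (abaCirc a b false false true J)
    (abaCirc a b false true true J) (shift3 (ptB u y)) (shift3 (ptB u x)) :=
  have e1 : ∀ j, abaCirc a b false j true J (y, ⟨1, by simp⟩) (shift3 (ptB u y)) := fun _ =>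
    (circles _ _).symm <| (circles _ _).trans (three_closing y) (three_slab0.straight rfl y)
  have e2 : ∀ j, abaCirc a b false j true J (m, ⟨2, by simp⟩) (shift3 (ptB u x)) := fun _ =>
    (circles _ _).trans (three_slab2.bent_bot h.left (by simp)) <| (circles _ _).symm <|
    (circles _ _).trans (three_closing x) <| (circles _ _).trans (three_slab0.straight rfl x)
      (three_slab1.side h.right h.left.ne.symm h.ne)
  (aba_saddle1 h.right.symm false true).congr (e1 _) (e2 _) (e1 _) (e2 _)

theorem aba_comap {i j k i' j' k' : Bool} {v v' : Pt u}
    (h : Saddle (abaCirc a b i j k J) (abaCirc a b i' j' k' J) (shift3 v) (shift3 v')) :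
    Saddle (abaRel a b i j k J) (abaRel a b i' j' k' J) v v' :=
  h.comap shift3 ((circles _ _).refl _) ((circles _ _).refl _) ((circles _ _).refl _)
    ((circles _ _).refl _)

theorem saddle_bent_top (h : Adjacent a b m x y) : Saddle (openRel u (TanBent m x) J)
    (openRel u (TanBent₂ m x y) J) (ptT u x) (ptT u y) := by
  rw [← abaRel_100 h, ← abaRel_110 h]
  exact aba_comap (aba_edge1_top h)

theorem saddle_bent_bottom (h : Adjacent a b m x y) : Saddle (openRel u (TanBent m x) J)
    (openRel u (TanBent₂ m y x) J) (ptB u x) (ptB u y) := by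
  rw [← abaRel_001 h, ← abaRel_011 h]
  exact (aba_comap (aba_edge1_bottom h)).swap

theorem theta_shift3 {i j k : Bool} {R : Setoid (Pt u)} (h : abaRel a b i j k J = R)
    (v v' : Pt u) (μ) : (khOps (aba a b u)).theta (abaCirc a b i j k J) (shift3 v) (shift3 v') μ =
      (abaOps a b u).theta R v v' μ := by
  rw [← h]
  exact (theta_comap shift3 _ _ _ _).symm

theorem aba_dEdge0 {j k : Bool} {v v' : Pt u} {R : Setoid (Pt u)}
    (hR : abaRel a b false j k J = R)
    (hs : Saddle (abaCirc a b false j k J) (abaCirc a b true j k J) (shift3 v) (shift3 v')) :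
    dEdge (abaRes a b false j k J) ⟨0, by simp⟩ =
      (abaOps a b u).theta R v v' (vac (abaRes a b true j k J)) := by
  rw [dEdge_eq rfl (by rw [update_res3_zero]; exact hs), update_res3_zero]
  exact theta_shift3 hR _ _ _

theorem aba_dEdge1 {i k : Bool} {v v' : Pt u} {R : Setoid (Pt u)}
    (hR : abaRel a b i false k J = R)
    (hs : Saddle (abaCirc a b i false k J) (abaCirc a b i true k J) (shift3 v) (shift3 v')) :
    dEdge (abaRes a b i false k J) ⟨1, by simp⟩ =
      (abaOps a b u).theta R v v' (vac (abaRes a b i true k J)) := by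
  rw [dEdge_eq rfl (by rw [update_res3_one]; exact hs), update_res3_one]
  exact theta_shift3 hR _ _ _

theorem aba_dEdge2 {i j : Bool} {v v' : Pt u} {R : Setoid (Pt u)}
    (hR : abaRel a b i j false J = R)
    (hs : Saddle (abaCirc a b i j false J) (abaCirc a b i j true J) (shift3 v) (shift3 v')) :
    dEdge (abaRes a b i j false J) ⟨2, by simp⟩ =
      (abaOps a b u).theta R v v' (vac (abaRes a b i j true J)) := by
  rw [dEdge_eq rfl (by rw [update_res3_two]; exact hs), update_res3_two]
  exact theta_shift3 hR _ _ _

theorem d_aba {i j k : Bool} {R : Resolution u → Setoid (Pt u)} {t0 t1 t2 : CKh (aba a b u)}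
    (hR : ∀ J, abaRel a b i j k J = R J) (h0 : dEdge (abaRes a b i j k J) ⟨0, by simp⟩ = t0)
    (h1 : dEdge (abaRes a b i j k J) ⟨1, by simp⟩ = t1)
    (h2 : dEdge (abaRes a b i j k J) ⟨2, by simp⟩ = t2) :
    d (aba a b u) (vac (abaRes a b i j k J)) =
      t0 + (t1 + (t2 + outD (abaOps a b u) R (fun J => vac (abaRes a b i j k J)) J)) := by
  rw [← h0, ← h1, ← h2, ← show (abaRel a b i j k : Resolution u → _) = R from funext hR]
  exact d_res3

theorem d_aba_000 (h : Adjacent a b m x y) : d (aba a b u) (vac (abaRes a b false false false J)) =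
    (abaOps a b u).theta (circles u J) (ptB u x) (ptT u m) (vac (abaRes a b true false false J)) +
    ((abaOps a b u).theta (circles u J) (ptB u y) (ptT u m) (vac (abaRes a b false true false J)) +
    ((abaOps a b u).theta (circles u J) (ptB u x) (ptT u m) (vac (abaRes a b false false true J)) +
    outD (abaOps a b u) (circles u) (fun J => vac (abaRes a b false false false J)) J)) :=
  d_aba (fun _ => abaRel_id) (aba_dEdge0 abaRel_id (aba_edge0 h))
    (aba_dEdge1 abaRel_id (aba_edge1 h)) (aba_dEdge2 abaRel_id (aba_edge2 h))

theorem d_aba_010 (h : Adjacent a b m x y) : d (aba a b u) (vac (abaRes a b false true false J)) =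
    (abaOps a b u).theta (openRel u (TanBent m y) J) (ptB u x) (ptB u y)
      (vac (abaRes a b true true false J)) +
    ((abaOps a b u).theta (openRel u (TanBent m y) J) (ptT u y) (ptT u x)
      (vac (abaRes a b false true true J)) +
    outD (abaOps a b u) (fun J => openRel u (TanBent m y) J)
      (fun J => vac (abaRes a b false true false J)) J) :=
  (d_aba (fun _ => abaRel_010 h) (aba_dEdge0 (abaRel_010 h) (aba_edge0' h _))
    (dEdge_of_true rfl) (aba_dEdge2 (abaRel_010 h) (aba_edge2' h _))).trans
      (congrArg _ (zero_add _))

theorem d_aba_110 (h : Adjacent a b m x y) : d (aba a b u) (vac (abaRes a b true true false J)) =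
    (abaOps a b u).theta (openRel u (TanBent₂ m x y) J) (ptT u y) (ptT u x)
      (vac (abaRes a b true true true J)) +
    outD (abaOps a b u) (fun J => openRel u (TanBent₂ m x y) J)
      (fun J => vac (abaRes a b true true false J)) J :=
  (d_aba (fun _ => abaRel_110 h) (dEdge_of_true rfl) (dEdge_of_true rfl)
    (aba_dEdge2 (abaRel_110 h) (aba_edge2' h _))).trans
      ((zero_add _).trans (zero_add _))

theorem d_aba_011 (h : Adjacent a b m x y) : d (aba a b u) (vac (abaRes a b false true true J)) =
    (abaOps a b u).theta (openRel u (TanBent₂ m y x) J) (ptB u x) (ptB u y)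
      (vac (abaRes a b true true true J)) +
    outD (abaOps a b u) (fun J => openRel u (TanBent₂ m y x) J)
      (fun J => vac (abaRes a b false true true J)) J :=
  (d_aba (fun _ => abaRel_011 h) (aba_dEdge0 (abaRel_011 h) (aba_edge0' h _)) (dEdge_of_true rfl)
    (dEdge_of_true rfl)).trans (congrArg _ ((zero_add _).trans (zero_add _)))

theorem d_aba_111 (h : Adjacent a b m x y) : d (aba a b u) (vac (abaRes a b true true true J)) =
    outD (abaOps a b u) (fun J => openRel u (TanBent m x) J)
      (fun J => vac (abaRes a b true true true J)) J :=
  (d_aba (fun _ => abaRel_111 h) (dEdge_of_true rfl) (dEdge_of_true rfl)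
    (dEdge_of_true rfl)).trans ((zero_add _).trans ((zero_add _).trans (zero_add _)))

/-- The middle circle meets no point of `u`, so changing the crossing `b` merges it with an outer
circle and the saddle map is the identity. This is the first isomorphism that the braid move
eliminates. -/
theorem d_aba_101 (h : Adjacent a b m x y) : d (aba a b u) (vac (abaRes a b true false true J)) =
    vac (abaRes a b true true true J) +
    outD (abaOps a b u) (fun J => openRel u (TanBent m x) J)
      (fun J => vac (abaRes a b true false true J)) J := by
  refine (d_aba (t1 := vac (abaRes a b true true true J)) (fun _ => abaRel_101 h)
    (dEdge_of_true rfl) ?_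
    (dEdge_of_true rfl)).trans ((zero_add _).trans (congrArg _ (zero_add _)))
  rw [dEdge_eq rfl (by rw [update_res3_one]; exact aba_saddle1 h.right true true),
    update_res3_one]
  refine theta_of_not (fun e => aba_circled (J := J) h (ptT u y) ?_) _
  exact (circles _ _).symm ((circles _ _).trans e
    (three_slab2.side h.left h.right.ne.symm h.ne.symm))

/-- A point on the middle circle. -/
abbrev abaMid (a b : Fin (n - 1)) (m : Fin n) (u : BraidWord n) : Pt (aba a b u) :=
  (m, ⟨1, by simp⟩)

/-- The term with the operator at `abaMid` splits off the middle circle with label v₋. It is the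
second isomorphism that the braid move eliminates. -/
theorem d_aba_100 (h : Adjacent a b m x y) : d (aba a b u) (vac (abaRes a b true false false J)) =
    (abaOps a b u).theta (openRel u (TanBent m x) J) (ptT u x) (ptT u y)
      (vac (abaRes a b true true false J)) +
    (((khOps (aba a b u)).X (abaMid a b m u) (vac (abaRes a b true false true J)) +
      (abaOps a b u).X (ptT u x) (vac (abaRes a b true false true J))) +
    outD (abaOps a b u) (fun J => openRel u (TanBent m x) J)
      (fun J => vac (abaRes a b true false false J)) J) := by
  refine (d_aba (fun _ => abaRel_100 h) (dEdge_of_true rfl)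
    (aba_dEdge1 (abaRel_100 h) (aba_edge1_top h)) ?_).trans (zero_add _)
  have e : abaCirc a b true false false J (m, ⟨2, by simp⟩) (shift3 (ptT u x)) :=
    (circles _ _).trans ((circles _ _).symm (three_slab1.straight rfl m)) <|
    (circles _ _).trans (three_slab0.bent_top h.left (by simp)) <|
    (circles _ _).trans (three_slab1.straight rfl x) (three_slab2.straight rfl x)
  have e' : abaCirc a b true false true J (m, ⟨2, by simp⟩) (abaMid a b m u) :=
    (circles _ _).symm (three_slab1.straight rfl m)
  rw [dEdge_eq rfl (by rw [update_res3_two]; exact aba_saddle2 h.left true false),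
    update_res3_two]
  refine (theta_of e _).trans ?_
  rw [vac_compat _ _ _ e']
  rfl

theorem d_aba_001 (h : Adjacent a b m x y) : d (aba a b u) (vac (abaRes a b false false true J)) =
    ((khOps (aba a b u)).X (abaMid a b m u) (vac (abaRes a b true false true J)) +
      (abaOps a b u).X (ptB u x) (vac (abaRes a b true false true J))) +
    ((abaOps a b u).theta (openRel u (TanBent m x) J) (ptB u y) (ptB u x)
      (vac (abaRes a b false true true J)) +
    outD (abaOps a b u) (fun J => openRel u (TanBent m x) J)
      (fun J => vac (abaRes a b false false true J)) J) := by
  refine (d_aba (fun _ => abaRel_001 h) ?_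
    (aba_dEdge1 (abaRel_001 h) (aba_edge1_bottom h)) (dEdge_of_true rfl)).trans
      (congrArg _ (congrArg _ (zero_add _)))
  have e : abaCirc a b false false true J (x, ⟨0, by simp⟩) (m, ⟨1, by simp⟩) :=
    (circles _ _).trans (three_slab0.straight rfl x) <|
    (circles _ _).trans (three_slab1.straight rfl x) <|
    (circles _ _).trans ((circles _ _).symm (three_slab2.bent_bot h.left (by simp)))
      ((circles _ _).symm (three_slab1.straight rfl m))
  have e' : abaCirc a b true false true J (x, ⟨0, by simp⟩) (shift3 (ptB u x)) :=
    (circles _ _).symm (three_closing x)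
  rw [dEdge_eq rfl (by rw [update_res3_zero]; exact aba_saddle0 h.left.symm false true),
    update_res3_zero]
  refine (theta_of e _).trans ?_
  rw [vac_compat _ _ _ e', add_comm]
  rfl

end Braid

end BraidKh

/-! ### The chain map for the braid relation. -/

namespace BraidKh

open FiltOps

variable {n : ℕ}

section Braid

variable {a b : Fin (n - 1)} {m x y : Fin n} {u : BraidWord n} {J : Resolution u}

theorem bent_outSaddle (h : Adjacent a b m x y) :
    OutSaddle (fun J => openRel u (TanBent m x) J) := by
  rw [← show (abaRel a b true false false : Resolution u → _) =
    (fun J => openRel u (TanBent m x) J) from funext fun J => abaRel_100 h]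
  exact rel3_outSaddle

theorem bent₂_outSaddle (h : Adjacent a b m x y) :
    OutSaddle (fun J => openRel u (TanBent₂ m x y) J) := by
  rw [← show (abaRel a b true true false : Resolution u → _) =
    (fun J => openRel u (TanBent₂ m x y) J) from funext fun J => abaRel_110 h]
  exact rel3_outSaddle

theorem braidlike_aba : braidlike (aba a b u) = abaRes a b false false false (braidlike u) := by
  funext j
  obtain ⟨j, hj⟩ := j
  rcases j with _ | _ | _ | j <;> rfl

/-- The image of the resolution `110` under the braid move. -/
def braidY (a b : Fin (n - 1)) (m x y : Fin n) (J : Resolution u) : CKh (aba b a u) :=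
  -- The correction at 101 makes the component of the boundary at 111 cancel, because the boundary
  -- of `vac` at 101 starts with `vac` at 111.
  vac (abaRes b a false true true J) +
    (abaOps b a u).theta (openRel u (TanBent₂ m x y) J) (ptB u y) (ptB u x)
      (vac (abaRes b a true false true J))

/-- The image of the resolution `011` under the braid move. -/
def braidZ (a b : Fin (n - 1)) (m x y : Fin n) (J : Resolution u) : CKh (aba b a u) :=
  vac (abaRes b a true true false J) +
    (abaOps b a u).theta (openRel u (TanBent₂ m y x) J) (ptT u x) (ptT u y)
      (vac (abaRes b a true false true J))

/-- The values of the braid move on the vectors with all labels `v₊`. -/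
def braidVal (a b : Fin (n - 1)) (m x y : Fin n) : Bool → Bool → Bool → Resolution u →
    CKh (aba b a u)
  -- Each resolution goes to resolutions of `b a b u` with the same connections outside: 001 bends
  -- the strands of `a`, as 010 does in the other word.
  | false, false, false, J => vac (abaRes b a false false false J)
  | false, false, true, J => vac (abaRes b a false true false J)
  -- Both 100 and 001 of the other word bend the strands of `b`. Only in the boundary of their sum
  -- do the terms with v₋ on the middle circle cancel.
  | false, true, false, J => vac (abaRes b a true false false J) + vac (abaRes b a false false true J)
  | true, true, false, J => braidY a b m x y J
  | false, true, true, J => braidZ a b m x y J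
  -- The resolutions 100, 101 and 111 take part in the elimination.
  | _, _, _, _ => 0

/-- The values of the braid move on the vectors with label `v₋` on the middle circle. -/
def braidVal' (a b : Fin (n - 1)) (m x y : Fin n) : Bool → Bool → Bool → Resolution u →
    CKh (aba b a u)
  -- Forced by the value zero at 100, whose boundary contains the middle circle labeled v₋ and the
  -- saddle to 110.
  | true, false, true, J =>
    (abaOps b a u).theta (openRel u (TanBent m x) J) (ptT u x) (ptT u y) (braidY a b m x y J)
  | _, _, _, _ => 0

theorem d_braidY (h : Adjacent a b m x y) : d (aba b a u) (braidY a b m x y J) =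
    outD (abaOps b a u) (fun J => openRel u (TanBent₂ m x y) J) (braidY a b m x y) J := by
  unfold braidY
  rw [map_add, d_theta_comap, d_aba_011 h.symm, d_aba_101 h.symm, map_add, outD_add,
    outD_theta (bent₂_outSaddle h) (bent_outSaddle h.symm)
      (fun J => (saddle_bent_bottom h.symm).symm) fun J => by
        rw [← abaRel_101 h.symm]; exact rel3_adm.compat]
  rw [add_add_add_comm, add_self_zmod2, zero_add]

theorem d_braidZ (h : Adjacent a b m x y) : d (aba b a u) (braidZ a b m x y J) =
    outD (abaOps b a u) (fun J => openRel u (TanBent₂ m y x) J) (braidZ a b m x y) J := by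
  unfold braidZ
  rw [map_add, d_theta_comap, d_aba_110 h.symm, d_aba_101 h.symm, map_add, outD_add,
    outD_theta (bent₂_outSaddle h.symm) (bent_outSaddle h.symm)
      (fun J => (saddle_bent_top h.symm).symm.swap) fun J => by
        rw [← abaRel_101 h.symm]; exact rel3_adm.compat]
  rw [add_add_add_comm, add_self_zmod2, zero_add]

/-- The chain map equation at 010. The corrections in `braidY` and `braidZ` yield a saddle followed
by its reverse, that is, sums of operators at the bottom and at the top points. The points `x` at
bottom and top lie on one circle and cancel; what is left are the outer terms in the boundaries of
100 and 001. -/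
theorem braid_middle (h : Adjacent a b m x y) :
    (abaOps b a u).theta (openRel u (TanBent m y) J) (ptB u x) (ptB u y) (braidY a b m x y J) +
      ((abaOps b a u).theta (openRel u (TanBent m y) J) (ptT u y) (ptT u x) (braidZ a b m x y J) +
      outD (abaOps b a u) (fun J => openRel u (TanBent m y) J)
        (fun J => vac (abaRes b a true false false J) + vac (abaRes b a false false true J)) J) =
    d (aba b a u) (vac (abaRes b a true false false J) + vac (abaRes b a false false true J)) := by
  have hc : (abaOps b a u).Compat (openRel u (TanBent m y) J)
      (vac (abaRes b a true false true J)) := by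
    rw [← abaRel_101 h.symm]; exact rel3_adm.compat
  have e1 : (abaOps b a u).theta (openRel u (TanBent m y) J) (ptB u x) (ptB u y)
      ((abaOps b a u).theta (openRel u (TanBent₂ m x y) J) (ptB u y) (ptB u x)
      (vac (abaRes b a true false true J))) = _ :=
    (theta_comm _ _ _ _).trans (theta_reverse (saddle_bent_bottom h.symm) _)
  have e2 : (abaOps b a u).theta (openRel u (TanBent m y) J) (ptT u y) (ptT u x)
      ((abaOps b a u).theta (openRel u (TanBent₂ m y x) J) (ptT u x) (ptT u y)
      (vac (abaRes b a true false true J))) = _ :=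
    (theta_comm _ _ _ _).trans (theta_reverse (saddle_bent_top h.symm).swap _)
  have e3 := hc (ptB u x) (ptT u x) (openRel_tanBent.2.2 x h.left.ne.symm h.ne)
  rw [map_add, d_aba_100 h.symm, d_aba_001 h.symm, outD_add]
  unfold braidY braidZ
  rw [map_add, map_add, e1, e2, e3]
  generalize (abaOps b a u).X (ptB u y) (vac (abaRes b a true false true J)) = p1
  generalize (abaOps b a u).X (ptT u y) (vac (abaRes b a true false true J)) = p2
  generalize (abaOps b a u).X (ptT u x) (vac (abaRes b a true false true J)) = p3
  generalize (khOps (aba b a u)).X (abaMid b a m u) (vac (abaRes b a true false true J)) = p4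
  have z3 := add_self_zmod2 p3
  have z4 := add_self_zmod2 p4
  generalize outD (abaOps b a u) _ _ J = q1
  generalize outD (abaOps b a u) _ _ J = q2
  generalize (abaOps b a u).theta _ _ _ _ = q3
  generalize (abaOps b a u).theta _ _ _ _ = q4
  rw [← sub_eq_zero]
  have z : q3 + (p1 + p3) + (q4 + (p3 + p2) + (q1 + q2)) -
    (q4 + (p4 + p2 + q1) + (p4 + p1 + (q3 + q2))) = (p3 + p3) - (p4 + p4) := by abel
  rw [z, z3, z4, sub_zero]

/-- The chain map equation at 001. The two corrections at 101 are the two ways around a square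
formed by a saddle at the top and a saddle at the bottom, so they are equal and cancel. -/
theorem braid_top (h : Adjacent a b m x y) :
    (abaOps b a u).theta (openRel u (TanBent m x) J) (ptT u x) (ptT u y) (braidY a b m x y J) +
    ((abaOps b a u).theta (openRel u (TanBent m x) J) (ptB u y) (ptB u x) (braidZ a b m x y J) +
      outD (abaOps b a u) (fun J => openRel u (TanBent m x) J)
        (fun J => vac (abaRes b a false true false J)) J) =
    d (aba b a u) (vac (abaRes b a false true false J)) := by
  have hc : (abaOps b a u).Compat (openRel u (TanBent m y) J)
      (vac (abaRes b a true false true J)) := by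
    rw [← abaRel_101 h.symm]; exact rel3_adm.compat
  have e := hc.face (saddle_bent_top h) (saddle_bent_bottom h.symm).symm
    (saddle_bent_bottom h).swap (saddle_bent_top h.symm).symm.swap
  rw [d_aba_010 h.symm]
  unfold braidY braidZ
  rw [map_add, map_add, e]
  generalize (abaOps b a u).theta _ _ _ ((abaOps b a u).theta _ _ _ _) = p
  have z := add_self_zmod2 p
  generalize outD (abaOps b a u) _ _ J = q1
  generalize (abaOps b a u).theta _ _ _ _ = q2
  generalize (abaOps b a u).theta _ _ _ _ = q3
  rw [← sub_eq_zero]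
  have z' : q2 + p + (q3 + p + q1) - (q3 + (q2 + q1)) = p + p := by abel
  rw [z', z]

/-- The braid move. -/
def FMap.braid (h : Adjacent a b m x y) (u : BraidWord n) : FMap (aba a b u) (aba b a u) :=
  let A : Outer (aba a b u) (Pt u) := ⟨shift3, ptB u, fun _ => abaMid a b m u,
    fun _ p => circles_closing p, fun I v => by
      obtain ⟨i, j, k, J, rfl⟩ := eq_res3 I
      exact aba_cover h v⟩
  let n0 : Resolution (aba a b u) → CKh (aba b a u) := fun I =>
    braidVal a b m x y (I ⟨0, by simp⟩) (I ⟨1, by simp⟩) (I ⟨2, by simp⟩)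
      fun j => I j.succ.succ.succ
  let n1 : Resolution (aba a b u) → CKh (aba b a u) := fun I =>
    braidVal' a b m x y (I ⟨0, by simp⟩) (I ⟨1, by simp⟩) (I ⟨2, by simp⟩)
      fun j => I j.succ.succ.succ
  have v0 : ∀ i j k J, n0 (abaRes a b i j k J) = braidVal a b m x y i j k J := fun _ _ _ _ => rfl
  have v1 : ∀ i j k J, n1 (abaRes a b i j k J) = braidVal' a b m x y i j k J := fun _ _ _ _ => rfl
  have hv : ∀ {i j k J} {R : Setoid (Pt u)}, abaRel b a i j k J = R →
      (abaOps b a u).Adm A.cl R (vac (abaRes b a i j k J)) := fun e => by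
    rw [← e]; exact rel3_adm
  have hY : ∀ J, (abaOps b a u).Adm A.cl (openRel u (TanBent₂ m x y) J) (braidY a b m x y J) :=
    fun J => (hv (abaRel_011 h.symm)).add
      ((hv (abaRel_101 h.symm)).theta (saddle_bent_bottom h.symm).symm)
  have hZ : ∀ J, (abaOps b a u).Adm A.cl (openRel u (TanBent₂ m y x) J) (braidZ a b m x y J) :=
    fun J => (hv (abaRel_110 h.symm)).add
      ((hv (abaRel_101 h.symm)).theta (saddle_bent_top h.symm).symm.swap)
  have h0 : ∀ I, (abaOps b a u).Adm A.cl (A.rel I) (n0 I) := fun I => by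
    obtain ⟨i, j, k, J, rfl⟩ := eq_res3 I
    rw [v0]
    change (abaOps b a u).Adm A.cl (abaRel a b i j k J) _
    cases i <;> cases j <;> cases k
    · rw [abaRel_id]; exact hv abaRel_id
    · rw [abaRel_001 h]; exact hv (abaRel_010 h.symm)
    · rw [abaRel_010 h]; exact (hv (abaRel_100 h.symm)).add (hv (abaRel_001 h.symm))
    · rw [abaRel_011 h]; exact hZ J
    · exact Adm.zero
    · exact Adm.zero
    · rw [abaRel_110 h]; exact hY J
    · exact Adm.zero
  have h1 : ∀ I, (abaOps b a u).Adm A.cl (A.rel I) (n1 I) := fun I => by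
    obtain ⟨i, j, k, J, rfl⟩ := eq_res3 I
    rw [v1]
    change (abaOps b a u).Adm A.cl (abaRel a b i j k J) _
    cases i <;> cases j <;> cases k
    any_goals exact Adm.zero
    rw [abaRel_101 h]; exact (hY J).theta (saddle_bent_top h)
  have c0 := fun I => (h0 I).compat
  have c1 := fun I => (h1 I).compat
  A.fmap shift3 n0 n1 h0 h1
    (fun I => by
      obtain ⟨i, j, k, J, rfl⟩ := eq_res3 I
      have hout : ∀ i j k (R : Resolution u → Setoid (Pt u)),
          A.lift (abaOps b a u) n0 n1 (outD (abaOps a b u) R (fun J => vac (abaRes a b i j k J)) J) =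
          outD (abaOps b a u) R (braidVal a b m x y i j k) J := fun i j k R =>
        (A.lift_outD c0 c1 _ _ _).trans (outD_congr fun J => (A.lift_vac c0 _).trans (v0 i j k J))
      have hth : ∀ (R : Setoid (Pt u)) (p q : Pt u) i j k,
          A.lift (abaOps b a u) n0 n1 ((abaOps a b u).theta R p q (vac (abaRes a b i j k J))) =
          (abaOps b a u).theta R p q (braidVal a b m x y i j k J) := fun R p q i j k =>
        (A.lift_theta c0 c1 _ _ _ _).trans (congrArg _ ((A.lift_vac c0 _).trans (v0 i j k J)))
      have hlv : ∀ i j k, A.lift (abaOps b a u) n0 n1 (vac (abaRes a b i j k J)) =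
          braidVal a b m x y i j k J := fun i j k => (A.lift_vac c0 _).trans (v0 i j k J)
      have hX : ∀ p, A.lift (abaOps b a u) n0 n1
          ((abaOps a b u).X p (vac (abaRes a b true false true J))) = 0 := fun p =>
        (A.lift_X c0 c1 _ _).trans ((congrArg _ (hlv true false true)).trans (map_zero _))
      have hM : A.lift (abaOps b a u) n0 n1
          ((khOps (aba a b u)).X (abaMid a b m u) (vac (abaRes a b true false true J))) =
          braidVal' a b m x y true false true J :=
        (A.lift_mid c1 (I := abaRes a b true false true J) (aba_circled h)).trans (v1 _ _ _ _)
      change A.lift (abaOps b a u) n0 n1 (d (aba a b u) (vac (abaRes a b i j k J))) =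
        d (aba b a u) (braidVal a b m x y i j k J)
      cases i <;> cases j <;> cases k
      · rw [d_aba_000 h, map_add, map_add, map_add, hth, hth, hth, hout]
        simp only [braidVal, map_zero, map_add]
        rw [d_aba_000 h.symm]
        abel
      · rw [d_aba_001 h, map_add, map_add, map_add, hM, hX, hth, hout, add_zero]
        exact braid_top h
      · rw [d_aba_010 h, map_add, map_add, hth, hth, hout]
        exact braid_middle h
      · rw [d_aba_011 h, map_add, hth, hout]
        simp only [braidVal, map_zero, zero_add]
        exact (d_braidZ h).symm
      -- The image of the middle circle labeled v₋ was chosen to cancel the image of the term at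
      -- 110.
      · rw [d_aba_100 h, map_add, map_add, map_add, hM, hX, hth, hout, add_zero, ← add_assoc]
        refine (congrArg₂ (· + ·) (add_self_zmod2 _) (outD_zero)).trans ?_
        rw [add_zero]; exact (map_zero _).symm
      · rw [d_aba_101 h, map_add, hlv, hout]
        exact (congrArg₂ (· + ·) rfl outD_zero).trans ((add_zero _).trans (map_zero _).symm)
      · rw [d_aba_110 h, map_add, hth, hout]
        simp only [braidVal, map_zero, zero_add]
        exact (d_braidY h).symm
      · rw [d_aba_111 h, hout]
        exact outD_zero.trans (map_zero _).symm)
    (fun I hI => by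
      obtain ⟨i, j, k, J, rfl⟩ := eq_res3 I
      have hno : ∀ {i j k J}, (i = false ∨ j = true ∨ k = false) →
          ¬ A.Circled (abaRes a b i j k J) := fun hb hI => by
        obtain ⟨z, hz⟩ := aba_not_circled (u := u) h hb
        exact hI z ((circles _ _).symm hz)
      cases i <;> cases j <;> cases k
      any_goals first
        | exact absurd hI (hno (Or.inl rfl))
        | exact absurd hI (hno (Or.inr (Or.inl rfl)))
        | exact absurd hI (hno (Or.inr (Or.inr rfl)))
      obtain ⟨z, hz⟩ := aba_not_circled (u := u) (J := J) (i := true) (j := true) (k := true) h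
        (by simp)
      have hX : (khOps (aba a b u)).X (abaMid a b m u) (vac (abaRes a b true true true J)) =
        A.ops.X z (vac (abaRes a b true true true J)) := vac_compat _ _ _ hz
      have e : (khOps (aba a b u)).X (abaMid a b m u) (outD (abaOps a b u)
          (fun J => openRel u (TanBent m x) J) (fun J => vac (abaRes a b true false true J)) J) = _ :=
        outD_map (O' := abaOps a b u) _ fun v x => (khOps _).comm _ _ _
      change A.lift (abaOps b a u) n0 n1 ((khOps (aba a b u)).X (abaMid a b m u)
        (d (aba a b u) (vac (abaRes a b true false true J)))) =
        d (aba b a u) ((abaOps b a u).theta (openRel u (TanBent m x) J) (ptT u x) (ptT u y)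
          (braidY a b m x y J))
      rw [d_aba_101 h, map_add, hX, e, map_add, A.lift_X c0 c1, A.lift_vac c0, v0,
        A.lift_outD c0 c1, outD_congr fun J => (A.lift_mid c1 (I := abaRes a b true false true J)
          (aba_circled h)).trans (v1 _ _ _ _), d_theta_comap, d_braidY h]
      refine (congrArg₂ (· + ·) (map_zero _) (outD_theta (bent_outSaddle h) (bent₂_outSaddle h)
        (fun J => saddle_bent_top h) fun J => (hY J).compat)).trans (zero_add _))
    (by
      rw [braidlike_aba, v0, xs_comap, List.map_map]
      change (khOps _).xs _ (vac (abaRes b a false false false (braidlike u))) = _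
      rw [← braidlike_aba]
      exact psi_eq_xs _ _ fun p => rfl)

theorem KEquiv.braid (h : Adjacent a b m x y) (u : BraidWord n) : KEquiv (aba a b u) (aba b a u) :=
  ⟨⟨FMap.braid h u⟩, ⟨FMap.braid h.symm u⟩⟩

end Braid

end BraidKh

namespace BraidKh

variable {n : ℕ}

/-! ### `κ` is a function on the braid group -/

/-- Words that have the same `κ` in every context. -/
def kCon (n : ℕ) : Con (FreeMonoid (Fin (n - 1) × Bool)) where
  r v w := ∀ u : BraidWord n, kappa (n := n) (v.toList ++ u) = kappa (n := n) (w.toList ++ u)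
  iseqv := ⟨fun _ _ => rfl, fun h u => (h u).symm, fun h h' u => (h u).trans (h' u)⟩
  -- A context on the right suffices: by invariance under rotation, a word on the left can be moved
  -- into the context on the right.
  mul' {v v' w w'} h h' u := by
    have key : ∀ w : FreeMonoid (Fin (n - 1) × Bool),
        kappa (n := n) (v'.toList ++ (w.toList ++ u)) = kappa (n := n) (w.toList ++ (u ++ v'.toList)) :=
      fun w => by rw [(KEquiv.append_comm v'.toList _).kappa_eq, List.append_assoc]
    rw [FreeMonoid.toList_mul, FreeMonoid.toList_mul, List.append_assoc, List.append_assoc, h, key,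
      key, h']

/-- The class of a letter. -/
def kLetter (n : ℕ) (s : Fin (n - 1) × Bool) : (kCon n).Quotient :=
  (kCon n).toQuotient (FreeMonoid.of s)

/-- Makes the classes of letters invertible. Therefore the relations of the braid group are needed
for positive letters only. -/
theorem kLetter_mul (a : Fin (n - 1)) (s : Bool) : kLetter n (a, s) * kLetter n (a, !s) = 1 :=
  (kCon n).eq.2 fun u => (KEquiv.cancelPair a s u).kappa_eq

/-- The class of a generator. -/
def kUnit (n : ℕ) (a : Fin (n - 1)) : (kCon n).Quotientˣ :=
  ⟨kLetter n (a, true), kLetter n (a, false), kLetter_mul a true, kLetter_mul a false⟩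

theorem kUnit_braid {a b : Fin (n - 1)} (h : a.val + 1 = b.val) :
    kUnit n a * kUnit n b * kUnit n a = kUnit n b * kUnit n a * kUnit n b :=
  Units.ext ((kCon n).eq.2 fun u => (KEquiv.braid (adjacent_of_val h) u).kappa_eq)

theorem kUnit_far {a b : Fin (n - 1)} (h : a.val + 2 ≤ b.val) :
    kUnit n a * kUnit n b = kUnit n b * kUnit n a :=
  Units.ext ((kCon n).eq.2 fun u =>
    (KEquiv.far (a := (a, true)) (b := (b, true)) u (Or.inl h)).kappa_eq)

/-- The braid group acts on classes of words. -/
def kHom (n : ℕ) : BraidGroup n →* (kCon n).Quotientˣ :=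
  PresentedGroup.toGroup (f := kUnit n) (by
    rintro r (⟨i, j, h, rfl⟩ | ⟨i, j, h, rfl⟩)
    · simp only [map_mul, map_inv, FreeGroup.lift_apply_of]
      rw [kUnit_braid h, mul_inv_cancel]
    · simp only [map_mul, map_inv, FreeGroup.lift_apply_of]
      rw [kUnit_far h, mul_inv_cancel])

theorem kHom_toBraid (w : BraidWord n) :
    (kHom n w.toBraid : (kCon n).Quotient) = (kCon n).toQuotient (FreeMonoid.ofList w) := by
  induction w with
  | nil =>
    change ((kHom n 1 : (kCon n).Quotientˣ) : (kCon n).Quotient) = _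
    rw [map_one]; rfl
  | cons s w ih =>
    have hs : BraidWord.toBraid (s :: w) = BraidWord.toBraid [s] * BraidWord.toBraid w := by
      unfold BraidWord.toBraid
      rw [← map_mul, FreeGroup.mul_mk]; rfl
    have h1 : (kHom n (BraidWord.toBraid [s]) : (kCon n).Quotient) = kLetter n s := by
      obtain ⟨a, b⟩ := s
      have ht : kHom n (PresentedGroup.of a) = kUnit n a := PresentedGroup.toGroup.of _
      cases b
      · have : BraidWord.toBraid [(a, false)] = (PresentedGroup.of a : BraidGroup n)⁻¹ := rfl
        rw [this, map_inv, ht]; rfl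
      · have : BraidWord.toBraid [(a, true)] = (PresentedGroup.of a : BraidGroup n) := rfl
        rw [this, ht]; rfl
    rw [hs, map_mul, Units.val_mul, ih, h1]
    rfl

/-- The class of a word in the quotient by `kCon` depends only on its braid. Equality of classes,
read in the empty context, is equality of `kappa`. -/
theorem kappa_eq_of_toBraid_eq {v w : BraidWord n} (h : v.toBraid = w.toBraid) :
    kappa v = kappa w := by
  have e := (kHom_toBraid v).symm.trans ((congrArg _ (congrArg (kHom n) h)).trans (kHom_toBraid w))
  have := (kCon n).eq.1 e []
  simpa using this

theorem toBraid_surjective (n : ℕ) :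
    Function.Surjective (BraidWord.toBraid : BraidWord n → BraidGroup n) := by
  intro β
  obtain ⟨g, rfl⟩ := PresentedGroup.mk_surjective _ β
  exact ⟨g.toWord, by unfold BraidWord.toBraid; rw [FreeGroup.mk_toWord]⟩

theorem toBraid_append (v w : BraidWord n) :
    BraidWord.toBraid (v ++ w) = v.toBraid * w.toBraid := by
  unfold BraidWord.toBraid
  rw [← map_mul, FreeGroup.mul_mk]

/-- `κ` of a braid. -/
def braidKappa (n : ℕ) (β : BraidGroup n) : WithTop ℤ :=
  kappa (Function.surjInv (toBraid_surjective n) β)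

theorem braidKappa_toBraid (w : BraidWord n) : braidKappa n w.toBraid = kappa w :=
  kappa_eq_of_toBraid_eq (Function.surjInv_eq (toBraid_surjective n) _)

theorem braidKappa_mul_comm (β γ : BraidGroup n) :
    braidKappa n (β * γ) = braidKappa n (γ * β) := by
  obtain ⟨v, rfl⟩ := toBraid_surjective n β
  obtain ⟨w, rfl⟩ := toBraid_surjective n γ
  rw [← toBraid_append, ← toBraid_append, braidKappa_toBraid, braidKappa_toBraid,
    (KEquiv.append_comm v w).kappa_eq]

theorem braidKappa_isConj {β β' : BraidGroup n} (h : IsConj β β') :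
    braidKappa n β = braidKappa n β' := by
  obtain ⟨γ, rfl⟩ := isConj_iff.1 h
  rw [braidKappa_mul_comm, inv_mul_cancel_left]

end BraidKh

namespace BraidKh
open FiltOps
variable {n : ℕ}

/-! ### Computing the circles of a resolution -/

/-- The label at position `i` in a list of labels. -/
def labelAt (l : List ℕ) (i : ℕ) : ℕ := l.getD i 0

/-- Identify the labels at two positions. -/
def joinLabels (l : List ℕ) (i j : ℕ) : List ℕ :=
  bif labelAt l i == labelAt l j then l
  else l.map fun x => bif x == labelAt l i then labelAt l j else x

theorem length_joinLabels (l : List ℕ) (i j : ℕ) : (joinLabels l i j).length = l.length := by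
  unfold joinLabels
  cases labelAt l i == labelAt l j <;> simp

theorem labelAt_joinLabels {l : List ℕ} (i j : ℕ) {k : ℕ} (hk : k < l.length) :
    labelAt (joinLabels l i j) k = if labelAt l k = labelAt l i then labelAt l j else labelAt l k := by
  unfold joinLabels
  by_cases h : labelAt l i = labelAt l j
  · have : (labelAt l i == labelAt l j) = true := beq_iff_eq.2 h
    rw [this, cond_true, h]
    split_ifs with h'
    · exact h'
    · rfl
  · have : (labelAt l i == labelAt l j) = false := beq_eq_false_iff_ne.2 h
    rw [this, cond_false]
    have e : labelAt (l.map fun x => bif x == labelAt l i then labelAt l j else x) k =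
        bif labelAt l k == labelAt l i then labelAt l j else labelAt l k := by
      simp [labelAt, hk]
    rw [e, Bool.cond_eq_ite]
    simp only [beq_iff_eq]

/-- Identify the labels at the ends of all edges in a list. -/
def joinAll {V : Type*} (f : V → ℕ) (l : List ℕ) (es : List (V × V)) : List ℕ :=
  es.foldl (fun l e => joinLabels l (f e.1) (f e.2)) l

section JoinAll

variable {V : Type*} {f : V → ℕ}

theorem joinAll_of_eq {l : List ℕ} (hl : ∀ v, f v < l.length) (es : List (V × V)) {u v : V}
    (h : labelAt l (f u) = labelAt l (f v)) :
    labelAt (joinAll f l es) (f u) = labelAt (joinAll f l es) (f v) := by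
  induction es generalizing l with
  | nil => exact h
  | cons e es ih =>
    refine ih (l := joinLabels l (f e.1) (f e.2)) (fun v => ?_) ?_
    · rw [length_joinLabels]; exact hl v
    · rw [labelAt_joinLabels _ _ (hl u), labelAt_joinLabels _ _ (hl v), h]

theorem joinAll_of_mem {l : List ℕ} (hl : ∀ v, f v < l.length) (es : List (V × V)) {u v : V}
    (h : (u, v) ∈ es) : labelAt (joinAll f l es) (f u) = labelAt (joinAll f l es) (f v) := by
  induction es generalizing l with
  | nil => simp at h
  | cons e es ih =>
    have hl' : ∀ v, f v < (joinLabels l (f e.1) (f e.2)).length := fun v => by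
      rw [length_joinLabels]; exact hl v
    rcases List.mem_cons.1 h with rfl | h
    · refine joinAll_of_eq hl' es ?_
      rw [labelAt_joinLabels _ _ (hl u), labelAt_joinLabels _ _ (hl v), if_pos rfl]
      split_ifs <;> rfl
    · exact ih hl' h

theorem joinAll_sound {l : List ℕ} (hl : ∀ v, f v < l.length) {es : List (V × V)} {E : Setoid V}
    (h : ∀ u v, labelAt l (f u) = labelAt l (f v) → E u v) (he : ∀ e ∈ es, E e.1 e.2) {u v : V}
    (h' : labelAt (joinAll f l es) (f u) = labelAt (joinAll f l es) (f v)) : E u v := by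
  induction es generalizing l with
  | nil => exact h u v h'
  | cons e es ih =>
    refine ih (l := joinLabels l (f e.1) (f e.2)) (fun v => ?_) ?_
      (fun e he' => he e (List.mem_cons_of_mem _ he')) h'
    · rw [length_joinLabels]; exact hl v
    · intro u v
      have hE := he e List.mem_cons_self
      rw [labelAt_joinLabels _ _ (hl u), labelAt_joinLabels _ _ (hl v)]
      split_ifs with h1 h2 h2
      · exact fun _ => h u v (h1.trans h2.symm)
      · exact fun k => E.trans (h _ _ h1) (E.trans hE (h _ _ k))
      · exact fun k => E.trans (h _ _ k) (E.trans (E.symm hE) (E.symm (h _ _ h2)))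
      · exact h u v

end JoinAll

/-- The resolution given by the binary digits of a number. -/
def bitRes (w : BraidWord n) (m : ℕ) : Resolution w := fun j => m.testBit j

/-- The crossing before level `t + 1` turns back the strand in position `p`. -/
def turnsAt (w : BraidWord n) (m t p : ℕ) : Bool :=
  match w[t]? with
  | none => false
  | some s => (m.testBit t == s.2) && (p == s.1.val || p == s.1.val + 1)

/-- The number of the arc that leads upwards to the point in position `p` at level `t`: `n + s` if
it begins above the `s`-th crossing, and its position if it begins at level `0`. -/
def arcId (w : BraidWord n) (m p : ℕ) : ℕ → ℕ
  | 0 => p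
  | t + 1 => bif turnsAt w m t p then n + t else arcId w m p t

/-- The number of the arc that leads upwards to a point. -/
def ptArc (w : BraidWord n) (m : ℕ) (v : Pt w) : ℕ := arcId w m v.1.val v.2.val

theorem bitRes_ne_iff {w : BraidWord n} {m : ℕ} {j : Fin w.length} :
    bitRes w m j ≠ braidlike w j ↔ (m.testBit j == (w.get j).2) = true := by
  unfold bitRes braidlike
  cases m.testBit j <;> cases (w.get j).2 <;> simp

theorem turnsAt_iff {w : BraidWord n} {m : ℕ} {j : Fin w.length} {p : Fin n} :
    turnsAt w m j p = true ↔ bitRes w m j ≠ braidlike w j ∧ (p = lft w j ∨ p = rgt w j) := by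
  rw [bitRes_ne_iff, turnsAt, List.getElem?_eq_getElem j.isLt, Bool.and_eq_true, Bool.or_eq_true,
    beq_iff_eq, beq_iff_eq, beq_iff_eq, Fin.ext_iff, Fin.ext_iff]
  simp [lft, rgt]

theorem ptArc_zero {w : BraidWord n} {m : ℕ} (p : Fin n) : ptArc w m (p, 0) = p.val := rfl

theorem ptArc_succ {w : BraidWord n} {m : ℕ} (p : Fin n) (j : Fin w.length) :
    ptArc w m (p, j.succ) = if bitRes w m j ≠ braidlike w j ∧ (p = lft w j ∨ p = rgt w j) then
      n + j.val else ptArc w m (p, j.castSucc) := by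
  change (bif turnsAt w m j p then n + j.val else arcId w m p j) = _
  rw [Bool.cond_eq_ite, if_congr turnsAt_iff rfl rfl]
  rfl

theorem ptArc_lt {w : BraidWord n} {m : ℕ} (v : Pt w) : ptArc w m v < n + w.length := by
  obtain ⟨p, t⟩ := v
  induction t using Fin.induction with
  | zero => rw [ptArc_zero]; omega
  | succ j ih =>
    rw [ptArc_succ]
    split_ifs
    · have := j.isLt; omega
    · exact ih

/-- Two points on the same arc are on the same circle. -/
theorem circles_of_ptArc {w : BraidWord n} {m : ℕ} {u v : Pt w} (h : ptArc w m u = ptArc w m v) :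
    circles w (bitRes w m) u v := by
  have key : ∀ (p : Fin n) (t : Fin (w.length + 1)),
      (∃ q : Fin n, ptArc w m (p, t) = q.val ∧ circles w (bitRes w m) (p, t) (q, 0)) ∨
      ∃ j : Fin w.length, ptArc w m (p, t) = n + j.val ∧
        circles w (bitRes w m) (p, t) (lft w j, j.succ) := by
    intro p t
    induction t using Fin.induction with
    | zero => exact Or.inl ⟨p, rfl, (circles w _).refl _⟩
    | succ j ih =>
      rw [ptArc_succ]
      split_ifs with hj
      · refine Or.inr ⟨j, rfl, ?_⟩
        rcases hj.2 with rfl | rfl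
        · exact (circles w _).refl _
        · exact (circles w _).symm (Joined.cup j hj.1).circles
      · have hup : Joined w (bitRes w m) (p, j.castSucc) (p, j.succ) := by
          by_cases hb : bitRes w m j = braidlike w j
          · by_cases hl : p = lft w j
            · subst hl; exact .left j hb
            · by_cases hr : p = rgt w j
              · subst hr; exact .right j hb
              · exact .away j p hl hr
          · exact .away j p (fun e => hj ⟨hb, Or.inl e⟩) fun e => hj ⟨hb, Or.inr e⟩
        have hd := (circles w _).symm hup.circles
        rcases ih with ⟨q, e, hq⟩ | ⟨k, e, hk⟩
        · exact Or.inl ⟨q, e, (circles w _).trans hd hq⟩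
        · exact Or.inr ⟨k, e, (circles w _).trans hd hk⟩
  obtain ⟨p, t⟩ := u
  obtain ⟨q, s⟩ := v
  rcases key p t with ⟨a, ea, ha⟩ | ⟨a, ea, ha⟩ <;> rcases key q s with ⟨b, eb, hb⟩ | ⟨b, eb, hb⟩
  · obtain rfl : a = b := Fin.ext (by omega)
    exact (circles w _).trans ha ((circles w _).symm hb)
  · have := a.isLt; omega
  · have := b.isLt; omega
  · obtain rfl : a = b := Fin.ext (by omega)
    exact (circles w _).trans ha ((circles w _).symm hb)

/-- The pairs of points that join the ends of two arcs. -/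
def arcJoins (w : BraidWord n) (m : ℕ) : List (Pt w × Pt w) :=
  (((List.finRange w.length).filter fun j : Fin w.length => m.testBit j.val == (w.get j).2).map fun j =>
      ((lft w j, j.castSucc), (rgt w j, j.castSucc))) ++
    (List.finRange n).map fun p => ((p, Fin.last _), (p, 0))

theorem joined_of_mem_arcJoins {w : BraidWord n} {m : ℕ} {e : Pt w × Pt w}
    (h : e ∈ arcJoins w m) : Joined w (bitRes w m) e.1 e.2 := by
  rw [arcJoins, List.mem_append] at h
  rcases h with h | h
  · obtain ⟨j, hj, rfl⟩ := List.mem_map.1 h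
    exact .cap j (bitRes_ne_iff.2 (List.mem_filter.1 hj).2)
  · obtain ⟨p, -, rfl⟩ := List.mem_map.1 h
    exact .closing p

theorem arc_or_mem_arcJoins {w : BraidWord n} {m : ℕ} {u v : Pt w}
    (h : Joined w (bitRes w m) u v) : ptArc w m u = ptArc w m v ∨ (u, v) ∈ arcJoins w m := by
  rw [arcJoins, List.mem_append]
  cases h with
  | closing p => exact Or.inr (Or.inr (List.mem_map.2 ⟨p, List.mem_finRange p, rfl⟩))
  | away j p hl hr => rw [ptArc_succ, if_neg fun h => h.2.elim hl hr]; exact Or.inl rfl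
  | left j h => rw [ptArc_succ, if_neg fun h' => h'.1 h]; exact Or.inl rfl
  | right j h => rw [ptArc_succ, if_neg fun h' => h'.1 h]; exact Or.inl rfl
  | cap j h =>
    exact Or.inr (Or.inl (List.mem_map.2 ⟨j, List.mem_filter.2 ⟨List.mem_finRange j,
      bitRes_ne_iff.1 h⟩, rfl⟩))
  | cup j h => rw [ptArc_succ, ptArc_succ, if_pos ⟨h, Or.inl rfl⟩, if_pos ⟨h, Or.inr rfl⟩]; exact Or.inl rfl

/-- Labels of the arcs that distinguish the circles of a resolution. -/
def circleLabels (w : BraidWord n) (m : ℕ) : List ℕ :=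
  joinAll (ptArc w m) (List.range (n + w.length)) (arcJoins w m)

/-- The label of the circle through a point. -/
def label (w : BraidWord n) (m : ℕ) (v : Pt w) : ℕ := labelAt (circleLabels w m) (ptArc w m v)

/-- Straight pieces and cups stay within one numbered arc, or have both ends on it. So the circles
arise by joining arcs at the caps and at the closing arcs, and `arcJoins` lists these. -/
theorem label_eq_iff {w : BraidWord n} {m : ℕ} {u v : Pt w} :
    label w m u = label w m v ↔ circles w (bitRes w m) u v := by
  have hl : ∀ v : Pt w, ptArc w m v < (List.range (n + w.length)).length := fun v => by
    rw [List.length_range]; exact ptArc_lt v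
  have h0 : ∀ v : Pt w, labelAt (List.range (n + w.length)) (ptArc w m v) = ptArc w m v := fun v => by
    simp [labelAt, ptArc_lt v]
  constructor
  · refine joinAll_sound hl (fun u v h => ?_) fun e he => (joined_of_mem_arcJoins he).circles
    rw [h0, h0] at h
    exact circles_of_ptArc h
  · refine circles_le (E := Setoid.ker (label w m)) fun u v h => ?_
    rcases arc_or_mem_arcJoins h with h | h
    · exact joinAll_of_eq hl _ (by rw [h])
    · exact joinAll_of_mem hl _ h

end BraidKh

namespace BraidKh
open FiltOps
variable {n : ℕ}

/-! ### Computing the filtration -/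

/-- The labels of the circles through the closing arcs. -/
def closeLabels (w : BraidWord n) (m : ℕ) : List ℕ := (List.finRange n).map fun p => label w m (p, 0)

/-- A label occurs an odd number of times. -/
def oddIn (l : List ℕ) (x : ℕ) : Bool := l.count x % 2 == 1

/-- The number of labels that occur an odd number of times. -/
def numOdd (l : List ℕ) : ℕ := (l.dedup.filter (oddIn l)).length

theorem card_filter_univ (P : Fin n → Prop) [DecidablePred P] (q : Fin n → Bool) (h : ∀ p, P p ↔ q p = true) :
    (Finset.univ.filter P).card = (List.finRange n).countP q := by
  have e : Finset.univ.filter P = ((List.finRange n).filter q).toFinset := by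
    ext p; simp [h]
  rw [e, List.toFinset_card_of_nodup ((List.nodup_finRange n).filter _), List.countP_eq_length_filter]

theorem count_closeLabels {w : BraidWord n} {m : ℕ} (x : ℕ) :
    (closeLabels w m).count x =
      (Finset.univ.filter fun p : Fin n => label w m (clPt w p) = x).card := by
  rw [card_filter_univ _ (fun p => label w m (clPt w p) == x) (fun p => beq_iff_eq.symm),
    closeLabels, List.count, List.countP_map]
  rfl

theorem NT_iff {w : BraidWord n} {m : ℕ} {v : Pt w} :
    NT (clPt w) (circles w (bitRes w m)) v ↔ oddIn (closeLabels w m) (label w m v) = true := by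
  rw [oddIn, beq_iff_eq, ← Nat.odd_iff, count_closeLabels, NT, trace]
  simp only [label_eq_iff]

theorem card_oddTraces_eq {w : BraidWord n} {m : ℕ} :
    (oddTraces (clPt w) (circles w (bitRes w m))).card = numOdd (closeLabels w m) := by
  have e : numOdd (closeLabels w m) =
      ((closeLabels w m).dedup.filter (oddIn (closeLabels w m))).toFinset.card := by
    rw [List.toFinset_card_of_nodup ((List.nodup_dedup _).filter _)]; rfl
  rw [e]
  have hodd : ∀ x, oddIn (closeLabels w m) x = true ↔
      Odd (Finset.univ.filter fun p : Fin n => label w m (clPt w p) = x).card := fun x => by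
    rw [oddIn, beq_iff_eq, ← Nat.odd_iff, count_closeLabels]
  have htr : ∀ v : Pt w, trace (clPt w) (circles w (bitRes w m)) v =
      Finset.univ.filter fun p : Fin n => label w m (clPt w p) = label w m v := fun v => by
    rw [trace]; simp only [label_eq_iff]
  symm
  refine Finset.card_bij
    (fun x _ => Finset.univ.filter fun p : Fin n => label w m (clPt w p) = x) ?_ ?_ ?_
  · intro x hx
    rw [List.mem_toFinset, List.mem_filter, List.mem_dedup] at hx
    obtain ⟨p, -, rfl⟩ := List.mem_map.1 hx.1
    rw [mem_oddTraces]
    exact ⟨(hodd _).1 hx.2, _, (htr (p, 0)).symm⟩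
  · intro x hx y hy h
    rw [List.mem_toFinset, List.mem_filter] at hx
    obtain ⟨p, hp⟩ := Finset.card_pos.1 ((hodd x).1 hx.2).pos
    have hp' := h ▸ hp
    rw [Finset.mem_filter] at hp hp'
    exact hp.2.symm.trans hp'.2
  · intro C hC
    obtain ⟨ho, v, rfl⟩ := mem_oddTraces.1 hC
    rw [htr] at ho
    refine ⟨label w m v, ?_, (htr v).symm⟩
    rw [List.mem_toFinset, List.mem_filter, List.mem_dedup]
    refine ⟨?_, (hodd _).2 ho⟩
    obtain ⟨p, hp⟩ := Finset.card_pos.1 ho.pos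
    exact List.mem_map.2 ⟨p, List.mem_finRange p, (Finset.mem_filter.1 hp).2⟩

/-! ### Chains as lists of terms -/

/-- A term of a chain: a resolution, given by binary digits, and points on its circles labeled
`v₋`. -/
abbrev Term (w : BraidWord n) : Type := ℕ × List (Pt w)

/-- The chain given by a term. -/
def Term.val {w : BraidWord n} (t : Term w) : CKh w := (khOps w).xs t.2 (vac (bitRes w t.1))

/-- The labels of the circles labeled `v₋`. -/
def Term.labels {w : BraidWord n} (t : Term w) : List ℕ := t.2.map (label w t.1)

/-- The resolution and the set of circles labeled `v₋` of a term, if it is a generator. -/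
def Term.key {w : BraidWord n} (t : Term w) : Option (ℕ × ℕ) :=
  bif decide t.labels.Nodup then some (t.1, t.labels.foldr (fun x a => 2 ^ x ||| a) 0) else none

theorem testBit_foldr (l : List ℕ) (k : ℕ) :
    (l.foldr (fun x a => 2 ^ x ||| a) 0).testBit k = true ↔ k ∈ l := by
  induction l with
  | nil => simp
  | cons x l ih =>
    rw [List.foldr_cons, Nat.testBit_or, Bool.or_eq_true, ih, List.mem_cons, Nat.testBit_two_pow,
      decide_eq_true_iff, eq_comm]

theorem Term.nodup_iff {w : BraidWord n} (t : Term w) :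
    t.labels.Nodup ↔ Dist (bitRes w t.1) t.2 := by
  rw [Term.labels, List.Nodup, List.pairwise_map]
  simp only [ne_eq, label_eq_iff]

theorem Term.val_of_key_none {w : BraidWord n} {t : Term w} (h : t.key = none) : t.val = 0 := by
  refine (vac_compat _).xs_zero fun hS => ?_
  rw [Term.key, decide_eq_true (t.nodup_iff.2 hS)] at h
  simp at h

theorem Term.key_some {w : BraidWord n} {t : Term w} {k : ℕ × ℕ} (h : t.key = some k) :
    Dist (bitRes w t.1) t.2 ∧ k = (t.1, t.labels.foldr (fun x a => 2 ^ x ||| a) 0) := by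
  unfold Term.key at h
  by_cases hS : t.labels.Nodup
  · rw [decide_eq_true hS, cond_true, Option.some_inj] at h
    exact ⟨t.nodup_iff.1 hS, h.symm⟩
  · rw [decide_eq_false hS] at h
    simp at h

/-- The set of labels is stored as the binary digits of a number. Equal keys mean the same
resolution and the same circles labeled v₋. -/
theorem Term.val_eq_of_key {w : BraidWord n} {t t' : Term w} {k : ℕ × ℕ} (h : t.key = some k)
    (h' : t'.key = some k) : t.val = t'.val := by
  obtain ⟨m, S⟩ := t
  obtain ⟨m', S'⟩ := t'
  obtain ⟨hS, e⟩ := Term.key_some h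
  obtain ⟨hS', e'⟩ := Term.key_some h'
  obtain ⟨h1, h2⟩ := Prod.ext_iff.1 (e.symm.trans e')
  obtain rfl : m = m' := h1
  simp only [Term.val]
  rw [xs_vac hS, xs_vac hS']
  congr 1
  refine genOf_eq (x := genOf (bitRes w m) S') fun v => ?_
  rw [genOf_at_false]
  have key : ∀ T : List (Pt w), (∃ u ∈ T, circles w (bitRes w m) u v) ↔
      label w m v ∈ T.map (label w m) := fun T => by
    rw [List.mem_map]
    simp only [label_eq_iff]
  have h3 := congrArg (fun a => a.testBit (label w m v) = true) h2
  simp only [testBit_foldr] at h3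
  exact (key S).trans ((Iff.of_eq h3).trans (key S').symm)

/-- The terms of the differential of a term. -/
def Term.diff {w : BraidWord n} (t : Term w) : List (Term w) :=
  (List.finRange w.length).flatMap fun j : Fin w.length =>
    bif t.1.testBit j.val then []
    else bif label w t.1 (cornerA w j) == label w t.1 (cornerB w j) then
      [(t.1 ||| 2 ^ j.val, cornerA w j :: t.2), (t.1 ||| 2 ^ j.val, cornerB w j :: t.2)]
    else [(t.1 ||| 2 ^ j.val, t.2)]

theorem sum_map_flatMap {α β M : Type*} [AddCommMonoid M] (l : List α) (f : α → List β) (g : β → M) :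
    ((l.flatMap f).map g).sum = (l.map fun x => ((f x).map g).sum).sum := by
  induction l with
  | nil => rfl
  | cons x l ih => rw [List.flatMap_cons, List.map_append, List.sum_append, ih]; rfl

theorem bitRes_or (w : BraidWord n) (m : ℕ) (j : Fin w.length) :
    bitRes w (m ||| 2 ^ j.val) = Function.update (bitRes w m) j true := by
  funext k
  by_cases h : k = j
  · subst h; simp [bitRes]
  · have : j.val ≠ k.val := fun e => h (Fin.ext e.symm)
    rw [Function.update_of_ne h, bitRes, Nat.testBit_or, Nat.testBit_two_pow_of_ne this,
      Bool.or_false]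
    rfl

theorem Term.d_val {w : BraidWord n} (t : Term w) :
    d w t.val = (t.diff.map Term.val).sum := by
  rw [Term.val, d_xs_vac, map_sum, Term.diff, sum_map_flatMap,
    ← List.sum_ofFn, List.ofFn_eq_map]
  refine congrArg List.sum (List.map_congr_left fun j _ => ?_)
  unfold dEdge
  by_cases hj : t.1.testBit j = true
  · rw [if_neg (by simp [bitRes, hj]), hj, map_zero]; rfl
  · rw [Bool.not_eq_true] at hj
    rw [if_pos (by exact hj), hj, cond_false, ← bitRes_or]
    by_cases e : label w t.1 (cornerA w j) = label w t.1 (cornerB w j)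
    · rw [theta_of (label_eq_iff.1 e), beq_iff_eq.2 e, cond_true, map_add, ← X_xs, ← X_xs]
      simp [Term.val]
    · rw [theta_of_not fun h => e (label_eq_iff.2 h), beq_eq_false_iff_ne.2 e]
      simp [Term.val]

/-- Add a key to a set of keys modulo 2. -/
def toggle (k : ℕ × ℕ) (l : List (ℕ × ℕ)) : List (ℕ × ℕ) := bif l.elem k then l.erase k else k :: l

/-- The sum modulo 2 of a list of keys. -/
def keySum (l : List (Option (ℕ × ℕ))) : List (ℕ × ℕ) :=
  l.foldr (fun o acc => match o with
    | none => acc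
    | some k => toggle k acc) []

theorem sum_toggle {w : BraidWord n} (f : ℕ × ℕ → CKh w) (k : ℕ × ℕ) (l : List (ℕ × ℕ)) :
    ((toggle k l).map f).sum = f k + (l.map f).sum := by
  unfold toggle
  by_cases h : l.elem k = true
  · rw [h, cond_true, ((List.perm_cons_erase (List.elem_iff.1 h)).map f).sum_eq, List.map_cons,
      List.sum_cons, ← add_assoc, add_self_zmod2, zero_add]
  · rw [Bool.eq_false_of_not_eq_true h, cond_false, List.map_cons, List.sum_cons]

theorem sum_val_eq_zero {w : BraidWord n} {l : List (Term w)} (h : keySum (l.map Term.key) = []) :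
    (l.map Term.val).sum = 0 := by
  -- A key is evaluated by any term that has it; the choice does not matter by `Term.val_eq_of_key`.
  have hf : ∃ f : ℕ × ℕ → CKh w, ∀ (t : Term w) k, t.key = some k → t.val = f k :=
    ⟨fun k => if h : ∃ t : Term w, t.key = some k then h.choose.val else 0, fun t k hk => by
      beta_reduce
      have h : ∃ t : Term w, t.key = some k := ⟨t, hk⟩
      rw [dif_pos h]
      exact Term.val_eq_of_key hk h.choose_spec⟩
  obtain ⟨f, hf⟩ := hf
  suffices (l.map Term.val).sum = ((keySum (l.map Term.key)).map f).sum by rw [this, h]; rfl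
  clear h
  induction l with
  | nil => rfl
  | cons t l ih =>
    rw [List.map_cons, List.sum_cons, List.map_cons, ih]
    cases hk : t.key with
    | none => rw [Term.val_of_key_none hk, zero_add]; rfl
    | some k => rw [hf t k hk, ← sum_toggle]; rfl

/-- A term is a generator in the given level of the filtration. -/
def Term.inLevel {w : BraidWord n} (i : ℤ) (t : Term w) : Bool :=
  decide t.labels.Nodup && decide ((numOdd (closeLabels w t.1) : ℤ) -
    2 * ((t.labels.filter (oddIn (closeLabels w t.1))).length : ℤ) ≤ i)

theorem Term.val_mem {w : BraidWord n} {i : ℤ} {t : Term w} (h : t.inLevel i = true) :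
    t.val ∈ F w i := by
  rw [Term.inLevel, Bool.and_eq_true, decide_eq_true_iff, decide_eq_true_iff] at h
  have hS := t.nodup_iff.1 h.1
  rw [Term.val, xs_vac hS]
  refine basisVec_mem_F ?_
  rw [kGrading_genOf hS, card_oddTraces_eq]
  refine le_trans (le_of_eq ?_) h.2
  congr 2
  rw [Term.labels, List.filter_map, List.length_map]
  generalize t.2 = S
  induction S with
  | nil => rfl
  | cons v S ih =>
    rw [List.map_cons, List.sum_cons, ih, List.filter_cons, ind]
    by_cases hv : NT (clPt w) (circles w (bitRes w t.1)) v
    · rw [if_pos hv, if_pos (by exact NT_iff.1 hv), List.length_cons]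
      push_cast; ring
    · rw [if_neg hv, if_neg (by exact fun e => hv (NT_iff.2 e)), zero_add]

/-- The term of `ψ`, if the digits of `m` give the braidlike resolution. -/
def psiTerm (w : BraidWord n) (m : ℕ) : Term w := (m, (List.finRange n).map fun p => (p, 0))

/-- The digits of a number give the braidlike resolution. -/
def isBraidlike (w : BraidWord n) (m : ℕ) : Bool :=
  (List.finRange w.length).all fun j => m.testBit j == !(w.get j).2

theorem bitRes_of_isBraidlike {w : BraidWord n} {m : ℕ} (h : isBraidlike w m = true) :
    bitRes w m = braidlike w := by
  funext j
  exact beq_iff_eq.1 (List.all_eq_true.1 h j (List.mem_finRange j))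

/-- The sum of a list of terms has boundary `ψ`. -/
def boundsPsi (w : BraidWord n) (i : ℤ) (m : ℕ) (ts : List (Term w)) : Bool :=
  isBraidlike w m && (psiTerm w m :: ts).all (Term.inLevel i) &&
    (keySum ((psiTerm w m).diff.map Term.key)).isEmpty &&
    (keySum ((psiTerm w m :: ts.flatMap Term.diff).map Term.key)).isEmpty

/-- The terms `ts` sum to a chain of level `i`. The sum of ψ and the boundaries of all terms is zero
modulo 2, so the boundary of the chain is ψ. That ψ is a cycle is checked by the same computation.
-/
theorem psiVanishes_of_boundsPsi {w : BraidWord n} {i : ℤ} {m : ℕ} {ts : List (Term w)}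
    (h : boundsPsi w i m ts = true) : PsiVanishes w i := by
  simp only [boundsPsi, Bool.and_eq_true, List.isEmpty_iff, List.all_eq_true] at h
  obtain ⟨⟨⟨h1, h2⟩, h3⟩, h4⟩ := h
  have e : (psiTerm w m).val = psi w := by
    rw [Term.val, psiTerm, bitRes_of_isBraidlike h1]
    exact psi_eq_xs w _ fun p => rfl
  have h4 := sum_val_eq_zero h4
  rw [List.map_cons, List.sum_cons, e, sum_map_flatMap] at h4
  rw [psiVanishes_iff, ← e]
  refine ⟨Term.val_mem (h2 _ List.mem_cons_self), ?_, (ts.map Term.val).sum,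
    list_sum_mem ?_, ?_⟩
  · rw [Term.d_val, sum_val_eq_zero h3]
  · intro x hx
    obtain ⟨t, ht, rfl⟩ := List.mem_map.1 hx
    exact Term.val_mem (h2 t (List.mem_cons_of_mem _ ht))
  · rw [map_list_sum, List.map_map, e]
    have h5 : (ts.map (d w ∘ Term.val)) = ts.map fun t => (t.diff.map Term.val).sum :=
      List.map_congr_left fun t _ => t.d_val
    rw [h5, eq_comm]
    refine (add_right_cancel (b := (ts.map fun t => (t.diff.map Term.val).sum).sum) ?_)
    rw [add_self_zmod2]
    exact h4

end BraidKh

namespace BraidKh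
open FiltOps
variable {n : ℕ}

/-! ### Functionals that vanish on boundaries of a level of the filtration -/

/-- The generator with all circles labeled `v₋`. -/
def allMinus {w : BraidWord n} (I : Resolution w) : Gen w := ⟨I, fun _ => false⟩

/-- An all-v₋ generator arises only by splitting a circle labeled v₋, or by merging a circle labeled
v₊ with one labeled v₋. -/
theorem edgeTerm_allMinus {w : BraidWord n} {j : Fin w.length} {y : Gen w} {J : Resolution w} :
    EdgeTerm j y (allMinus J) ↔ y.res j = false ∧ J = Function.update y.res j true ∧
      (∀ v, ¬ circles w y.res v (cornerA w j) → ¬ circles w y.res v (cornerB w j) →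
        y.at v = false) ∧
      (if circles w y.res (cornerA w j) (cornerB w j) then y.at (cornerA w j) = false
        else y.at (cornerA w j) ≠ y.at (cornerB w j)) := by
  rw [edgeTerm_iff]
  refine and_congr Iff.rfl (and_congr Iff.rfl (and_congr Iff.rfl ?_))
  change (if _ then ComulTerm _ false false else MulTerm _ _ false) ↔ _
  split_ifs with h
  · rw [comulTerm_iff]; cases y.at (cornerA w j) <;> simp
  · rw [mulTerm_iff]
    cases y.at (cornerA w j) <;> cases y.at (cornerB w j) <;> simp

theorem kGrading_eq_plus {w : BraidWord n} (x : Gen w) : kGrading x =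
    2 * (Finset.card {c : Circle w x.res | c.Nontrivial ∧ x.lab c = true} : ℤ) -
      (oddTraces (clPt w) (circles w x.res)).card := by
  have h := kGrading_eq x
  rw [kGrading] at h ⊢
  linarith

theorem edgeTerm_allMinus_of_forall {w : BraidWord n} {j : Fin w.length} {y : Gen w}
    {J : Resolution w} (hy : ∀ v, y.at v = false) : EdgeTerm j y (allMinus J) ↔
      y.res j = false ∧ J = Function.update y.res j true ∧
        circles w y.res (cornerA w j) (cornerB w j) := by
  rw [edgeTerm_allMinus]
  simp only [hy]
  simp

theorem edgeTerm_allMinus_of_plus {w : BraidWord n} {j : Fin w.length} {y : Gen w}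
    {J : Resolution w} {c : Pt w} (hy : ∀ v, y.at v = true ↔ circles w y.res v c) :
    EdgeTerm j y (allMinus J) ↔ y.res j = false ∧ J = Function.update y.res j true ∧
      (¬ circles w y.res (cornerA w j) c ↔ circles w y.res (cornerB w j) c) := by
  have hf : ∀ v, y.at v = false ↔ ¬ circles w y.res v c := fun v => by
    rw [← hy, Bool.not_eq_true]
  rw [edgeTerm_allMinus]
  refine and_congr Iff.rfl (and_congr Iff.rfl ?_)
  constructor
  · rintro ⟨h1, h2⟩
    split_ifs at h2 with h
    · rw [hf] at h2
      refine absurd ((hy c).2 ((circles w y.res).refl c)) ?_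
      rw [h1 c (fun k => h2 ((circles w y.res).symm k)) fun k =>
        h2 ((circles w y.res).trans h ((circles w y.res).symm k))]
      simp
    · rw [← hy, ← hy]
      revert h2
      cases y.at (cornerA w j) <;> cases y.at (cornerB w j) <;> simp
  · intro h
    have hab : ¬ circles w y.res (cornerA w j) (cornerB w j) := fun k => by
      have : circles w y.res (cornerA w j) c ↔ circles w y.res (cornerB w j) c :=
        ⟨(circles w y.res).trans ((circles w y.res).symm k), (circles w y.res).trans k⟩
      tauto
    refine ⟨fun v hva hvb => ?_, ?_⟩
    · rw [hf]
      intro hv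
      by_cases ha : circles w y.res (cornerA w j) c
      · exact hva ((circles w y.res).trans hv ((circles w y.res).symm ha))
      · exact hvb ((circles w y.res).trans hv ((circles w y.res).symm (h.1 ha)))
    · rw [if_neg hab]
      rw [← hy, ← hy] at h
      revert h
      cases y.at (cornerA w j) <;> cases y.at (cornerB w j) <;> simp

/-- A generator whose differential contains a generator with all labels `v₋` has at most one circle
labeled `v₊`. -/
theorem plus_of_edgeTerm {w : BraidWord n} {j : Fin w.length} {y : Gen w} {J : Resolution w}
    (h : EdgeTerm j y (allMinus J)) : (∀ v, y.at v = false) ∨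
      ∃ c, (c = cornerA w j ∨ c = cornerB w j) ∧ ∀ v, y.at v = true ↔ circles w y.res v c := by
  rw [edgeTerm_allMinus] at h
  obtain ⟨-, -, h1, h2⟩ := h
  have key : ∀ c c' : Pt w, (∀ v, ¬ circles w y.res v c → ¬ circles w y.res v c' → y.at v = false) →
      y.at c = true → y.at c' = false → ∀ v, y.at v = true ↔ circles w y.res v c := by
    intro c c' h hc hc' v
    refine ⟨fun hv => ?_, fun hv => by rw [y.at_congr hv, hc]⟩
    by_contra k
    by_cases k' : circles w y.res v c'
    · rw [y.at_congr k', hc'] at hv; simp at hv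
    · rw [h v k k'] at hv; simp at hv
  split_ifs at h2 with hab
  · left
    intro v
    by_cases ha : circles w y.res v (cornerA w j)
    · rw [y.at_congr ha, h2]
    · exact h1 v ha fun k => ha ((circles w y.res).trans k ((circles w y.res).symm hab))
  · right
    cases ha : y.at (cornerA w j) with
    | true =>
      cases hb : y.at (cornerB w j) with
      | true => exact absurd (ha.trans hb.symm) h2
      | false => exact ⟨_, Or.inl rfl, key _ _ h1 ha hb⟩
    | false =>
      cases hb : y.at (cornerB w j) with
      | true => exact ⟨_, Or.inr rfl, key _ _ (fun v k k' => h1 v k' k) hb ha⟩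
      | false => exact absurd (ha.trans hb.symm) h2

/-- The edge of the cube at the `j`-th crossing leads from `m` to `z`. -/
def isEdge (m z j : ℕ) : Bool := !m.testBit j && z == m ||| 2 ^ j

/-- The number of edges from the generator at `m` with all labels `v₋` to generators of this kind
in a list. -/
def splitCount (w : BraidWord n) (zs : List ℕ) (m : ℕ) : ℕ :=
  zs.countP fun z => (List.finRange w.length).any fun j : Fin w.length => isEdge m z j.val &&
    (label w m (cornerA w j) == label w m (cornerB w j))

/-- The number of edges from the generator at `m` with label `v₊` only on the circle with label `x`
to generators with all labels `v₋` in a list. -/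
def mergeCount (w : BraidWord n) (zs : List ℕ) (m x : ℕ) : ℕ :=
  zs.countP fun z => (List.finRange w.length).any fun j : Fin w.length => isEdge m z j.val &&
    xor (label w m (cornerA w j) == x) (label w m (cornerB w j) == x)

/-- The sum of coefficients over generators with all labels `v₋` vanishes on the boundaries of the
generators at `m` in level `i`. -/
def vanishesAt (w : BraidWord n) (i : ℤ) (zs : List ℕ) (m : ℕ) : Bool :=
  -- With all labels v₋ the k-grading is minus the number of non-trivial circles. One label v₊ adds
  -- 2 on a non-trivial circle and nothing on a trivial one. Generators above level `i` need no
  -- check.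
  (decide (i < -(numOdd (closeLabels w m) : ℤ)) || splitCount w zs m % 2 == 0) &&
    (List.finRange w.length).all fun j => [cornerA w j, cornerB w j].all fun c =>
      decide (i < (bif oddIn (closeLabels w m) (label w m c) then 2 else 0) -
        (numOdd (closeLabels w m) : ℤ)) || mergeCount w zs m (label w m c) % 2 == 0

/-- The sum of coefficients over the generators with all labels `v₋` at a list of resolutions
detects that `ψ` is not a boundary in level `i`. -/
def detectsPsi (w : BraidWord n) (i : ℤ) (b : ℕ) (zs : List ℕ) : Bool :=
  isBraidlike w b && (zs.count b % 2 == 1) && (b :: zs).all (fun z => decide (z < 2 ^ w.length)) &&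
    zs.all fun z => (List.finRange w.length).all fun j : Fin w.length =>
      !z.testBit j.val || vanishesAt w i zs (z ^^^ 2 ^ j.val)

theorem bitRes_inj {w : BraidWord n} {m m' : ℕ} (h : m < 2 ^ w.length) (h' : m' < 2 ^ w.length)
    (e : bitRes w m = bitRes w m') : m = m' := by
  refine Nat.eq_of_testBit_eq fun i => ?_
  by_cases hi : i < w.length
  · exact congrFun e ⟨i, hi⟩
  · have : 2 ^ w.length ≤ 2 ^ i := Nat.pow_le_pow_right (by norm_num) (not_lt.1 hi)
    rw [Nat.testBit_lt_two_pow (h.trans_le this), Nat.testBit_lt_two_pow (h'.trans_le this)]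

theorem isEdge_iff {w : BraidWord n} {m z : ℕ} {j : Fin w.length} (h : m < 2 ^ w.length)
    (h' : z < 2 ^ w.length) : isEdge m z j.val = true ↔
      bitRes w m j = false ∧ bitRes w z = Function.update (bitRes w m) j true := by
  rw [isEdge, Bool.and_eq_true, Bool.not_eq_true', beq_iff_eq, ← bitRes_or]
  refine and_congr Iff.rfl ⟨congrArg _, bitRes_inj h' ?_⟩
  exact Nat.or_lt_two_pow h (Nat.pow_lt_pow_right (by norm_num) j.isLt)

theorem countP_cast {α : Type*} (l : List α) (q : α → Bool) (P : α → Prop) [DecidablePred P]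
    (h : ∀ z ∈ l, P z ↔ q z = true) :
    (l.map fun z => if P z then (1 : ZMod 2) else 0).sum = (l.countP q : ZMod 2) := by
  induction l with
  | nil => simp
  | cons z l ih =>
    rw [List.map_cons, List.sum_cons, ih fun z hz => h z (List.mem_cons_of_mem _ hz),
      List.countP_cons, if_congr (h z List.mem_cons_self) rfl rfl]
    push_cast
    rw [add_comm]

theorem sum_eq_zero_of_countP {α : Type*} (l : List α) (q : α → Bool) (P : α → Prop)
    [DecidablePred P] (h : ∀ z ∈ l, P z ↔ q z = true) (h0 : (l.countP q % 2 == 0) = true) :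
    (l.map fun z => if P z then (1 : ZMod 2) else 0).sum = 0 := by
  rw [countP_cast l q P h, ZMod.natCast_eq_zero_iff]
  exact Nat.dvd_of_mod_eq_zero (beq_iff_eq.1 h0)

/-- The sum of the coefficients at the generators with all labels `v₋` over a list of resolutions. -/
def sumAt (w : BraidWord n) (zs : List ℕ) : CKh w →ₗ[ZMod 2] ZMod 2 :=
  (zs.map fun z => LinearMap.proj (allMinus (bitRes w z))).sum

theorem sumAt_apply (w : BraidWord n) (zs : List ℕ) (f : CKh w) :
    sumAt w zs f = (zs.map fun z => f (allMinus (bitRes w z))).sum := by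
  induction zs with
  | nil => rfl
  | cons z zs ih =>
    rw [List.map_cons, List.sum_cons, ← ih]; rfl

/-- The value counts, modulo 2, the edges from `y` to the listed all-v₋ generators. It is even by
`vanishesAt`, whose other alternative, that `y` lies above level `i`, contradicts the bound on k. -/
theorem sumAt_d_eq_zero {w : BraidWord n} {i : ℤ} {zs : List ℕ} {m : ℕ} (hm : m < 2 ^ w.length)
    (hz : ∀ z ∈ zs, z < 2 ^ w.length) (hv : vanishesAt w i zs m = true) {y : Gen w}
    (hy : y.res = bitRes w m) (hk : kGrading y ≤ i)
    (hp : (∀ v, y.at v = false) ∨ ∃ (j : Fin w.length) (c : Pt w),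
      (c = cornerA w j ∨ c = cornerB w j) ∧ ∀ v, y.at v = true ↔ circles w y.res v c) :
    sumAt w zs (d w (basisVec y)) = 0 := by
  obtain ⟨I, l⟩ := y
  obtain rfl : I = bitRes w m := hy
  rw [sumAt_apply]
  simp only [d_basisVec]
  rw [vanishesAt, Bool.and_eq_true, Bool.or_eq_true, decide_eq_true_iff] at hv
  rw [kGrading_eq_plus] at hk
  simp only [card_oddTraces_eq] at hk
  rcases hp with hp | ⟨j, c, hc, hp⟩
  · refine sum_eq_zero_of_countP _ _ _ (fun z hz' => ?_) (hv.1.resolve_left fun h => ?_)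
    · rw [List.any_eq_true]
      simp only [List.mem_finRange, true_and, Bool.and_eq_true, isEdge_iff hm (hz z hz'),
        beq_iff_eq, label_eq_iff, edgeTerm_allMinus_of_forall hp, and_assoc]
    · have : (0 : ℤ) ≤ (Finset.card {c : Circle w (bitRes w m) | c.Nontrivial ∧ l c = true} : ℤ) := by
        positivity
      linarith
  · have h2 := List.all_eq_true.1 hv.2 j (List.mem_finRange j)
    have h3 := List.all_eq_true.1 h2 c (by rcases hc with rfl | rfl <;> simp)
    rw [Bool.or_eq_true, decide_eq_true_iff] at h3
    refine sum_eq_zero_of_countP _ _ _ (fun z hz' => ?_) (h3.resolve_left fun h => ?_)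
    · rw [List.any_eq_true]
      simp only [List.mem_finRange, true_and, Bool.and_eq_true, isEdge_iff hm (hz z hz'),
        edgeTerm_allMinus_of_plus hp, and_assoc]
      refine exists_congr fun k => and_congr Iff.rfl (and_congr Iff.rfl ?_)
      rw [← label_eq_iff, ← label_eq_iff]
      by_cases h1 : label w m (cornerA w k) = label w m c <;>
        by_cases h2 : label w m (cornerB w k) = label w m c <;> simp [h1, h2]
    · cases ho : oddIn (closeLabels w m) (label w m c) with
      | false =>
        rw [ho, cond_false] at h
        have : (0 : ℤ) ≤ (Finset.card {c : Circle w (bitRes w m) | c.Nontrivial ∧ l c = true} : ℤ) := by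
          positivity
        linarith
      | true =>
        rw [ho, cond_true] at h
        have : 0 < Finset.card {c : Circle w (bitRes w m) | c.Nontrivial ∧ l c = true} := by
          refine Finset.card_pos.2 ⟨circ w _ c, ?_⟩
          rw [Finset.mem_filter]
          exact ⟨Finset.mem_univ _, (nontrivial_iff _ c).2 (NT_iff.2 ho),
            (hp c).2 ((circles w _).refl c)⟩
        have : (1 : ℤ) ≤ (Finset.card {c : Circle w (bitRes w m) | c.Nontrivial ∧ l c = true} : ℤ) := by
          exact_mod_cast this
        linarith

/-- If ψ were the boundary of a chain in F_i, the functional `sumAt` would be 0 on it. But it is 1,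
since the braidlike resolution occurs an odd number of times in `zs`. -/
theorem not_psiVanishes_of_detectsPsi {w : BraidWord n} {i : ℤ} {b : ℕ} {zs : List ℕ}
    (h : detectsPsi w i b zs = true) : ¬ PsiVanishes w i := by
  simp only [detectsPsi, Bool.and_eq_true, List.all_eq_true, decide_eq_true_iff] at h
  obtain ⟨⟨⟨h1, h2⟩, h3⟩, h4⟩ := h
  have hz : ∀ z ∈ zs, z < 2 ^ w.length := fun z hz => h3 z (List.mem_cons_of_mem _ hz)
  rw [psiVanishes_iff]
  rintro ⟨-, -, y, hy, e⟩
  have key : F w i ≤ LinearMap.ker (sumAt w zs ∘ₗ d w) := by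
    refine Submodule.span_le.2 ?_
    rintro _ ⟨x, hx, rfl⟩
    change sumAt w zs (d w (basisVec x)) = 0
    by_cases hE : ∃ z ∈ zs, ∃ j, EdgeTerm j x (allMinus (bitRes w z))
    · obtain ⟨z, hz', j, hj⟩ := hE
      have hzj : z.testBit j.val = true := by
        have := congrFun hj.2.1 j
        rwa [Function.update_self] at this
      have hpow : 2 ^ j.val < 2 ^ w.length := Nat.pow_lt_pow_right (by norm_num) j.isLt
      -- The edge ends at `z` and changes the crossing `j` from 0 to 1, so it begins at `z` with the
      -- digit `j` removed.
      refine sumAt_d_eq_zero (m := z ^^^ 2 ^ j.val) (Nat.xor_lt_two_pow (hz z hz') hpow) hz ?_ ?_ hx ?_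
      · have := h4 z hz' j (List.mem_finRange j)
        rwa [hzj, Bool.not_true, Bool.false_or] at this
      · funext k
        rw [bitRes, Nat.testBit_xor]
        by_cases hk : k = j
        · subst hk
          rw [hj.1, hzj]; simp
        · have := congrFun hj.2.1 k
          rw [Function.update_of_ne hk] at this
          rw [← this, Nat.testBit_two_pow_of_ne fun e => hk (Fin.ext e.symm), Bool.xor_false]
          rfl
      · rcases plus_of_edgeTerm hj with h | ⟨c, hc, h⟩
        · exact Or.inl h
        · exact Or.inr ⟨j, c, hc, h⟩
    · rw [sumAt_apply]
      refine List.sum_eq_zero fun a ha => ?_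
      obtain ⟨z, hz', rfl⟩ := List.mem_map.1 ha
      rw [d_basisVec, if_neg fun ⟨j, hj⟩ => hE ⟨z, hz', j, hj⟩]
  have h0 : sumAt w zs (d w y) = 0 := key hy
  rw [e, sumAt_apply, psi_eq] at h0
  simp only [basisVec_apply] at h0
  rw [countP_cast zs (fun z => z == b), ZMod.natCast_eq_zero_iff] at h0
  · have := Nat.mod_eq_zero_of_dvd h0
    rw [← List.count] at this
    rw [beq_iff_eq, this] at h2
    simp at h2
  · intro z hz'
    rw [beq_iff_eq, ← bitRes_of_isBraidlike h1]
    refine ⟨fun e => bitRes_inj (hz z hz') (h3 b List.mem_cons_self) (congrArg Gen.res e), ?_⟩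
    rintro rfl
    rfl

end BraidKh

namespace BraidKh
open FiltOps
variable {n : ℕ}

/-! ### The values of `κ` -/

theorem PsiVanishes.mono {w : BraidWord n} {i j : ℤ} (h : PsiVanishes w i) (hij : i ≤ j) :
    PsiVanishes w j := by
  rw [psiVanishes_iff] at h ⊢
  obtain ⟨h1, h2, y, hy, e⟩ := h
  exact ⟨(khOps w).mono hij h1, h2, y, (khOps w).mono hij hy, e⟩

theorem kappa_eq_of_psiVanishes {w : BraidWord n} {i : ℤ} (h : PsiVanishes w i)
    (h' : ¬ PsiVanishes w (i - 1)) : kappa w = (((n : ℤ) + i : ℤ) : WithTop ℤ) := by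
  have hr : psi w ∈ LinearMap.range (d w) := by
    obtain ⟨-, -, y, -, e⟩ := psiVanishes_iff.1 h
    exact ⟨y, e⟩
  have hs : {i : ℤ | PsiVanishes w i} = Set.Ici i := by
    ext j
    refine ⟨fun hj => ?_, h.mono⟩
    by_contra k
    rw [Set.mem_Ici, not_le] at k
    exact h' (PsiVanishes.mono hj (by omega))
  rw [kappa, if_pos hr, hs, csInf_Ici]

theorem kappa_append_comm (u v : BraidWord n) : kappa (n := n) (u ++ v) = kappa (n := n) (v ++ u) :=
  (KEquiv.append_comm u v).kappa_eq

/-- Far apart letters may be interchanged. -/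
theorem kappa_swap (u v : BraidWord n) {a b : Fin (n - 1) × Bool} (h : FarApart a b) :
    kappa (n := n) (u ++ a :: b :: v) = kappa (n := n) (u ++ b :: a :: v) := by
  rw [kappa_append_comm, kappa_append_comm u]
  exact (KEquiv.far (v ++ u) h).kappa_eq

/-- The point of a positive stabilization may be moved past a crossing that is far away from the
innermost strand. -/
theorem kappa_stabAt_succ (w : BraidWord (n + 1)) (t : Fin w.length)
    (h : (w.get t).1.val + 2 ≤ n) :
    kappa (w.stabAt t.castSucc) = kappa (w.stabAt t.succ) := by
  unfold BraidWord.stabAt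
  have h1 : w.drop t.castSucc = w.get t :: w.drop t.succ := by
    simp
  have h2 : w.take t.succ = w.take t.castSucc ++ [w.get t] := by
    simp
  rw [h1, h2]
  unfold BraidWord.lift
  rw [List.map_append, List.append_assoc]
  exact kappa_swap _ _ (Or.inr h)

/-- Positive stabilizations at the two ends of a word agree. -/
theorem kappa_stabAt_zero (w : BraidWord (n + 1)) :
    kappa (w.stabAt 0) = kappa (w.stabAt (Fin.last _)) := by
  unfold BraidWord.stabAt
  simp only [Fin.val_zero, List.take_zero, List.drop_zero, Fin.val_last, List.take_length,
    List.drop_length]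
  exact kappa_append_comm [lastCrossing n] _

/-- Resolutions are written in binary, and 1094 = 2 + 4 + 64 + 1024 has its digits at the negative
crossings. For the lower bound the coefficient at ψ is enough: an edge into the braidlike resolution
comes from one where two strands form a trivial circle. There n - 2 circles are non-trivial, so k ≥
-(n - 2). -/
theorem kappa_B00 : kappa B00 = 2 := by
  refine (kappa_eq_of_psiVanishes (i := -2) (psiVanishes_of_boundsPsi (m := 1094) (ts :=
    [(1057, [(0, 0), (1, 0), (1, 2), (1, 3)]), (546, [(0, 0), (3, 0), (1, 3)]),
    (578, [(0, 0), (3, 0), (1, 3)]), (1090, [(0, 0), (1, 0), (3, 0)]),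
    (224, [(0, 0), (3, 0), (1, 2), (1, 3)]), (352, [(0, 0), (3, 0), (1, 2), (1, 3)]),
    (608, [(0, 0), (3, 0), (1, 2), (1, 3)]), (1120, [(0, 0), (3, 0), (1, 2), (1, 3)]),
    (1568, [(0, 0), (3, 0), (1, 2), (1, 3)]), (448, [(0, 0), (3, 0), (1, 2), (0, 9)])])
    (by decide +kernel)) (not_psiVanishes_of_detectsPsi (b := 1094) (zs := [1094])
    (by decide +kernel))).trans ?_
  norm_num

/-- The chain is that for `B00` with digit 0 at the new crossing and v₋ on the new strand. In each
term the circle through p is labeled v₋, so the edge at the new crossing gives v₋v₋ = 0. -/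
theorem kappa_stabAt_one : kappa (BraidWord.stabAt (n := 3) B00 1) = 2 := by
  refine (kappa_eq_of_psiVanishes (i := -3) (psiVanishes_of_boundsPsi (m := 2188) (ts :=
    [(2113, [(0, 0), (1, 0), (4, 0), (1, 3), (1, 4)]), (1092, [(0, 0), (3, 0), (4, 0), (1, 4)]),
    (1156, [(0, 0), (3, 0), (4, 0), (1, 4)]), (2180, [(0, 0), (1, 0), (3, 0), (4, 0)]),
    (448, [(0, 0), (3, 0), (4, 0), (1, 3), (1, 4)]), (704, [(0, 0), (3, 0), (4, 0), (1, 3), (1, 4)]),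
    (1216, [(0, 0), (3, 0), (4, 0), (1, 3), (1, 4)]),
    (2240, [(0, 0), (3, 0), (4, 0), (1, 3), (1, 4)]),
    (3136, [(0, 0), (3, 0), (4, 0), (1, 3), (1, 4)]),
    (896, [(0, 0), (3, 0), (4, 0), (1, 3), (0, 10)])])
    (by decide +kernel)) (not_psiVanishes_of_detectsPsi (b := 2188) (zs := [2188])
    (by decide +kernel))).trans ?_
  norm_num


/-- The same chain as for `B00`, again with p on circles labeled v₋. All its terms have digit 0 at
letter number 4, so one list serves both points. -/
theorem kappa_stabAt_four_five {t : Fin (B00.length + 1)} (ht : t = 4 ∨ t = 5) :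
    kappa (BraidWord.stabAt (n := 3) B00 t) = 2 := by
  refine (kappa_eq_of_psiVanishes (i := -3) (psiVanishes_of_boundsPsi (m := 2182) (ts :=
    [(2113, [(0, 0), (1, 0), (4, 0), (1, 2), (1, 3)]), (1090, [(0, 0), (3, 0), (4, 0), (1, 3)]),
    (1154, [(0, 0), (3, 0), (4, 0), (1, 3)]), (2178, [(0, 0), (1, 0), (3, 0), (4, 0)]),
    (448, [(0, 0), (3, 0), (4, 0), (1, 2), (1, 3)]), (704, [(0, 0), (3, 0), (4, 0), (1, 2), (1, 3)]),
    (1216, [(0, 0), (3, 0), (4, 0), (1, 2), (1, 3)]),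
    (2240, [(0, 0), (3, 0), (4, 0), (1, 2), (1, 3)]),
    (3136, [(0, 0), (3, 0), (4, 0), (1, 2), (1, 3)]),
    (896, [(0, 0), (3, 0), (4, 0), (1, 2), (0, 10)])])
    (by rcases ht with rfl | rfl <;> decide +kernel)) (not_psiVanishes_of_detectsPsi (b := 2182)
    (zs := [2182]) (by rcases ht with rfl | rfl <;> decide +kernel))).trans ?_
  norm_num

/-- At 1057, which becomes 2114 here, the innermost strand is cut at the crossings 0 and 6 into two
circles, and the one through p is labeled v₊. The edge at the new crossing then leaves a term; the
first term of the list cancels it, with v₋ on this trivial circle and v₊ on the new strand, and this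
raises k from -3 to -1. For the lower bound the coefficient at ψ alone does not suffice: ψ occurs in
boundaries of generators with k = -3. The sixteen resolutions complete it to a functional that
vanishes on all boundaries of this level. -/
theorem kappa_stabAt_first : kappa (BraidWord.stabAt (n := 3) B00 0) = 4 := by
  refine (kappa_eq_of_psiVanishes (i := -1) (psiVanishes_of_boundsPsi (m := 2188) (ts :=
    [(2114, [(0, 0), (1, 0), (2, 0), (1, 3), (1, 4)]),
    (2114, [(0, 0), (1, 0), (4, 0), (1, 3), (1, 4)]), (1092, [(0, 0), (3, 0), (4, 0), (1, 4)]),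
    (1156, [(0, 0), (3, 0), (4, 0), (1, 4)]), (2180, [(0, 0), (1, 0), (3, 0), (4, 0)]),
    (448, [(0, 0), (3, 0), (4, 0), (1, 3), (1, 4)]), (704, [(0, 0), (3, 0), (4, 0), (1, 3), (1, 4)]),
    (1216, [(0, 0), (3, 0), (4, 0), (1, 3), (1, 4)]),
    (2240, [(0, 0), (3, 0), (4, 0), (1, 3), (1, 4)]),
    (3136, [(0, 0), (3, 0), (4, 0), (1, 3), (1, 4)]),
    (896, [(0, 0), (3, 0), (4, 0), (1, 3), (0, 10)])])
    (by decide +kernel)) (not_psiVanishes_of_detectsPsi (b := 2188) (zs :=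
    [652, 708, 712, 720, 2062, 2067, 2115, 2118, 2122, 2130, 2188, 2194, 2242, 2244, 2248, 2256])
    (by decide +kernel))).trans ?_
  norm_num

theorem kappa_stabAt_last : kappa (BraidWord.stabAt (n := 3) B00 (Fin.last _)) = 4 :=
  (kappa_stabAt_zero (n := 3) B00).symm.trans kappa_stabAt_first

/-- The innermost strand meets the letters number 0, 3, 4 and 6. So the levels 1 to 3, the level 4,
the levels 5 and 6, and the levels from 7 through the closure to 0 form the four arcs. Along an arc
the new crossing commutes with the letters that it passes. -/
theorem kappa_stabAt_B00 (t : Fin (B00.length + 1)) :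
    kappa (BraidWord.stabAt (n := 3) B00 t) = if t.val = 0 ∨ 7 ≤ t.val then 4 else 2 := by
  have move : ∀ (t : ℕ) (ht : t < B00.length), (B00.get ⟨t, ht⟩).1.val + 2 ≤ 3 →
      kappa (BraidWord.stabAt (n := 3) B00 ⟨t, Nat.lt_succ_of_lt ht⟩) =
        kappa (BraidWord.stabAt (n := 3) B00 ⟨t + 1, Nat.succ_lt_succ ht⟩) :=
    fun t ht => kappa_stabAt_succ (n := 3) B00 ⟨t, ht⟩
  have h11 : kappa (BraidWord.stabAt (n := 3) B00 11) = 4 := kappa_stabAt_last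
  have h10 : kappa (BraidWord.stabAt (n := 3) B00 10) = 4 := (move 10 (by decide) (by decide)).trans h11
  have h9 : kappa (BraidWord.stabAt (n := 3) B00 9) = 4 := (move 9 (by decide) (by decide)).trans h10
  have h8 : kappa (BraidWord.stabAt (n := 3) B00 8) = 4 := (move 8 (by decide) (by decide)).trans h9
  have h7 : kappa (BraidWord.stabAt (n := 3) B00 7) = 4 := (move 7 (by decide) (by decide)).trans h8
  have h5 := kappa_stabAt_four_five (t := 5) (Or.inr rfl)
  have h6 : kappa (BraidWord.stabAt (n := 3) B00 6) = 2 := (move 5 (by decide) (by decide)).symm.trans h5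
  have h2 : kappa (BraidWord.stabAt (n := 3) B00 2) = 2 :=
    (move 1 (by decide) (by decide)).symm.trans kappa_stabAt_one
  have h3 : kappa (BraidWord.stabAt (n := 3) B00 3) = 2 := (move 2 (by decide) (by decide)).symm.trans h2
  have h4 := kappa_stabAt_four_five (t := 4) (Or.inl rfl)
  obtain ⟨t, ht⟩ := t
  have ht' : t < 12 := ht
  interval_cases t
  · exact kappa_stabAt_first.trans (if_pos (by simp)).symm
  · exact kappa_stabAt_one.trans (if_neg (by simp)).symm
  · exact h2.trans (if_neg (by simp)).symm
  · exact h3.trans (if_neg (by simp)).symm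
  · exact h4.trans (if_neg (by simp)).symm
  · exact h5.trans (if_neg (by simp)).symm
  · exact h6.trans (if_neg (by simp)).symm
  · exact h7.trans (if_pos (by simp)).symm
  · exact h8.trans (if_pos (by simp)).symm
  · exact h9.trans (if_pos (by simp)).symm
  · exact h10.trans (if_pos (by simp)).symm
  · exact h11.trans (if_pos (by simp)).symm

end BraidKh

end

/-! ### The theorem. -/

theorem mainTheorem1 :
    ∃ K : ∀ n : ℕ, BraidKh.BraidGroup n → WithTop ℤ,
      -- `κ` is well defined on `B_n`
      (∀ (n : ℕ) (w : BraidKh.BraidWord n), K n w.toBraid = BraidKh.kappa w) ∧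
      -- it is constant on conjugacy classes
      (∀ (n : ℕ) (β β' : BraidKh.BraidGroup n), IsConj β β' → K n β = K n β') ∧
      -- it is not a transverse invariant
      (¬ ∀ a b : (Σ n : ℕ, BraidKh.BraidGroup n),
        BraidKh.TransverseEquiv a b → K a.1 a.2 = K b.1 b.2) ∧
      -- it can increase by exactly 2 under positive stabilization
      (∃ (n : ℕ) (w : BraidKh.BraidWord (n + 1)) (t : Fin (w.length + 1)),
        K (n + 1) w.toBraid ≠ ⊤ ∧
        K (n + 2) (w.stabAt t).toBraid = K (n + 1) w.toBraid + 2) ∧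
      -- the example: `κ(B(0,0)) = 2`, and the values of `κ(S^p B(0,0))` at all innermost points
      K 4 BraidKh.B00.toBraid = 2 ∧
      (∀ t : Fin (BraidKh.B00.length + 1),
        K 5 (BraidKh.BraidWord.stabAt (n := 3) BraidKh.B00 t).toBraid =
          if t.val = 0 ∨ 7 ≤ t.val then 4 else 2) := by
  refine ⟨BraidKh.braidKappa, fun n w => BraidKh.braidKappa_toBraid w,
    fun n β β' h => BraidKh.braidKappa_isConj h, fun h => ?_,
    ⟨3, BraidKh.B00, Fin.last _, ?_, ?_⟩, ?_, fun t => ?_⟩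
  -- Stabilization at the end of the word `B00` changes the value from 2 to 4.
  · have := h _ _ (.rel _ _ (BraidKh.TransverseMove.stab (n := 3) BraidKh.B00))
    simp only [BraidKh.braidKappa_toBraid] at this
    rw [BraidKh.kappa_stabAt_last] at this
    erw [BraidKh.kappa_B00] at this
    exact absurd (WithTop.coe_injective (a₁ := (2 : ℤ)) (a₂ := 4) this) (by decide)
  · rw [BraidKh.braidKappa_toBraid]
    erw [BraidKh.kappa_B00]
    exact WithTop.coe_ne_top (a := (2 : ℤ))
  · rw [BraidKh.braidKappa_toBraid, BraidKh.braidKappa_toBraid, BraidKh.kappa_stabAt_last]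
    erw [BraidKh.kappa_B00]
    norm_num
  · rw [BraidKh.braidKappa_toBraid, BraidKh.kappa_B00]
  · rw [BraidKh.braidKappa_toBraid, BraidKh.kappa_stabAt_B00]
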